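/- Let $-1\le a_1<a_2<a_3<a_4\le 1$ and $\Gamma=[-1,a_1]\cup[a_2,a_3]\cup[a_4,1]$. Let $R_0(z)=\sqrt{z^2-1}$ on $\mathbb C\setminus[-1,1]$ with $R_0(z)\sim z$ as $z\to\infty$, and put $R_0(\zeta)=i\sqrt{1-\zeta^2}$ for $\zeta\in[-1,1]$. The genus-one defocusing NLS soliton condensate with spectral support $\Gamma$ is described by its density of states $u$ and density of fluxes $v$: real integrable functions on $\Gamma$ which solve the nonlinear dispersion relations with zero spectral scaling function, $$\int_\Gamma \ln\left|\frac{R_0(z)R_0(w)+wz-1}{z-w}\right|u(w)\,dw=|R_0(z)|,\qquad \int_\Gamma \ln\left|\frac{R_0(z)R_0(w)+wz-1}{z-w}\right|v(w)\,dw=2z|R_0(z)|,\qquad z\in\Gamma,$$ the integrals being absolutely convergent. The associated quasimomentum and quasienergy densities are $$\frac{dp}{dz}=\frac{z}{R_0(z)}-\frac{i}{R_0(z)}\int_\Gamma\frac{u(\zeta)R_0(\zeta)}{\zeta-z}\,d\zeta=1-\sum_{m\ge1}\frac{I_m}{z^{m+1}},$$ $$\frac{dq}{dz}=2R_0(z)+\frac{2z^2}{R_0(z)}-\frac{i}{R_0(z)}\int_\Gamma\frac{v(\zeta)R_0(\zeta)}{\zeta-z}\,d\zeta=4z-\sum_{m\ge1}\frac{J_m}{z^{m+1}}\qquad(z\to\infty).$$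 The averaged densities and fluxes of the condensate are defined by $$\langle|\psi|^2\rangle=-2I_1,\qquad \langle|\psi|^4+|\psi_x|^2\rangle=-\tfrac83 I_3,\qquad \langle|\psi|^4+2|\psi_x|^2\rangle=-2J_2,$$ so that $\langle|\psi|^4\rangle=-\tfrac{16}{3}I_3+2J_2$, and the kurtosis is $\kappa=\langle|\psi|^4\rangle/\langle|\psi|^2\rangle^2$. Theorem. Such a pair $(u,v)$ exists, and for every such pair $\langle|\psi|^2\rangle>0$, $C\mu+D\neq0$ and $$\kappa=\frac{A\mu+B}{3(C\mu+D)^2},$$ where $$\mu=\frac{E(m)}{K(m)},\qquad m=\frac{(a_3-a_4)(a_1-a_2)}{(a_2-a_4)(a_1-a_3)},$$ $$E(m)=\int_0^{\pi/2}\sqrt{1-m\sin^2y}\,dy,\qquad K(m)=\int_0^{\pi/2}\frac{dy}{\sqrt{1-m\sin^2y}},$$ $$A=-8(a_2-a_4)(a_1-a_3)\Big(4\sum_{j=1}^4a_j^2-\Big(\sum_{j=1}^4a_j\Big)^2\Big),$$ $$\begin{aligned}B={}&3a_1^4+(12a_2-12a_3-12a_4)a_1^3\\&+\big(2a_2^2+(-20a_3-20a_4)a_2+18a_3^2+20a_4a_3+18a_4^2\big)a_1^2\\&+\big(12a_2^3-4(a_3+a_4)(5a_2^2-5a_3a_2-5a_4a_2+3a_3^2+2a_4a_3+3a_4^2)\big)a_1\\&+3a_2^4+(-12a_3-12a_4)a_2^3+(18a_3^2+20a_4a_3+18a_4^2)a_2^2\\&+(-12a_3^3-20a_3^2a_4-20a_3a_4^2-12a_4^3)a_2\\&+3a_3^4+12a_3^3a_4+2a_3^2a_4^2+12a_3a_4^3+3a_4^4,\end{aligned}$$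 $$C=4(a_2-a_4)(a_1-a_3),\qquad D=-(a_1+a_2-a_3-a_4)^2.$$ -/

import Mathlib

open MeasureTheory Set

noncomputable section

namespace DefNLS

/-- Complete elliptic integral of the first kind, as a function of the parameter `m`. -/
def ellipticK (m : ℝ) : ℝ := ∫ y in (0 : ℝ)..(Real.pi / 2), 1 / √(1 - m * Real.sin y ^ 2)

/-- Complete elliptic integral of the second kind, as a function of the parameter `m`. -/
def ellipticE (m : ℝ) : ℝ := ∫ y in (0 : ℝ)..(Real.pi / 2), √(1 - m * Real.sin y ^ 2)

/-- `R₀(z) = (z² - 1)^{1/2}` on `ℂ \ [-1, 1]`, with the branch `R₀(z) ∼ z` at infinity: since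
`1 - 1/z²` is a non-positive real only for `z ∈ [-1, 1]`, the principal square root is analytic
there. -/
def R₀ (z : ℂ) : ℂ := z * (1 - 1 / z ^ 2) ^ (1 / 2 : ℂ)

/-- `|R₀(z)| = √(1 - z²)` on the cut `[-1, 1]`. -/
def absR₀ (z : ℝ) : ℝ := √(1 - z ^ 2)

/-- The value of `R₀` on the cut `[-1, 1]` (boundary value from the upper half plane). -/
def R₀cut (z : ℝ) : ℂ := Complex.I * (absR₀ z : ℂ)

/-- The kernel `log |(R₀(z) R₀(w) + w z - 1) / (z - w)|` of the nonlinear dispersion relations.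
For `z, w ∈ [-1, 1]` one has `R₀(z) R₀(w) = - |R₀(z)| |R₀(w)|`. -/
def kernel (z w : ℝ) : ℝ := Real.log |(-(absR₀ z * absR₀ w) + w * z - 1) / (z - w)|

/-- `u` is an integrable function on `Γ` which satisfies
`∫_Γ log |(R₀(z) R₀(w) + w z - 1) / (z - w)| u(w) dw + σ(z) u(z) = f(z)` for `z ∈ Γ`. -/
structure SolvesNDR (Γ : Set ℝ) (σ f u : ℝ → ℝ) : Prop where
  integrableOn : IntegrableOn u Γ
  kernel_integrableOn : ∀ z ∈ Γ, IntegrableOn (fun w => kernel z w * u w) Γ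
  equation : ∀ z ∈ Γ, (∫ w in Γ, kernel z w * u w) + σ z * u z = f z

/-- `u` is the density of states of the soliton gas with spectral support `Γ` and spectral scaling
function `σ`: it solves the first nonlinear dispersion relation. -/
def IsDOS (Γ : Set ℝ) (σ u : ℝ → ℝ) : Prop := SolvesNDR Γ σ absR₀ u

/-- `v` is the density of fluxes of the soliton gas with spectral support `Γ` and spectral scaling
function `σ`: it solves the second nonlinear dispersion relation. -/
def IsDOF (Γ : Set ℝ) (σ v : ℝ → ℝ) : Prop := SolvesNDR Γ σ (fun z => 2 * z * absR₀ z) v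

/-- `u` and `v` are the densities of states and of fluxes of the soliton condensate on `Γ`, that is,
of the soliton gas with `σ ≡ 0`. -/
structure IsCondensate (Γ : Set ℝ) (u v : ℝ → ℝ) : Prop where
  dos : IsDOS Γ (fun _ => 0) u
  dof : IsDOF Γ (fun _ => 0) v

/-- The density `dp/dz` of the quasimomentum differential of a soliton gas with density of
states `u` on `Γ`. -/
def dpdz (Γ : Set ℝ) (u : ℝ → ℝ) (z : ℂ) : ℂ :=
  z / R₀ z - Complex.I / R₀ z * ∫ ζ in Γ, (u ζ : ℂ) * R₀cut ζ / ((ζ : ℂ) - z)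

/-- The density `dq/dz` of the quasienergy differential of a soliton gas with density of
fluxes `v` on `Γ`. -/
def dqdz (Γ : Set ℝ) (v : ℝ → ℝ) (z : ℂ) : ℂ :=
  2 * R₀ z + 2 * z ^ 2 / R₀ z
    - Complex.I / R₀ z * ∫ ζ in Γ, (v ζ : ℂ) * R₀cut ζ / ((ζ : ℂ) - z)

/-- The coefficient of `z ^ (-(m + 1))` in the Laurent expansion at infinity of a function `f`
that is analytic for `|z| > 1`. -/
def laurentCoeff (f : ℂ → ℂ) (m : ℕ) : ℂ :=
  (2 * (Real.pi : ℂ) * Complex.I)⁻¹ * circleIntegral (fun z => z ^ m * f z) 0 2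

/-- `I_m`: `dp/dz = 1 - ∑_{m ≥ 1} I_m / z ^ (m + 1)` at infinity; `I_m` is real. -/
def coeffI (Γ : Set ℝ) (u : ℝ → ℝ) (m : ℕ) : ℝ := (-laurentCoeff (dpdz Γ u) m).re

/-- `J_m`: `dq/dz = 4 z - ∑_{m ≥ 1} J_m / z ^ (m + 1)` at infinity; `J_m` is real. -/
def coeffJ (Γ : Set ℝ) (v : ℝ → ℝ) (m : ℕ) : ℝ := (-laurentCoeff (dqdz Γ v) m).re

/-- The average of the density `f₁ = |ψ|²`. -/
def meanF₁ (Γ : Set ℝ) (u : ℝ → ℝ) : ℝ := -2 * coeffI Γ u 1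

/-- The average of the density `f₃ = |ψ|⁴ + |ψ_x|²`. -/
def meanF₃ (Γ : Set ℝ) (u : ℝ → ℝ) : ℝ := -(8 / 3) * coeffI Γ u 3

/-- The average of the flux `g₂ = |ψ|⁴ + 2 |ψ_x|²`. -/
def meanG₂ (Γ : Set ℝ) (v : ℝ → ℝ) : ℝ := -2 * coeffJ Γ v 2

/-- The average of `|ψ|²`. -/
def meanSq (Γ : Set ℝ) (u : ℝ → ℝ) : ℝ := meanF₁ Γ u

/-- The average of `|ψ|⁴ = 2 f₃ - g₂`. -/
def meanFourth (Γ : Set ℝ) (u v : ℝ → ℝ) : ℝ := 2 * meanF₃ Γ u - meanG₂ Γ v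

/-- The kurtosis: the average of `|ψ|⁴` over the square of the average of `|ψ|²`. -/
def kurtosis (Γ : Set ℝ) (u v : ℝ → ℝ) : ℝ := meanFourth Γ u v / meanSq Γ u ^ 2

/-- The spectral support `[-1, a₁] ∪ [a₂, a₃] ∪ [a₄, 1]` of a genus one condensate. -/
def genusOneSupport (a₁ a₂ a₃ a₄ : ℝ) : Set ℝ := Icc (-1) a₁ ∪ Icc a₂ a₃ ∪ Icc a₄ 1

end DefNLS

end

/-! ### Fourth-order Taylor expansions and residues read off from them. -/

namespace DefNLS

open Filter Topology Asymptotics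

/-! The map `z = (ζ + 1/ζ)/2` takes the unit disc to the plane cut along `[-1, 1]`. For `z = cos α`
and `η = exp(iα)`, the kernel is the real boundary value of `log(1 - ζη) - log(1 - ζη̄)`, which is
analytic in the disc. Its imaginary part on the upper semicircle is piecewise constant and jumps
only at `x = z`. The form `N(x) dx / √∏(x - aⱼ)`, with `N` a polynomial, is real on the bands and
imaginary on the gaps. Multiplying the two, integrating over the circle and taking real parts gives
the potential on the bands of the density `N / (π √∏(x - aⱼ))`, plus constants times the integrals
of `N` over the two gaps. All of this equals a residue at `ζ = 0`. If both gap integrals vanish, the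
potential is therefore an explicit polynomial in `z` times `|R₀(z)|` (`Branches.band_identity`,
`Branches.integral_kernel_mul`).

A quadratic numerator without residue at infinity has equal integrals over the two gaps. Its
constant term `c` is fixed by making the first one zero, and a Möbius substitution expresses `c`
through `μ = E/K` (`Branches.gapIntegral_eq`, `Branches.gapIntegral_quasimomentum`). Adding exact
differentials `d(p √(-∏(x - aⱼ)))` produces numerators of higher degree whose gap integrals vanish
too. In this way `momentumNum`, `energyNum` and `secondNum` have the potentials `|R₀|`, `2z|R₀|` and
`z²|R₀|`. The first two give existence of the condensate.

Uniqueness of `(u, v)` is not needed. The Laurent coefficients at infinity involve `u` and `v` only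
through `∫ u|R₀|`, `∫ u x²|R₀|` and `∫ v x|R₀|`, and each of these weights is, up to a factor, the
potential of an explicit density. Symmetry of the kernel (`setIntegral_kernel_swap`) moves the
kernel from the explicit density to the unknown solution, where the dispersion relation evaluates
it. What remains is a moment of an explicit density against `|R₀|`, again a residue
(`Branches.integral_absR₀_mul`).

The averages come out as `⟨|ψ|²⟩ = -(Cμ + D)/4` and `⟨|ψ|⁴⟩ = (Aμ + B)/48`. The sign of the first
follows from `μ < 1`, `C > 0` and `C + D = -((a₄ - a₂) - (a₃ - a₁))²`. -/

/-- `f(z) = c₀ + c₁ z + c₂ z² + c₃ z³ + c₄ z⁴ + O(z⁵)` as `z → 0`, `z ≠ 0`. -/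
def HasTaylor (f : ℂ → ℂ) (c₀ c₁ c₂ c₃ c₄ : ℂ) : Prop :=
  (fun z => f z - (c₀ + c₁ * z + c₂ * z ^ 2 + c₃ * z ^ 3 + c₄ * z ^ 4))
    =O[𝓝[≠] 0] fun z : ℂ => z ^ 5

theorem isBigO_one_of_continuous {f : ℂ → ℂ} (hf : Continuous f) :
    f =O[𝓝[≠] 0] fun _ : ℂ => (1 : ℂ) :=
  (hf.tendsto 0).mono_left nhdsWithin_le_nhds |>.isBigO_one ℂ

theorem HasTaylor.of_eq {f g : ℂ → ℂ} {c₀ c₁ c₂ c₃ c₄ d₀ d₁ d₂ d₃ d₄ : ℂ}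
    (hf : HasTaylor f c₀ c₁ c₂ c₃ c₄) (hfg : ∀ z, z ≠ 0 → g z = f z)
    (h₀ : d₀ = c₀) (h₁ : d₁ = c₁) (h₂ : d₂ = c₂) (h₃ : d₃ = c₃) (h₄ : d₄ = c₄) :
    HasTaylor g d₀ d₁ d₂ d₃ d₄ := by
  subst h₀ h₁ h₂ h₃ h₄
  refine IsBigO.congr' hf ?_ EventuallyEq.rfl
  filter_upwards [self_mem_nhdsWithin] with z hz
  rw [hfg z hz]

theorem hasTaylor_poly (c₀ c₁ c₂ c₃ c₄ : ℂ) :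
    HasTaylor (fun z => c₀ + c₁ * z + c₂ * z ^ 2 + c₃ * z ^ 3 + c₄ * z ^ 4) c₀ c₁ c₂ c₃ c₄ := by
  simp only [HasTaylor, sub_self]
  exact isBigO_zero _ _

theorem HasTaylor.isBigO_one {f : ℂ → ℂ} {c₀ c₁ c₂ c₃ c₄ : ℂ}
    (hf : HasTaylor f c₀ c₁ c₂ c₃ c₄) : f =O[𝓝[≠] 0] fun _ : ℂ => (1 : ℂ) := by
  have h1 : (fun z : ℂ => z ^ 5) =O[𝓝[≠] 0] fun _ : ℂ => (1 : ℂ) :=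
    isBigO_one_of_continuous (continuous_pow 5)
  have h2 := (IsBigO.trans hf h1).add (isBigO_one_of_continuous
    (f := fun z : ℂ => c₀ + c₁ * z + c₂ * z ^ 2 + c₃ * z ^ 3 + c₄ * z ^ 4) (by fun_prop))
  simpa using h2

theorem HasTaylor.add {f g : ℂ → ℂ} {c₀ c₁ c₂ c₃ c₄ d₀ d₁ d₂ d₃ d₄ : ℂ}
    (hf : HasTaylor f c₀ c₁ c₂ c₃ c₄) (hg : HasTaylor g d₀ d₁ d₂ d₃ d₄) :
    HasTaylor (fun z => f z + g z) (c₀ + d₀) (c₁ + d₁) (c₂ + d₂) (c₃ + d₃) (c₄ + d₄) := by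
  refine (IsBigO.add hf hg).congr_left fun z => ?_
  ring

theorem HasTaylor.mul {f g : ℂ → ℂ} {c₀ c₁ c₂ c₃ c₄ d₀ d₁ d₂ d₃ d₄ : ℂ}
    (hf : HasTaylor f c₀ c₁ c₂ c₃ c₄) (hg : HasTaylor g d₀ d₁ d₂ d₃ d₄) :
    HasTaylor (fun z => f z * g z) (c₀ * d₀) (c₀ * d₁ + c₁ * d₀) (c₀ * d₂ + c₁ * d₁ + c₂ * d₀)
      (c₀ * d₃ + c₁ * d₂ + c₂ * d₁ + c₃ * d₀)
      (c₀ * d₄ + c₁ * d₃ + c₂ * d₂ + c₃ * d₁ + c₄ * d₀) := by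
  have h1 := hf.isBigO_one.mul hg
  have h2 := (isBigO_one_of_continuous
    (f := fun z : ℂ => d₀ + d₁ * z + d₂ * z ^ 2 + d₃ * z ^ 3 + d₄ * z ^ 4) (by fun_prop)).mul hf
  have h3 := (isBigO_one_of_continuous
    (f := fun z : ℂ => (c₁ * d₄ + c₂ * d₃ + c₃ * d₂ + c₄ * d₁) + (c₂ * d₄ + c₃ * d₃ + c₄ * d₂) * z
      + (c₃ * d₄ + c₄ * d₃) * z ^ 2 + c₄ * d₄ * z ^ 3) (by fun_prop)).mul
    (isBigO_refl (fun z : ℂ => z ^ 5) (𝓝[≠] 0))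
  refine (((h1.add h2).add h3).congr_left fun z => ?_).trans (by simpa using isBigO_refl _ _)
  ring

/-- Let `t` be the binomial series of `h^(-1/2)` truncated at order four, so that `t² h - 1 =
O(z⁵)`. From `g² h = 1` one gets `(g - t)(g + t) h = 1 - t² h`. The limit `g → 1` selects the
branch: it makes `(g + t) h` tend to `2`, and the error of `t² h` passes to `g - t`. -/
theorem hasTaylor_of_sq_mul_eq_one {g h : ℂ → ℂ} {h₁ h₂ h₃ h₄ : ℂ}
    (hh : HasTaylor h 1 h₁ h₂ h₃ h₄) (hg : Tendsto g (𝓝[≠] 0) (𝓝 1))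
    (hgh : ∀ᶠ z in 𝓝[≠] 0, g z ^ 2 * h z = 1) :
    HasTaylor g 1 (-h₁ / 2) (-h₂ / 2 + 3 / 8 * h₁ ^ 2)
      (-h₃ / 2 + 3 / 4 * h₁ * h₂ - 5 / 16 * h₁ ^ 3)
      (-h₄ / 2 + 3 / 8 * (h₂ ^ 2 + 2 * h₁ * h₃) - 15 / 16 * h₁ ^ 2 * h₂ + 35 / 128 * h₁ ^ 4) := by
  set t : ℂ → ℂ := fun z => 1 + (-h₁ / 2) * z + (-h₂ / 2 + 3 / 8 * h₁ ^ 2) * z ^ 2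
    + (-h₃ / 2 + 3 / 4 * h₁ * h₂ - 5 / 16 * h₁ ^ 3) * z ^ 3
    + (-h₄ / 2 + 3 / 8 * (h₂ ^ 2 + 2 * h₁ * h₃) - 15 / 16 * h₁ ^ 2 * h₂ + 35 / 128 * h₁ ^ 4) * z ^ 4
    with ht
  have ht5 : HasTaylor t _ _ _ _ _ := hasTaylor_poly _ _ _ _ _
  have hth : HasTaylor (fun z => t z * t z * h z) 1 0 0 0 0 := by
    refine ((ht5.mul ht5).mul hh).of_eq (fun z _ => rfl) ?_ ?_ ?_ ?_ ?_ <;> ring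
  have hh1 : Tendsto h (𝓝[≠] 0) (𝓝 1) := by
    have hp : Tendsto (fun z : ℂ => 1 + h₁ * z + h₂ * z ^ 2 + h₃ * z ^ 3 + h₄ * z ^ 4)
        (𝓝[≠] 0) (𝓝 1) := by
      refine (Continuous.tendsto' ?_ 0 1 (by simp)).mono_left nhdsWithin_le_nhds
      fun_prop
    have h0 : Tendsto (fun z : ℂ => z ^ 5) (𝓝[≠] 0) (𝓝 0) :=
      (Continuous.tendsto' (continuous_pow 5) 0 0 (by simp)).mono_left nhdsWithin_le_nhds
    have := (IsBigO.trans_tendsto hh h0).add hp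
    simpa using this
  have ht1 : Tendsto t (𝓝[≠] 0) (𝓝 1) := by
    refine (Continuous.tendsto' ?_ 0 1 (by simp [ht])).mono_left nhdsWithin_le_nhds
    fun_prop
  have hden : Tendsto (fun z => ((g z + t z) * h z)⁻¹) (𝓝[≠] 0) (𝓝 ((1 + 1) * 1)⁻¹) :=
    ((hg.add ht1).mul hh1).inv₀ (by norm_num)
  have hne : ∀ᶠ z in 𝓝[≠] 0, (g z + t z) * h z ≠ 0 :=
    ((hg.add ht1).mul hh1).eventually_ne (by norm_num)
  have := ((hden.isBigO_one ℂ).mul hth).neg_left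
  refine this.congr' ?_ ?_
  · filter_upwards [hne, hgh] with z hz hz2
    have : ((g z + t z) * h z)⁻¹ * (t z * t z * h z - 1) = -(g z - t z) := by
      rw [inv_mul_eq_div, div_eq_iff hz]
      linear_combination hz2
    simp only [ht] at this ⊢
    linear_combination -this
  · filter_upwards with z
    ring

theorem hasTaylor_log (η : ℂ) : HasTaylor (fun z => Complex.log (1 - z * η)) 0 (-η) (-η ^ 2 / 2)
    (-η ^ 3 / 3) (-η ^ 4 / 4) := by
  have h := Complex.log_sub_logTaylor_isBigO 4
  have ht : Tendsto (fun z : ℂ => -(z * η)) (𝓝[≠] 0) (𝓝 0) := by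
    refine (Continuous.tendsto' ?_ 0 0 (by simp)).mono_left nhdsWithin_le_nhds
    fun_prop
  have h2 := h.comp_tendsto ht
  have h3 : (fun z : ℂ => (-(z * η)) ^ 5) =O[𝓝[≠] 0] fun z : ℂ => z ^ 5 := by
    refine ((isBigO_refl (fun z : ℂ => z ^ 5) (𝓝[≠] 0)).const_mul_left (-η ^ 5)).congr_left ?_
    intro z; ring
  refine (h2.trans h3).congr_left fun z => ?_
  simp only [Function.comp, Complex.logTaylor_succ, Complex.logTaylor_zero, Pi.add_apply]
  rw [← sub_eq_add_neg]
  norm_num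
  ring

theorem circleIntegral_laurent (r : ℝ) (n : ℤ) (c : ℂ) (hn : n ≠ -1) :
    (∮ z in C(0, r), c * z ^ n) = 0 := by
  rw [circleIntegral.integral_const_mul]
  have := circleIntegral.integral_sub_zpow_of_ne hn 0 0 r
  simp only [sub_zero] at this
  rw [this, mul_zero]

theorem circleIntegral_inv (r : ℝ) (hr : 0 < r) (c : ℂ) :
    (∮ z in C(0, r), c * z ^ (-1 : ℤ)) = 2 * Real.pi * Complex.I * c := by
  rw [circleIntegral.integral_const_mul]
  have := circleIntegral.integral_sub_inv_of_mem_ball (c := 0) (w := 0) (R := r) (by simpa using hr)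
  simp only [sub_zero] at this
  simp only [zpow_neg_one]
  rw [this]; ring

theorem circleIntegrable_laurent (r : ℝ) (hr : 0 < r) (n : ℤ) (c : ℂ) :
    CircleIntegrable (fun z => c * z ^ n) 0 r := by
  apply ContinuousOn.circleIntegrable hr.le
  intro z hz
  have : z ≠ 0 := by
    rintro rfl
    simp at hz; exact hr.ne hz
  exact (continuousAt_const.mul (continuousAt_zpow₀ z n (Or.inl this))).continuousWithinAt

theorem circleIntegral_laurent₅ (r : ℝ) (hr : 0 < r) (c₀ c₁ c₂ c₃ c₄ : ℂ) (n₀ n₁ n₂ n₃ : ℤ)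
    (h₀ : n₀ ≠ -1) (h₁ : n₁ ≠ -1) (h₂ : n₂ ≠ -1) (h₃ : n₃ ≠ -1) :
    CircleIntegrable (fun z => c₀ * z ^ n₀ + c₁ * z ^ n₁ + c₂ * z ^ n₂ + c₃ * z ^ n₃
      + c₄ * z ^ (-1 : ℤ)) 0 r ∧
    (∮ z in C(0, r), (c₀ * z ^ n₀ + c₁ * z ^ n₁ + c₂ * z ^ n₂ + c₃ * z ^ n₃
      + c₄ * z ^ (-1 : ℤ))) = 2 * Real.pi * Complex.I * c₄ := by
  have i := circleIntegrable_laurent r hr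
  have j0 := i n₀ c₀
  have j1 : CircleIntegrable (fun z => c₀ * z ^ n₀ + c₁ * z ^ n₁) 0 r := j0.add (i n₁ c₁)
  have j2 : CircleIntegrable (fun z => c₀ * z ^ n₀ + c₁ * z ^ n₁ + c₂ * z ^ n₂) 0 r :=
    j1.add (i n₂ c₂)
  have j3 : CircleIntegrable (fun z => c₀ * z ^ n₀ + c₁ * z ^ n₁ + c₂ * z ^ n₂ + c₃ * z ^ n₃) 0 r :=
    j2.add (i n₃ c₃)
  refine ⟨j3.add (i (-1) c₄), ?_⟩
  rw [circleIntegral.integral_add j3 (i _ _), circleIntegral.integral_add j2 (i _ _),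
    circleIntegral.integral_add j1 (i _ _), circleIntegral.integral_add j0 (i _ _),
    circleIntegral_laurent r _ _ h₀, circleIntegral_laurent r _ _ h₁,
    circleIntegral_laurent r _ _ h₂, circleIntegral_laurent r _ _ h₃,
    circleIntegral_inv r hr]
  ring

/-- Shrink the circle to radius `ρ`. After subtracting the principal part of a pole of order at most
five, the integrand is bounded, so the difference of integrals is `O(ρ)`. Order five suffices later:
a quartic numerator contributes `ζ⁻⁴` and the factor `G` at most `ζ⁻¹`. -/
theorem circleIntegral_eq_residue {f : ℂ → ℂ} {c₀ c₁ c₂ c₃ c₄ : ℂ}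
    (hd : ∀ z, ‖z‖ < 1 → z ≠ 0 → DifferentiableAt ℂ f z)
    (hT : HasTaylor (fun z => z ^ 5 * f z) c₀ c₁ c₂ c₃ c₄) {r : ℝ} (hr : 0 < r) (hr1 : r < 1) :
    (∮ z in C(0, r), f z) = 2 * Real.pi * Complex.I * c₄ := by
  obtain ⟨K, hK⟩ := hT.bound
  rw [eventually_nhdsWithin_iff, Metric.eventually_nhds_iff] at hK
  obtain ⟨ε, hε, hK⟩ := hK
  have key : ∀ ρ, 0 < ρ → ρ < ε → ρ ≤ r →
      ‖(∮ z in C(0, r), f z) - 2 * Real.pi * Complex.I * c₄‖ ≤ 2 * Real.pi * ρ * K := by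
    intro ρ h0 h1 h2
    have e1 : (∮ z in C(0, r), f z) = ∮ z in C(0, ρ), f z := by
      apply Complex.circleIntegral_eq_of_differentiable_on_annulus_off_countable h0 h2
        countable_empty
      · intro z hz
        simp only [Set.mem_sdiff, Metric.mem_closedBall, dist_zero_right, Metric.mem_ball, not_lt] at hz
        refine (hd z (by linarith) ?_).continuousAt.continuousWithinAt
        rintro rfl; simp at hz; linarith
      · intro z hz
        simp only [Set.mem_sdiff, Metric.mem_closedBall, dist_zero_right, Metric.mem_ball, not_le] at hz
        refine hd z (by linarith) ?_
        rintro rfl; simp at hz; linarith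
    obtain ⟨i1, i2⟩ := circleIntegral_laurent₅ ρ h0 c₀ c₁ c₂ c₃ c₄ (-5) (-4) (-3) (-2)
      (by norm_num) (by norm_num) (by norm_num) (by norm_num)
    have i3 : CircleIntegrable f 0 ρ := by
      apply ContinuousOn.circleIntegrable h0.le
      intro z hz
      have hz' : ‖z‖ = ρ := by simpa using hz
      refine (hd z (by linarith) ?_).continuousAt.continuousWithinAt
      rintro rfl; simp at hz'; linarith
    rw [e1, ← i2, ← circleIntegral.integral_sub i3 i1]
    apply circleIntegral.norm_integral_le_of_norm_le_const h0.le
    intro z hz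
    have hz' : ‖z‖ = ρ := by simpa using hz
    have hz0 : z ≠ 0 := by
      rintro rfl; simp at hz'; linarith
    have hb := hK (y := z) (by simpa [hz'] using h1) hz0
    have h5 : 0 < ‖z ^ 5‖ := norm_pos_iff.mpr (pow_ne_zero _ hz0)
    rw [← mul_le_mul_iff_right₀ h5, ← norm_mul, mul_comm ‖z ^ 5‖ K]
    refine le_of_eq_of_le (congrArg _ ?_) hb
    rw [zpow_neg, zpow_neg, zpow_neg, zpow_neg, zpow_neg]
    norm_cast
    field_simp
  have lim : Tendsto (fun ρ : ℝ => 2 * Real.pi * ρ * K) (𝓝[>] 0) (𝓝 0) := by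
    refine (Continuous.tendsto' ?_ 0 0 (by simp)).mono_left nhdsWithin_le_nhds
    fun_prop
  have : ‖(∮ z in C(0, r), f z) - 2 * Real.pi * Complex.I * c₄‖ ≤ 0 := by
    refine ge_of_tendsto lim ?_
    filter_upwards [Ioo_mem_nhdsGT (lt_min hε hr)] with ρ hρ
    exact key ρ hρ.1 (hρ.2.trans_le (min_le_left _ _)) (hρ.2.le.trans (min_le_right _ _))
  exact sub_eq_zero.mp (norm_le_zero_iff.mp this)

/-- The same argument with growing circles: the remainder is `O(z⁻²)`, hence contributes `O(1/ρ)`.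
Growth up to `z³` is permitted because `I₃` is a residue of `z³ dp/dz`. -/
theorem circleIntegral_eq_residue_infinity {f : ℂ → ℂ} {c₀ c₁ c₂ c₃ c₄ : ℂ}
    (hd : ∀ z, 1 < ‖z‖ → DifferentiableAt ℂ f z)
    (hT : HasTaylor (fun z => z ^ 3 * f z⁻¹) c₀ c₁ c₂ c₃ c₄) :
    (∮ z in C(0, 2), f z) = 2 * Real.pi * Complex.I * c₄ := by
  obtain ⟨K, hK⟩ := hT.bound
  rw [eventually_nhdsWithin_iff, Metric.eventually_nhds_iff] at hK
  obtain ⟨ε, hε, hK⟩ := hK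
  have key : ∀ ρ, 2 ≤ ρ → ε⁻¹ < ρ →
      ‖(∮ z in C(0, 2), f z) - 2 * Real.pi * Complex.I * c₄‖ ≤ 2 * Real.pi * K * ρ⁻¹ := by
    intro ρ h0 h1
    have hρ : 0 < ρ := by linarith
    have e1 : (∮ z in C(0, ρ), f z) = ∮ z in C(0, 2), f z := by
      apply Complex.circleIntegral_eq_of_differentiable_on_annulus_off_countable two_pos h0
        countable_empty
      · intro z hz
        simp only [Set.mem_sdiff, Metric.mem_closedBall, dist_zero_right, Metric.mem_ball, not_lt] at hz
        exact (hd z (by linarith)).continuousAt.continuousWithinAt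
      · intro z hz
        simp only [Set.mem_sdiff, Metric.mem_closedBall, dist_zero_right, Metric.mem_ball, not_le] at hz
        exact hd z (by linarith)
    obtain ⟨i1, i2⟩ := circleIntegral_laurent₅ ρ hρ c₀ c₁ c₂ c₃ c₄ 3 2 1 0
      (by norm_num) (by norm_num) (by norm_num) (by norm_num)
    have i3 : CircleIntegrable f 0 ρ := by
      apply ContinuousOn.circleIntegrable hρ.le
      intro z hz
      have hz' : ‖z‖ = ρ := by simpa using hz
      exact (hd z (by linarith)).continuousAt.continuousWithinAt
    rw [← e1, ← i2, ← circleIntegral.integral_sub i3 i1]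
    have : 2 * Real.pi * K * ρ⁻¹ = 2 * Real.pi * ρ * (K * (ρ⁻¹) ^ 2) := by
      field_simp
    rw [this]
    apply circleIntegral.norm_integral_le_of_norm_le_const hρ.le
    intro z hz
    have hz' : ‖z‖ = ρ := by simpa using hz
    have hz0 : z ≠ 0 := by
      rintro rfl; simp at hz'; linarith
    have hb := hK (y := z⁻¹) (by
      simpa [hz'] using inv_lt_of_inv_lt₀ hε h1) (inv_ne_zero hz0)
    have h5 : 0 < ‖z⁻¹ ^ 3‖ := norm_pos_iff.mpr (pow_ne_zero _ (inv_ne_zero hz0))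
    rw [← mul_le_mul_iff_right₀ h5, ← norm_mul]
    have e : ‖z⁻¹ ^ 3‖ * (K * ρ⁻¹ ^ 2) = K * ‖z⁻¹ ^ 5‖ := by
      simp only [norm_pow, norm_inv, hz']; ring
    rw [e]
    refine le_of_eq_of_le (congrArg _ ?_) hb
    beta_reduce
    rw [inv_inv, show (z : ℂ) ^ (3 : ℤ) = z ^ 3 from by norm_cast,
      show (z : ℂ) ^ (2 : ℤ) = z ^ 2 from by norm_cast]
    simp only [zpow_one, zpow_zero, zpow_neg]
    field_simp
  have lim : Tendsto (fun ρ : ℝ => 2 * Real.pi * K * ρ⁻¹) atTop (𝓝 0) := by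
    simpa using tendsto_inv_atTop_zero.const_mul (2 * Real.pi * K)
  have : ‖(∮ z in C(0, 2), f z) - 2 * Real.pi * Complex.I * c₄‖ ≤ 0 := by
    refine ge_of_tendsto lim ?_
    filter_upwards [eventually_ge_atTop 2, eventually_gt_atTop ε⁻¹] with ρ h1 h2
    exact key ρ h1 h2
  exact sub_eq_zero.mp (norm_le_zero_iff.mp this)

end DefNLS

/-! ### Integrable majorants for inverse square roots and logarithms; bounds on the kernel. -/

namespace DefNLS

open Filter Topology Asymptotics

theorem intervalIntegrable_abs_rpow {s : ℝ} (hs : -1 < s) (a b : ℝ) :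
    IntervalIntegrable (fun x : ℝ => |x| ^ s) volume a b := by
  have h1 : ∀ c : ℝ, 0 ≤ c → IntervalIntegrable (fun x : ℝ => |x| ^ s) volume 0 c := by
    intro c hc
    refine (intervalIntegral.intervalIntegrable_rpow' hs (a := 0) (b := c)).congr ?_
    intro x hx
    rw [uIoc_of_le hc] at hx
    simp only [abs_of_pos hx.1]
  have h2 : ∀ c : ℝ, IntervalIntegrable (fun x : ℝ => |x| ^ s) volume 0 c := by
    intro c
    rcases le_total 0 c with hc | hc
    · exact h1 c hc
    · have := (h1 (-c) (by linarith)).comp_sub_left 0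
      simp only [zero_sub, abs_neg, neg_neg, sub_zero] at this
      simpa using this
  exact (h2 a).symm.trans (h2 b)

theorem integrableOn_abs_sub_rpow {s : ℝ} (hs : -1 < s) (p : ℝ) :
    IntegrableOn (fun x : ℝ => |x - p| ^ s) (Icc (-1) 1) := by
  rw [← intervalIntegrable_iff_integrableOn_Icc_of_le (by norm_num)]
  have := (intervalIntegrable_abs_rpow hs (-1 - p) (1 - p)).comp_sub_right p
  simpa using this

theorem setIntegral_abs_sub_rpow_le {s : ℝ} (hs : -1 < s) {p : ℝ} (hp : p ∈ Icc (-1 : ℝ) 1) :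
    ∫ x in Icc (-1 : ℝ) 1, |x - p| ^ s ≤ ∫ x in (-2 : ℝ)..2, |x| ^ s := by
  rw [integral_Icc_eq_integral_Ioc, ← intervalIntegral.integral_of_le (by norm_num),
    intervalIntegral.integral_comp_sub_right (fun x => |x| ^ s)]
  apply intervalIntegral.integral_mono_interval (by linarith [hp.2]) (by linarith) (by linarith [hp.1])
  · filter_upwards with x
    exact Real.rpow_nonneg (abs_nonneg _) _
  · exact intervalIntegrable_abs_rpow hs _ _

theorem abs_sub_rpow_nonneg (x p s : ℝ) : 0 ≤ |x - p| ^ s := Real.rpow_nonneg (abs_nonneg _) _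

/-- Every `x` is at distance at least `|p - q|/2` from one of the two points, so one of the two
factors is bounded. -/
theorem rpow_neg_half_mul_le {p q x : ℝ} (h : p ≠ q) :
    |x - q| ^ (-(1 / 2) : ℝ) * |x - p| ^ (-(1 / 2) : ℝ) ≤
      (|p - q| / 2) ^ (-(1 / 2) : ℝ) * (|x - q| ^ (-(1 / 2) : ℝ) + |x - p| ^ (-(1 / 2) : ℝ)) := by
  have hd : 0 < |p - q| / 2 := by
    have := abs_pos.mpr (sub_ne_zero.mpr h); linarith
  have tri : |p - q| ≤ |x - q| + |x - p| := by
    rw [abs_sub_comm x p, add_comm]; exact abs_sub_le p x q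
  have h1 := abs_sub_rpow_nonneg x q (-(1 / 2))
  have h2 := abs_sub_rpow_nonneg x p (-(1 / 2))
  have hδ : 0 ≤ (|p - q| / 2) ^ (-(1 / 2) : ℝ) := Real.rpow_nonneg hd.le _
  rcases le_total (|p - q| / 2) |x - q| with h | h
  · have := Real.rpow_le_rpow_of_nonpos hd h (show (-(1 / 2) : ℝ) ≤ 0 by norm_num)
    nlinarith
  · have := Real.rpow_le_rpow_of_nonpos hd (show |p - q| / 2 ≤ |x - p| by linarith)
      (show (-(1 / 2) : ℝ) ≤ 0 by norm_num)
    nlinarith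

/-- Singularities at distinct points do not reinforce each other. By induction on the set, each
cross term is split by `rpow_neg_half_mul_le`. -/
theorem exists_prod_rpow_neg_half_le (s : Finset ℝ) : ∃ C, 0 ≤ C ∧ ∀ x : ℝ,
    ∏ p ∈ s, |x - p| ^ (-(1 / 2) : ℝ) ≤ C * (1 + ∑ p ∈ s, |x - p| ^ (-(1 / 2) : ℝ)) := by
  classical
  induction s using Finset.induction_on with
  | empty => exact ⟨1, zero_le_one, fun x => by simp⟩
  | insert q s hq ih =>
    obtain ⟨C, hC, ih⟩ := ih
    set δ : ℝ → ℝ := fun p => (|p - q| / 2) ^ (-(1 / 2) : ℝ) with hδ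
    have δ0 : ∀ p, 0 ≤ δ p := fun p => Real.rpow_nonneg (by positivity) _
    set M := ∑ p ∈ s, δ p with hM
    have M0 : 0 ≤ M := Finset.sum_nonneg fun p _ => δ0 p
    refine ⟨C * (1 + M), by positivity, fun x => ?_⟩
    rw [Finset.prod_insert hq, Finset.sum_insert hq]
    set A := |x - q| ^ (-(1 / 2) : ℝ) with hA
    have A0 : 0 ≤ A := abs_sub_rpow_nonneg _ _ _
    set B : ℝ → ℝ := fun p => |x - p| ^ (-(1 / 2) : ℝ) with hB
    have B0 : ∀ p, 0 ≤ B p := fun p => abs_sub_rpow_nonneg _ _ _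
    have S0 : 0 ≤ ∑ p ∈ s, B p := Finset.sum_nonneg fun p _ => B0 p
    have key : A * ∑ p ∈ s, B p ≤ M * A + M * ∑ p ∈ s, B p := by
      calc A * ∑ p ∈ s, B p = ∑ p ∈ s, A * B p := Finset.mul_sum _ _ _
        _ ≤ ∑ p ∈ s, (δ p * A + M * B p) := by
          refine Finset.sum_le_sum fun p hp => ?_
          have h1 := rpow_neg_half_mul_le (x := x) (show p ≠ q from fun h => hq (h ▸ hp))
          have h2 : δ p ≤ M := Finset.single_le_sum (fun p _ => δ0 p) hp
          have h3 := mul_le_mul_of_nonneg_right h2 (B0 p)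
          simp only [hA, hB, hδ] at h1 h3 ⊢
          linarith
        _ = _ := by rw [Finset.sum_add_distrib, ← Finset.sum_mul, ← Finset.mul_sum]
    calc A * ∏ p ∈ s, B p ≤ A * (C * (1 + ∑ p ∈ s, B p)) := mul_le_mul_of_nonneg_left (ih x) A0
      _ = C * (A + A * ∑ p ∈ s, B p) := by ring
      _ ≤ C * (A + (M * A + M * ∑ p ∈ s, B p)) := by gcongr
      _ ≤ C * (1 + M) * (1 + (A + ∑ p ∈ s, B p)) := by
        have : 0 ≤ C * (1 + M + ∑ p ∈ s, B p) := by positivity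
        nlinarith

/-- Replacing the larger base by the smaller one merges the exponents into `-3/4`, still integrable.
This covers the collision of the logarithmic singularity, dominated by the power `-1/4`, with a
branch point. -/
theorem rpow_neg_quarter_mul_half_le (A B : ℝ) (hA : 0 ≤ A) (hB : 0 ≤ B) :
    A ^ (-(1 / 4) : ℝ) * B ^ (-(1 / 2) : ℝ) ≤ A ^ (-(3 / 4) : ℝ) + B ^ (-(3 / 4) : ℝ) := by
  have h1 := Real.rpow_nonneg hA (-(3 / 4))
  have h2 := Real.rpow_nonneg hB (-(3 / 4))
  -- At base zero a negative power is `0` by convention, so the left side vanishes.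
  rcases hA.eq_or_lt with rfl | hA
  · rw [Real.zero_rpow (by norm_num), zero_mul]; linarith
  rcases hB.eq_or_lt with rfl | hB
  · rw [Real.zero_rpow (x := -(1 / 2)) (by norm_num), mul_zero]; linarith
  rcases le_total A B with h | h
  · have := Real.rpow_le_rpow_of_nonpos hA h (show (-(1 / 2) : ℝ) ≤ 0 by norm_num)
    have e : A ^ (-(1 / 4) : ℝ) * A ^ (-(1 / 2) : ℝ) = A ^ (-(3 / 4) : ℝ) := by
      rw [← Real.rpow_add hA]; norm_num
    have := mul_le_mul_of_nonneg_left this (Real.rpow_nonneg hA.le (-(1 / 4)))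
    linarith
  · have := Real.rpow_le_rpow_of_nonpos hB h (show (-(1 / 4) : ℝ) ≤ 0 by norm_num)
    have e : B ^ (-(1 / 4) : ℝ) * B ^ (-(1 / 2) : ℝ) = B ^ (-(3 / 4) : ℝ) := by
      rw [← Real.rpow_add hB]; norm_num
    have := mul_le_mul_of_nonneg_right this (Real.rpow_nonneg hB.le (-(1 / 2)))
    linarith

theorem rpow_le_one_add_rpow {A : ℝ} (hA : 0 ≤ A) {s : ℝ} (hs : s < 0) (hs' : -(3 / 4) ≤ s) :
    A ^ s ≤ 1 + A ^ (-(3 / 4) : ℝ) := by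
  have h0 := Real.rpow_nonneg hA (-(3 / 4))
  rcases hA.eq_or_lt with rfl | hA
  · rw [Real.zero_rpow hs.ne]; linarith
  rcases le_total A 1 with h | h
  · have := Real.rpow_le_rpow_of_exponent_ge hA h hs'
    linarith
  · have := Real.rpow_le_one_of_one_le_of_nonpos h hs.le
    linarith

/-- An integrable majorant with singularities at the points of `s` and at `y`. -/
noncomputable def majorant (s : Finset ℝ) (y x : ℝ) : ℝ :=
  1 + |x - y| ^ (-(3 / 4) : ℝ) + ∑ p ∈ s, |x - p| ^ (-(3 / 4) : ℝ)

theorem majorant_nonneg (s : Finset ℝ) (y x : ℝ) : 0 ≤ majorant s y x := by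
  have := abs_sub_rpow_nonneg x y (-(3 / 4))
  have : 0 ≤ ∑ p ∈ s, |x - p| ^ (-(3 / 4) : ℝ) :=
    Finset.sum_nonneg fun p _ => abs_sub_rpow_nonneg _ _ _
  unfold majorant; linarith

theorem integrableOn_majorant (s : Finset ℝ) (y : ℝ) :
    IntegrableOn (majorant s y) (Icc (-1) 1) := by
  have h : (-1 : ℝ) < -(3 / 4) := by norm_num
  exact ((integrableOn_const (by simp)).add (integrableOn_abs_sub_rpow h y)).add
    (integrable_finsetSum _ fun p _ => integrableOn_abs_sub_rpow h p)

/-- Translating by `y` keeps the interval inside `[-2, 2]`, so the bound is uniform in `y`. The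
uniformity is what lets Fubini apply to a solution known only to be integrable. -/
theorem exists_setIntegral_majorant_le (s : Finset ℝ) : ∃ C, ∀ y ∈ Icc (-1 : ℝ) 1,
    ∫ x in Icc (-1) 1, majorant s y x ≤ C := by
  have h : (-1 : ℝ) < -(3 / 4) := by norm_num
  refine ⟨2 + (∫ x in (-2 : ℝ)..2, |x| ^ (-(3 / 4) : ℝ)) +
    ∑ p ∈ s, ∫ x in Icc (-1 : ℝ) 1, |x - p| ^ (-(3 / 4) : ℝ), fun y hy => ?_⟩
  have i1 : IntegrableOn (fun _ : ℝ => (1 : ℝ)) (Icc (-1) 1) := integrableOn_const (by simp)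
  have i2 := integrableOn_abs_sub_rpow h y
  have i3 := fun p (_ : p ∈ s) => integrableOn_abs_sub_rpow h p
  have i4 : IntegrableOn (fun x : ℝ => 1 + |x - y| ^ (-(3 / 4) : ℝ)) (Icc (-1) 1) := i1.add i2
  unfold majorant
  rw [integral_add i4 (integrable_finsetSum _ i3), integral_add i1 i2,
    integral_finsetSum _ i3]
  have := setIntegral_abs_sub_rpow_le h hy
  have e : ∫ x in Icc (-1 : ℝ) 1, (1 : ℝ) = 2 := by simp; norm_num
  rw [e]
  gcongr

theorem exists_mul_prod_le_majorant (s : Finset ℝ) : ∃ C, 0 ≤ C ∧ ∀ y x : ℝ,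
    (1 + |x - y| ^ (-(1 / 4) : ℝ)) * ∏ p ∈ s, |x - p| ^ (-(1 / 2) : ℝ) ≤ C * majorant s y x := by
  obtain ⟨C, hC, h⟩ := exists_prod_rpow_neg_half_le s
  refine ⟨C * (2 + 2 * s.card), by positivity, fun y x => ?_⟩
  have A0 := abs_sub_rpow_nonneg x y (-(1 / 4))
  have A1 := abs_sub_rpow_nonneg x y (-(3 / 4))
  have B0 : 0 ≤ ∑ p ∈ s, |x - p| ^ (-(3 / 4) : ℝ) :=
    Finset.sum_nonneg fun p _ => abs_sub_rpow_nonneg _ _ _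
  have h1 : |x - y| ^ (-(1 / 4) : ℝ) ≤ 1 + |x - y| ^ (-(3 / 4) : ℝ) :=
    rpow_le_one_add_rpow (abs_nonneg _) (by norm_num) (by norm_num)
  have h2 : ∑ p ∈ s, |x - p| ^ (-(1 / 2) : ℝ) ≤ s.card + ∑ p ∈ s, |x - p| ^ (-(3 / 4) : ℝ) := by
    calc _ ≤ ∑ p ∈ s, (1 + |x - p| ^ (-(3 / 4) : ℝ)) := Finset.sum_le_sum fun p _ =>
          rpow_le_one_add_rpow (abs_nonneg _) (by norm_num) (by norm_num)
      _ = _ := by rw [Finset.sum_add_distrib]; simp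
  have h3 : |x - y| ^ (-(1 / 4) : ℝ) * ∑ p ∈ s, |x - p| ^ (-(1 / 2) : ℝ) ≤
      s.card * |x - y| ^ (-(3 / 4) : ℝ) + ∑ p ∈ s, |x - p| ^ (-(3 / 4) : ℝ) := by
    rw [Finset.mul_sum]
    calc _ ≤ ∑ p ∈ s, (|x - y| ^ (-(3 / 4) : ℝ) + |x - p| ^ (-(3 / 4) : ℝ)) :=
          Finset.sum_le_sum fun p _ =>
            rpow_neg_quarter_mul_half_le _ _ (abs_nonneg _) (abs_nonneg _)
      _ = _ := by rw [Finset.sum_add_distrib]; simp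
  have h4 : (0 : ℝ) ≤ s.card := by positivity
  calc _ ≤ (1 + |x - y| ^ (-(1 / 4) : ℝ)) * (C * (1 + ∑ p ∈ s, |x - p| ^ (-(1 / 2) : ℝ))) :=
        mul_le_mul_of_nonneg_left (h x) (by linarith)
    _ = C * (1 + |x - y| ^ (-(1 / 4) : ℝ) + ∑ p ∈ s, |x - p| ^ (-(1 / 2) : ℝ)
        + |x - y| ^ (-(1 / 4) : ℝ) * ∑ p ∈ s, |x - p| ^ (-(1 / 2) : ℝ)) := by ring
    _ ≤ C * ((2 + 2 * s.card) * majorant s y x) := by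
        apply mul_le_mul_of_nonneg_left _ hC
        unfold majorant
        have := mul_nonneg h4 A1
        have := mul_nonneg h4 B0
        nlinarith
    _ = _ := by ring

/-! ### The kernel -/

theorem kernel_comm (z w : ℝ) : kernel z w = kernel w z := by
  unfold kernel
  rw [abs_div, abs_div, abs_sub_comm z w]
  rw [mul_comm (absR₀ z), mul_comm w z]

/-- At `z = ±1` the numerator is `∓(z - w)`, so the quotient has absolute value one. On the diagonal
the convention `log 0 = 0` gives the same value. -/
theorem kernel_eq_zero_of_sq_eq_one {z : ℝ} (hz : z ^ 2 = 1) (w : ℝ) : kernel z w = 0 := by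
  have h0 : absR₀ z = 0 := by simp [absR₀, hz]
  unfold kernel
  rw [h0]
  rcases (sq_eq_one_iff.mp hz) with rfl | rfl
  · rcases eq_or_ne w 1 with rfl | hw
    · simp
    · have : (1 : ℝ) - w ≠ 0 := sub_ne_zero.mpr hw.symm
      rw [show (-(0 * absR₀ w) + w * 1 - 1) / (1 - w) = -1 by field_simp; ring]
      simp
  · rcases eq_or_ne w (-1) with rfl | hw
    · simp
    · have : (-1 : ℝ) - w ≠ 0 := sub_ne_zero.mpr hw.symm
      rw [show (-(0 * absR₀ w) + w * -1 - 1) / (-1 - w) = 1 by field_simp; ring]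
      simp

/-- The absolute numerator lies between `|w - z|` and `2`, so the logarithm is nonnegative and at
most `log(2/|w - z|)`. The constant `8` is `4` from `log x ≤ 4 x^(1/4)`, times the crude bound
`2^(1/4) ≤ 2`. -/
theorem abs_kernel_le {z w : ℝ} (hz : z ∈ Icc (-1 : ℝ) 1) (hw : w ∈ Icc (-1 : ℝ) 1) :
    |kernel z w| ≤ 8 * |w - z| ^ (-(1 / 4) : ℝ) := by
  have hz1 : 0 ≤ 1 - z ^ 2 := by nlinarith [hz.1, hz.2]
  have hw1 : 0 ≤ 1 - w ^ 2 := by nlinarith [hw.1, hw.2]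
  rcases eq_or_ne z w with rfl | hne
  · simp [kernel, Real.zero_rpow]
  have hpos : 0 < |w - z| := abs_pos.mpr (sub_ne_zero.mpr hne.symm)
  have hs0 : 0 ≤ absR₀ z * absR₀ w := mul_nonneg (Real.sqrt_nonneg _) (Real.sqrt_nonneg _)
  have hs1 : absR₀ z * absR₀ w ≤ 1 + w * z := by
    have h1 : absR₀ z * absR₀ w = √((1 - z ^ 2) * (1 - w ^ 2)) := by
      rw [Real.sqrt_mul hz1]; rfl
    rw [h1]
    apply Real.sqrt_le_iff.mpr
    constructor
    · nlinarith [hz.1, hz.2, hw.1, hw.2]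
    · nlinarith [sq_nonneg (z + w)]
  have hnum : |(-(absR₀ z * absR₀ w) + w * z - 1)| = 1 - w * z + absR₀ z * absR₀ w := by
    rw [abs_of_nonpos]
    · ring
    · nlinarith [hz.1, hz.2, hw.1, hw.2]
  have hlow : |w - z| ≤ 1 - w * z := by
    rw [abs_le]; constructor <;> nlinarith [hz.1, hz.2, hw.1, hw.2]
  unfold kernel
  rw [abs_div, hnum, abs_sub_comm z w]
  have q1 : 1 ≤ (1 - w * z + absR₀ z * absR₀ w) / |w - z| := by
    rw [le_div_iff₀ hpos]; linarith
  rw [abs_of_nonneg (Real.log_nonneg q1)]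
  have q2 : (1 - w * z + absR₀ z * absR₀ w) / |w - z| ≤ 2 * |w - z|⁻¹ := by
    rw [div_eq_mul_inv]
    gcongr
    linarith
  have q3 := Real.log_le_rpow_div (x := (1 - w * z + absR₀ z * absR₀ w) / |w - z|)
    (by linarith) (ε := 1 / 4) (by norm_num)
  have q4 := Real.rpow_le_rpow (by linarith) q2 (show (0 : ℝ) ≤ 1 / 4 by norm_num)
  rw [Real.mul_rpow (by norm_num) (by positivity), Real.inv_rpow hpos.le,
    ← Real.rpow_neg hpos.le] at q4
  have q5 : (2 : ℝ) ^ (1 / 4 : ℝ) ≤ 2 := by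
    calc (2 : ℝ) ^ (1 / 4 : ℝ) ≤ 2 ^ (1 : ℝ) :=
          Real.rpow_le_rpow_of_exponent_le (by norm_num) (by norm_num)
      _ = 2 := by simp
  have q6 := mul_le_mul_of_nonneg_right q5 (Real.rpow_nonneg hpos.le (-(1 / 4)))
  linarith

theorem measurable_kernel : Measurable fun q : ℝ × ℝ => kernel q.1 q.2 := by
  unfold kernel absR₀
  fun_prop

end DefNLS

/-! ### The cut plane uniformised by the unit disc: square roots, boundary values, half-circle
integrals. -/

namespace DefNLS

open Filter Topology Asymptotics ComplexConjugate

/-! ### Square roots on the unit disc -/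

theorem circleMap_zero_re (r θ : ℝ) : (circleMap 0 r θ).re = r * Real.cos θ := by
  simp [circleMap, Complex.exp_re]

theorem circleMap_zero_im (r θ : ℝ) : (circleMap 0 r θ).im = r * Real.sin θ := by
  simp [circleMap, Complex.exp_im]

/-- The branch of `√(1 - 2 a ζ + ζ²)` on the unit disc with value `1` at the origin; in terms of
`z = (ζ + 1 / ζ) / 2` it is `√(2 ζ (z - a))`. -/
noncomputable def diskSqrt (a : ℝ) (ζ : ℂ) : ℂ := (1 - 2 * a * ζ + ζ ^ 2) ^ (2⁻¹ : ℂ)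

theorem quadratic_re (a : ℝ) (ζ : ℂ) :
    (1 - 2 * a * ζ + ζ ^ 2).re = 1 - 2 * a * ζ.re + (ζ.re ^ 2 - ζ.im ^ 2) := by
  simp [sq]

theorem quadratic_im (a : ℝ) (ζ : ℂ) :
    (1 - 2 * a * ζ + ζ ^ 2).im = 2 * ζ.im * (ζ.re - a) := by
  simp [sq]; ring

/-- The imaginary part vanishes only for real `ζ` or for `Re ζ = a`. In the first case the value is
at least `(1 - |ζ|)²`; in the second its real part is `1 - |ζ|²`. Hence the principal square root is
analytic on the whole disc. -/
theorem quadratic_mem_slitPlane {a : ℝ} (ha : a ∈ Icc (-1 : ℝ) 1) {ζ : ℂ} (hζ : ‖ζ‖ < 1) :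
    1 - 2 * a * ζ + ζ ^ 2 ∈ Complex.slitPlane := by
  rw [Complex.mem_slitPlane_iff, quadratic_re, quadratic_im]
  have hn : ζ.re ^ 2 + ζ.im ^ 2 < 1 := by
    have := Complex.sq_norm ζ
    rw [Complex.normSq_apply] at this
    nlinarith [norm_nonneg ζ]
  by_contra! h
  obtain ⟨h1, h2⟩ := h
  rcases mul_eq_zero.mp h2 with h2 | h2
  · have hy : ζ.im = 0 := by linarith
    rw [hy] at h1 hn
    have hx1 : ζ.re < 1 := by nlinarith
    have hx2 : -1 < ζ.re := by nlinarith
    rcases le_total 0 ζ.re with h0 | h0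
    · nlinarith [mul_nonneg h0 (sub_nonneg.mpr ha.2), mul_pos (sub_pos.mpr hx1) (sub_pos.mpr hx1)]
    · nlinarith [mul_nonneg (neg_nonneg.mpr h0) (neg_le_iff_add_nonneg.mp ha.1),
        mul_pos (neg_lt_iff_pos_add.mp hx2) (neg_lt_iff_pos_add.mp hx2)]
  · have hx : ζ.re = a := by linarith
    rw [hx] at h1 hn
    nlinarith

theorem quadratic_circle_mem_slitPlane {a θ : ℝ} (hθ : θ ∈ Ioo 0 Real.pi) (ha : Real.cos θ ≠ a) :
    1 - 2 * a * circleMap 0 1 θ + circleMap 0 1 θ ^ 2 ∈ Complex.slitPlane := by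
  rw [Complex.mem_slitPlane_iff, quadratic_im, circleMap_zero_re, circleMap_zero_im]
  right
  have := Real.sin_pos_of_mem_Ioo hθ
  simp only [one_mul]
  exact mul_ne_zero (by positivity) (sub_ne_zero.mpr ha)

theorem diskSqrt_sq (a : ℝ) (ζ : ℂ) : diskSqrt a ζ ^ 2 = 1 - 2 * a * ζ + ζ ^ 2 := by
  have := Complex.cpow_nat_inv_pow (1 - 2 * a * ζ + ζ ^ 2) (n := 2) two_ne_zero
  rw [Nat.cast_ofNat] at this
  exact this

theorem diskSqrt_ne_zero {a : ℝ} (ha : a ∈ Icc (-1 : ℝ) 1) {ζ : ℂ} (hζ : ‖ζ‖ < 1) :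
    diskSqrt a ζ ≠ 0 := by
  intro h
  have := diskSqrt_sq a ζ
  rw [h] at this
  have h2 := Complex.slitPlane_ne_zero (quadratic_mem_slitPlane ha hζ)
  exact h2 (by rw [← this]; ring)

theorem differentiableAt_diskSqrt {a : ℝ} {ζ : ℂ}
    (h : 1 - 2 * a * ζ + ζ ^ 2 ∈ Complex.slitPlane) : DifferentiableAt ℂ (diskSqrt a) ζ := by
  unfold diskSqrt
  exact DifferentiableAt.cpow_const (by fun_prop) h

theorem diskSqrt_conj {a : ℝ} (ha : a ∈ Icc (-1 : ℝ) 1) {ζ : ℂ} (hζ : ‖ζ‖ < 1) :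
    diskSqrt a (conj ζ) = conj (diskSqrt a ζ) := by
  unfold diskSqrt
  have h := Complex.slitPlane_arg_ne_pi (quadratic_mem_slitPlane ha hζ)
  have := Complex.conj_cpow _ (2⁻¹ : ℂ) h
  simpa only [map_inv₀, map_add, map_sub, map_one, map_mul, map_pow, Complex.conj_ofReal,
    map_ofNat] using this

theorem diskSqrt_zero (a : ℝ) : diskSqrt a 0 = 1 := by simp [diskSqrt]

/-- Boundary value on the cut of `√(X - a)`. -/
noncomputable def cutSqrt (a X : ℝ) : ℂ :=
  if a ≤ X then (√(X - a) : ℂ) else -Complex.I * (√(a - X) : ℂ)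

theorem cutSqrt_sq (a X : ℝ) : cutSqrt a X ^ 2 = ((X - a : ℝ) : ℂ) := by
  unfold cutSqrt
  split_ifs with h
  · rw [← Complex.ofReal_pow, Real.sq_sqrt (by linarith)]
  · rw [mul_pow, neg_sq, Complex.I_sq, ← Complex.ofReal_pow, Real.sq_sqrt (by linarith)]
    push_cast; ring

theorem norm_cutSqrt (a X : ℝ) : ‖cutSqrt a X‖ = √|X - a| := by
  rw [← Real.sqrt_sq (norm_nonneg (cutSqrt a X)), ← norm_pow, cutSqrt_sq, Complex.norm_real, Real.norm_eq_abs]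

theorem quadratic_circle (a θ : ℝ) :
    1 - 2 * a * circleMap 0 1 θ + circleMap 0 1 θ ^ 2
      = 2 * ((Real.cos θ - a : ℝ) : ℂ) * circleMap 0 1 θ := by
  have hs := Real.sin_sq_add_cos_sq θ
  apply Complex.ext
  · rw [quadratic_re]
    simp only [circleMap_zero_re, circleMap_zero_im, Complex.mul_re, Complex.mul_im,
      Complex.ofReal_re, Complex.ofReal_im, Complex.re_ofNat, Complex.im_ofNat]
    nlinarith
  · rw [quadratic_im]
    simp only [circleMap_zero_re, circleMap_zero_im, Complex.mul_re, Complex.mul_im,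
      Complex.ofReal_re, Complex.ofReal_im, Complex.re_ofNat, Complex.im_ofNat]
    ring

/-- The squares agree because `1 - 2aζ + ζ² = 2ζ(cos θ - a)` on the circle. The branch is right
because the right side has positive real part: `exp(iθ/2)` lies in the open first quadrant, and
multiplying it by `-i` keeps it in the right half plane. The upper semicircle, approached from
inside the disc, is the lower side of the cut, which explains the `-i` in `cutSqrt`. -/
theorem diskSqrt_circle {a θ : ℝ} (hθ : θ ∈ Ioo 0 Real.pi) (ha : Real.cos θ ≠ a) :
    diskSqrt a (circleMap 0 1 θ) = (√2 : ℂ) * circleMap 0 1 (θ / 2) * cutSqrt a (Real.cos θ) := by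
  set w := (√2 : ℂ) * circleMap 0 1 (θ / 2) * cutSqrt a (Real.cos θ) with hw
  have h2 : ((√2 : ℝ) : ℂ) ^ 2 = 2 := by
    rw [← Complex.ofReal_pow, Real.sq_sqrt (by norm_num)]; simp
  have hsq : w ^ 2 = 1 - 2 * a * circleMap 0 1 θ + circleMap 0 1 θ ^ 2 := by
    rw [quadratic_circle, hw, mul_pow, mul_pow, cutSqrt_sq, h2]
    have : circleMap 0 1 (θ / 2) ^ 2 = circleMap 0 1 θ := by
      simp only [circleMap, zero_add, Complex.ofReal_one, one_mul]
      rw [← Complex.exp_nat_mul]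
      congr 1; push_cast; ring
    rw [this]; ring
  have hre : 0 < w.re := by
    have hc := circleMap_zero_re 1 (θ / 2)
    have hi := circleMap_zero_im 1 (θ / 2)
    have h1 : 0 < Real.cos (θ / 2) :=
      Real.cos_pos_of_mem_Ioo ⟨by linarith [hθ.1, hθ.2], by linarith [hθ.2]⟩
    have h3 : 0 < Real.sin (θ / 2) :=
      Real.sin_pos_of_mem_Ioo ⟨by linarith [hθ.1], by linarith [hθ.1, hθ.2]⟩
    have h4 : 0 < √(2 : ℝ) := by positivity
    rw [hw, cutSqrt]
    split_ifs with h
    · have h5 : 0 < √(Real.cos θ - a) := Real.sqrt_pos.mpr (by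
        have := lt_of_le_of_ne h ha.symm; linarith)
      simp only [Complex.mul_re, Complex.mul_im, Complex.ofReal_re, Complex.ofReal_im, hc, hi]
      simp
      positivity
    · have h5 : 0 < √(a - Real.cos θ) := Real.sqrt_pos.mpr (by linarith)
      simp only [Complex.mul_re, Complex.mul_im, Complex.ofReal_re, Complex.ofReal_im, hc, hi]
      simp
      positivity
  rw [diskSqrt, ← hsq]
  exact Complex.sq_cpow_two_inv hre

/-- The difference of the squares of the two sides is `(1 - r)²((1 + r)² - 4ra cos θ) ≥ 0`. This
bounds the disc functions in terms of `cos θ` uniformly as `r → 1`, as dominated convergence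
requires. -/
theorem two_mul_abs_cos_sub_le_norm {a r θ : ℝ} (ha : a ∈ Icc (-1 : ℝ) 1) (hr : 0 ≤ r) :
    2 * r * |Real.cos θ - a| ≤ ‖1 - 2 * a * circleMap 0 r θ + circleMap 0 r θ ^ 2‖ := by
  apply le_of_sq_le_sq _ (norm_nonneg _) |> fun h => h
  rw [Complex.sq_norm, Complex.normSq_apply, quadratic_re, quadratic_im, circleMap_zero_re,
    circleMap_zero_im, mul_pow, sq_abs]
  have hs := Real.sin_sq θ
  set X := Real.cos θ
  set s := Real.sin θ
  have hX : X ∈ Icc (-1 : ℝ) 1 := ⟨Real.neg_one_le_cos θ, Real.cos_le_one θ⟩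
  have haX : a * X ≤ 1 := by nlinarith [ha.1, ha.2, hX.1, hX.2]
  have h4 : 0 ≤ (1 + r) ^ 2 - 4 * r * (a * X) := by nlinarith [sq_nonneg (1 - r)]
  have key : (1 - 2 * a * (r * X) + ((r * X) ^ 2 - (r * s) ^ 2)) *
      (1 - 2 * a * (r * X) + ((r * X) ^ 2 - (r * s) ^ 2)) +
      2 * (r * s) * (r * X - a) * (2 * (r * s) * (r * X - a)) - (2 * r) ^ 2 * (X - a) ^ 2
      = (1 - r) ^ 2 * ((1 + r) ^ 2 - 4 * r * (a * X)) := by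
    have e1 : (r * s) ^ 2 = r ^ 2 * (1 - X ^ 2) := by rw [mul_pow, hs]
    have e2 : 2 * (r * s) * (r * X - a) * (2 * (r * s) * (r * X - a))
      = 4 * (r ^ 2 * (1 - X ^ 2)) * (r * X - a) ^ 2 := by rw [← e1]; ring
    rw [e1, e2]; ring
  have := mul_nonneg (sq_nonneg (1 - r)) h4
  linarith

theorem rpow_neg_half_eq (x : ℝ) (hx : 0 ≤ x) : x ^ (-(1 / 2) : ℝ) = (√x)⁻¹ := by
  rw [Real.rpow_neg hx, Real.sqrt_eq_rpow]

theorem norm_diskSqrt_inv_le {a r θ : ℝ} (ha : a ∈ Icc (-1 : ℝ) 1) (hr : 1 / 2 ≤ r)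
    (hX : Real.cos θ ≠ a) :
    ‖diskSqrt a (circleMap 0 r θ)‖⁻¹ ≤ |Real.cos θ - a| ^ (-(1 / 2) : ℝ) := by
  rw [rpow_neg_half_eq _ (abs_nonneg _)]
  have hpos : 0 < |Real.cos θ - a| := abs_pos.mpr (sub_ne_zero.mpr hX)
  apply inv_anti₀ (Real.sqrt_pos.mpr hpos)
  apply Real.sqrt_le_iff.mpr ⟨norm_nonneg _, ?_⟩
  rw [← norm_pow, diskSqrt_sq]
  refine le_trans ?_ (two_mul_abs_cos_sub_le_norm ha (by linarith))
  nlinarith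

theorem norm_circleMap_sub_le {r θ ε : ℝ} (hr : 0 ≤ r) (hr1 : r ≤ 1) (hε : |ε| = 1) :
    ‖circleMap 0 r θ - (ε : ℂ)‖ ≤ 2 := by
  refine (norm_sub_le _ _).trans ?_
  rw [norm_circleMap_zero, abs_of_nonneg hr, Complex.norm_real, Real.norm_eq_abs, hε]
  linarith

/-- The factor `ζ - ε` comes from `dz`. If `a = ε` it has the same modulus as `diskSqrt a ζ` and
cancels it; otherwise it is simply bounded by `2`. The product over the set `{a, ε}`, which
collapses when `a = ε`, treats both cases at once, so that `a₁ = -1` and `a₄ = 1` are allowed. -/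
theorem norm_endpoint_factor_le {a r θ ε : ℝ} (ha : a ∈ Icc (-1 : ℝ) 1) (hε : |ε| = 1)
    (hr : 1 / 2 ≤ r) (hr1 : r < 1) (hX : Real.cos θ ≠ a) (hXε : Real.cos θ ≠ ε) :
    ‖circleMap 0 r θ - (ε : ℂ)‖ * ‖diskSqrt a (circleMap 0 r θ)‖⁻¹ ≤
      2 * (√|Real.cos θ - ε| * ∏ p ∈ ({a, ε} : Finset ℝ), |Real.cos θ - p| ^ (-(1 / 2) : ℝ)) := by
  have hpos : 0 < √|Real.cos θ - ε| := Real.sqrt_pos.mpr (abs_pos.mpr (sub_ne_zero.mpr hXε))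
  have hn : ‖circleMap 0 r θ‖ < 1 := by
    rw [norm_circleMap_zero, abs_of_nonneg (by linarith)]; exact hr1
  rcases eq_or_ne a ε with rfl | hne
  · simp only [Finset.mem_singleton, Finset.insert_eq_of_mem, Finset.prod_singleton]
    rw [rpow_neg_half_eq _ (abs_nonneg _), mul_inv_cancel₀ hpos.ne']
    have ha2 : (a : ℂ) ^ 2 = 1 := by
      rw [← Complex.ofReal_pow, ← sq_abs, hε]; simp
    have h : ‖diskSqrt a (circleMap 0 r θ)‖ ^ 2 = ‖circleMap 0 r θ - (a : ℂ)‖ ^ 2 := by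
      rw [← norm_pow, ← norm_pow, diskSqrt_sq]
      congr 1
      linear_combination -ha2
    rw [pow_left_inj₀ (norm_nonneg _) (norm_nonneg _) two_ne_zero] at h
    rw [← h, mul_inv_cancel₀ (norm_ne_zero_iff.mpr (diskSqrt_ne_zero ha hn))]
    norm_num
  · rw [Finset.prod_pair hne, rpow_neg_half_eq |Real.cos θ - ε| (abs_nonneg _)]
    have e : 2 * (√|Real.cos θ - ε| * (|Real.cos θ - a| ^ (-(1 / 2) : ℝ) * (√|Real.cos θ - ε|)⁻¹))
      = 2 * |Real.cos θ - a| ^ (-(1 / 2) : ℝ) := by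
      field_simp
    rw [e]
    exact mul_le_mul (norm_circleMap_sub_le (by linarith) hr1.le hε)
      (norm_diskSqrt_inv_le ha hr hX) (inv_nonneg.mpr (norm_nonneg _)) (by norm_num)

/-- `1 / ∏ √(1 - 2 aⱼ ζ + ζ²)` on the unit disc. -/
noncomputable def diskInvRoot (a₁ a₂ a₃ a₄ : ℝ) (ζ : ℂ) : ℂ :=
  (diskSqrt a₁ ζ * diskSqrt a₂ ζ * diskSqrt a₃ ζ * diskSqrt a₄ ζ)⁻¹

/-- Boundary value on the cut of `1 / √(∏ (X - aⱼ))`. -/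
noncomputable def cutInvRoot (a₁ a₂ a₃ a₄ X : ℝ) : ℂ :=
  (cutSqrt a₁ X * cutSqrt a₂ X * cutSqrt a₃ X * cutSqrt a₄ X)⁻¹

/-- The branch points together with `±1`. -/
noncomputable def singularSet (a₁ a₂ a₃ a₄ : ℝ) : Finset ℝ :=
  ({a₁, -1} ∪ {a₂}) ∪ ({a₃} ∪ {a₄, 1})

/-- The ordering of the branch points. -/
structure Branches (a₁ a₂ a₃ a₄ : ℝ) : Prop where
  h₀₁ : -1 ≤ a₁
  h₁₂ : a₁ < a₂
  h₂₃ : a₂ < a₃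
  h₃₄ : a₃ < a₄
  h₄₅ : a₄ ≤ 1

namespace Branches

variable {a₁ a₂ a₃ a₄ : ℝ}

theorem mem₁ (ha : Branches a₁ a₂ a₃ a₄) : a₁ ∈ Icc (-1 : ℝ) 1 :=
  ⟨ha.h₀₁, by linarith [ha.h₁₂, ha.h₂₃, ha.h₃₄, ha.h₄₅]⟩

theorem mem₂ (ha : Branches a₁ a₂ a₃ a₄) : a₂ ∈ Icc (-1 : ℝ) 1 :=
  ⟨by linarith [ha.h₀₁, ha.h₁₂], by linarith [ha.h₂₃, ha.h₃₄, ha.h₄₅]⟩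

theorem mem₃ (ha : Branches a₁ a₂ a₃ a₄) : a₃ ∈ Icc (-1 : ℝ) 1 :=
  ⟨by linarith [ha.h₀₁, ha.h₁₂, ha.h₂₃], by linarith [ha.h₃₄, ha.h₄₅]⟩

theorem mem₄ (ha : Branches a₁ a₂ a₃ a₄) : a₄ ∈ Icc (-1 : ℝ) 1 :=
  ⟨by linarith [ha.h₀₁, ha.h₁₂, ha.h₂₃, ha.h₃₄], ha.h₄₅⟩

theorem prod_singularSet (ha : Branches a₁ a₂ a₃ a₄) (f : ℝ → ℝ) : ∏ p ∈ singularSet a₁ a₂ a₃ a₄, f p =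
    (∏ p ∈ ({a₁, -1} : Finset ℝ), f p) * f a₂ * (f a₃ * ∏ p ∈ ({a₄, 1} : Finset ℝ), f p) := by
  obtain ⟨h₀₁, h₁₂, h₂₃, h₃₄, h₄₅⟩ := ha
  unfold singularSet
  rw [Finset.prod_union, Finset.prod_union, Finset.prod_union, Finset.prod_singleton,
    Finset.prod_singleton]
  · rw [Finset.disjoint_left]
    intro x hx hx'
    simp only [Finset.mem_insert, Finset.mem_singleton] at hx hx'
    rcases hx' with h | h <;> subst hx <;> linarith
  · rw [Finset.disjoint_left]
    intro x hx hx'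
    simp only [Finset.mem_insert, Finset.mem_singleton] at hx hx'
    rcases hx with h | h <;> subst hx' <;> linarith
  · rw [Finset.disjoint_left]
    intro x hx hx'
    simp only [Finset.mem_union, Finset.mem_insert, Finset.mem_singleton] at hx hx'
    rcases hx with (h | h) | h <;> rcases hx' with h' | h' | h' <;> linarith

/-- The endpoint factors are paired with `a₁` and `a₄`, and `√|cos θ + 1| √|cos θ - 1| = sin θ`.
Keeping `sin θ` as the Jacobian of `x = cos θ` turns the bound into one that is integrable in `x`.
-/
theorem norm_sq_sub_one_mul_diskInvRoot_le (ha : Branches a₁ a₂ a₃ a₄)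
    {r θ : ℝ} (hθ : θ ∈ Ioo 0 Real.pi) (hr : 1 / 2 ≤ r)
    (hr1 : r < 1) (hX : Real.cos θ ∉ singularSet a₁ a₂ a₃ a₄) :
    ‖(circleMap 0 r θ ^ 2 - 1) * diskInvRoot a₁ a₂ a₃ a₄ (circleMap 0 r θ)‖ ≤
      4 * (Real.sin θ * ∏ p ∈ singularSet a₁ a₂ a₃ a₄, |Real.cos θ - p| ^ (-(1 / 2) : ℝ)) := by
  simp only [singularSet, Finset.mem_union, Finset.mem_insert, Finset.mem_singleton, not_or] at hX
  obtain ⟨⟨⟨x1, xm⟩, x2⟩, x3, x4, xp⟩ := hX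
  rw [ha.prod_singularSet]
  have b1 := norm_endpoint_factor_le (ε := -1) ha.mem₁ (by simp) hr hr1 x1 xm
  have b4 := norm_endpoint_factor_le (ε := 1) ha.mem₄ (by simp) hr hr1 x4 xp
  have b2 := norm_diskSqrt_inv_le ha.mem₂ hr x2
  have b3 := norm_diskSqrt_inv_le ha.mem₃ hr x3
  have hsin : √|Real.cos θ - -1| * √|Real.cos θ - 1| = Real.sin θ := by
    rw [← Real.sqrt_mul (abs_nonneg _), ← abs_mul]
    have : (Real.cos θ - -1) * (Real.cos θ - 1) = -(Real.sin θ) ^ 2 := by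
      rw [Real.sin_sq]; ring
    rw [this, abs_neg, abs_of_nonneg (sq_nonneg _),
      Real.sqrt_sq (Real.sin_pos_of_mem_Ioo hθ).le]
  rw [← hsin]
  set ζ := circleMap 0 r θ
  have e : ‖(ζ ^ 2 - 1) * diskInvRoot a₁ a₂ a₃ a₄ ζ‖ =
      (‖ζ - ((-1 : ℝ) : ℂ)‖ * ‖diskSqrt a₁ ζ‖⁻¹) * ‖diskSqrt a₂ ζ‖⁻¹ *
      (‖diskSqrt a₃ ζ‖⁻¹ * (‖ζ - ((1 : ℝ) : ℂ)‖ * ‖diskSqrt a₄ ζ‖⁻¹)) := by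
    have : ζ ^ 2 - 1 = (ζ - ((-1 : ℝ) : ℂ)) * (ζ - ((1 : ℝ) : ℂ)) := by push_cast; ring
    rw [this, diskInvRoot]
    simp only [norm_mul, norm_inv, mul_inv]
    ring
  rw [e]
  have n2 : 0 ≤ ‖diskSqrt a₂ ζ‖⁻¹ := inv_nonneg.mpr (norm_nonneg _)
  have n3 : 0 ≤ ‖diskSqrt a₃ ζ‖⁻¹ := inv_nonneg.mpr (norm_nonneg _)
  have n4 : 0 ≤ ‖ζ - ((1 : ℝ) : ℂ)‖ * ‖diskSqrt a₄ ζ‖⁻¹ := by positivity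
  have p1 : 0 ≤ ∏ p ∈ ({a₁, -1} : Finset ℝ), |Real.cos θ - p| ^ (-(1 / 2) : ℝ) :=
    Finset.prod_nonneg fun p _ => abs_sub_rpow_nonneg _ _ _
  have p2 := abs_sub_rpow_nonneg (Real.cos θ) a₂ (-(1 / 2))
  refine (mul_le_mul (mul_le_mul b1 b2 n2 (by positivity))
    (mul_le_mul b3 b4 n4 (abs_sub_rpow_nonneg _ _ _)) (by positivity) (by positivity)).trans ?_
  apply le_of_eq
  ring

theorem diskInvRoot_conj (ha : Branches a₁ a₂ a₃ a₄) {ζ : ℂ} (hζ : ‖ζ‖ < 1) :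
    diskInvRoot a₁ a₂ a₃ a₄ (conj ζ) = conj (diskInvRoot a₁ a₂ a₃ a₄ ζ) := by
  simp only [diskInvRoot, diskSqrt_conj ha.mem₁ hζ, diskSqrt_conj ha.mem₂ hζ,
    diskSqrt_conj ha.mem₃ hζ, diskSqrt_conj ha.mem₄ hζ, map_inv₀, map_mul]

theorem differentiableAt_diskInvRoot (ha : Branches a₁ a₂ a₃ a₄) {ζ : ℂ} (hζ : ‖ζ‖ < 1) :
    DifferentiableAt ℂ (diskInvRoot a₁ a₂ a₃ a₄) ζ := by
  have d := fun a (h : a ∈ Icc (-1 : ℝ) 1) =>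
    differentiableAt_diskSqrt (quadratic_mem_slitPlane h hζ)
  refine ((((d _ ha.mem₁).mul (d _ ha.mem₂)).mul (d _ ha.mem₃)).mul (d _ ha.mem₄)).inv ?_
  exact mul_ne_zero (mul_ne_zero (mul_ne_zero (diskSqrt_ne_zero ha.mem₁ hζ)
    (diskSqrt_ne_zero ha.mem₂ hζ)) (diskSqrt_ne_zero ha.mem₃ hζ)) (diskSqrt_ne_zero ha.mem₄ hζ)

end Branches

section Boundary

variable {a₁ a₂ a₃ a₄ θ : ℝ}

theorem diskInvRoot_circle (hθ : θ ∈ Ioo 0 Real.pi) (hX : Real.cos θ ∉ singularSet a₁ a₂ a₃ a₄) :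
    4 * circleMap 0 1 θ ^ 2 * diskInvRoot a₁ a₂ a₃ a₄ (circleMap 0 1 θ) =
      cutInvRoot a₁ a₂ a₃ a₄ (Real.cos θ) := by
  simp only [singularSet, Finset.mem_union, Finset.mem_insert, Finset.mem_singleton, not_or] at hX
  obtain ⟨⟨⟨x1, xm⟩, x2⟩, x3, x4, xp⟩ := hX
  rw [diskInvRoot, cutInvRoot, diskSqrt_circle hθ x1, diskSqrt_circle hθ x2,
    diskSqrt_circle hθ x3, diskSqrt_circle hθ x4]
  have h2 : ((√2 : ℝ) : ℂ) ^ 4 = 4 := by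
    rw [← Complex.ofReal_pow, show (√(2 : ℝ)) ^ 4 = ((√2) ^ 2) ^ 2 by ring,
      Real.sq_sqrt (by norm_num)]
    norm_num
  have h3 : circleMap 0 1 (θ / 2) ^ 2 = circleMap 0 1 θ := by
    simp only [circleMap, zero_add, Complex.ofReal_one, one_mul]
    rw [← Complex.exp_nat_mul]
    congr 1; push_cast; ring
  have h4 : circleMap 0 1 θ ≠ 0 := by simp [circleMap]
  set c := circleMap 0 1 (θ / 2)
  rw [← h3] at h4 ⊢
  have : (√2 : ℂ) * c * cutSqrt a₁ (Real.cos θ) * ((√2 : ℂ) * c * cutSqrt a₂ (Real.cos θ)) *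
      ((√2 : ℂ) * c * cutSqrt a₃ (Real.cos θ)) * ((√2 : ℂ) * c * cutSqrt a₄ (Real.cos θ)) =
      (4 * (c ^ 2) ^ 2) * (cutSqrt a₁ (Real.cos θ) * cutSqrt a₂ (Real.cos θ) *
      cutSqrt a₃ (Real.cos θ) * cutSqrt a₄ (Real.cos θ)) := by
    rw [← h2]; ring
  rw [this, mul_inv, ← mul_assoc, mul_inv_cancel₀ (mul_ne_zero (by norm_num) (pow_ne_zero 2 h4)), one_mul]

theorem continuousAt_diskInvRoot_circle (hθ : θ ∈ Ioo 0 Real.pi)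
    (hX : Real.cos θ ∉ singularSet a₁ a₂ a₃ a₄) :
    ContinuousAt (diskInvRoot a₁ a₂ a₃ a₄) (circleMap 0 1 θ) := by
  simp only [singularSet, Finset.mem_union, Finset.mem_insert, Finset.mem_singleton, not_or] at hX
  obtain ⟨⟨⟨x1, xm⟩, x2⟩, x3, x4, xp⟩ := hX
  have d := fun a (h : Real.cos θ ≠ a) =>
    (differentiableAt_diskSqrt (quadratic_circle_mem_slitPlane hθ h)).continuousAt
  have n : ∀ a, Real.cos θ ≠ a → diskSqrt a (circleMap 0 1 θ) ≠ 0 := by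
    intro a h h0
    have := diskSqrt_sq a (circleMap 0 1 θ)
    rw [h0] at this
    exact Complex.slitPlane_ne_zero (quadratic_circle_mem_slitPlane hθ h) (by rw [← this]; ring)
  refine ((((d _ x1).mul (d _ x2)).mul (d _ x3)).mul (d _ x4)).inv₀ ?_
  exact mul_ne_zero (mul_ne_zero (mul_ne_zero (n _ x1) (n _ x2)) (n _ x3)) (n _ x4)

end Boundary

/-! ### Contour integrals over the unit circle -/

/-- On a circle of radius `r < 1` the integral is `2πi c₄` by the residue theorem. The symmetry
under conjugation makes the lower half the conjugate of the upper one, so the real part over the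
upper half is half of this, independently of `r`. Dominated convergence then passes to `r = 1`. -/
theorem integral_half_circle {f : ℂ → ℂ} {c₀ c₁ c₂ c₃ c₄ : ℂ} {D : ℝ → ℝ}
    (hd : ∀ z, ‖z‖ < 1 → z ≠ 0 → DifferentiableAt ℂ f z)
    (hT : HasTaylor (fun z => z ^ 5 * f z) c₀ c₁ c₂ c₃ c₄)
    (hs : ∀ z, ‖z‖ < 1 → f (conj z) = -conj (f z))
    (hc : ∀ᵐ θ ∂volume.restrict (Ioo 0 Real.pi), ContinuousAt f (circleMap 0 1 θ))
    (hD : IntegrableOn D (Ioo 0 Real.pi))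
    (hb : ∀ᵐ θ ∂volume.restrict (Ioo 0 Real.pi), ∀ r, 1 / 2 ≤ r → r < 1 →
      ‖f (circleMap 0 r θ)‖ ≤ D θ) :
    ∫ θ in Ioo 0 Real.pi, (circleMap 0 1 θ * Complex.I * f (circleMap 0 1 θ)).re =
      (Real.pi * Complex.I * c₄).re := by
  have hpi := Real.pi_pos
  have key : ∀ r : ℝ, 0 < r → r < 1 →
      ContinuousOn (fun θ : ℝ => circleMap 0 r θ * Complex.I * f (circleMap 0 r θ)) univ ∧
      ∫ θ in Ioo 0 Real.pi, (circleMap 0 r θ * Complex.I * f (circleMap 0 r θ)).re =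
      (Real.pi * Complex.I * c₄).re := by
    intro r hr hr1
    have hcont : Continuous (fun θ : ℝ => circleMap 0 r θ * Complex.I * f (circleMap 0 r θ)) := by
      refine ((continuous_circleMap 0 r).mul continuous_const).mul ?_
      rw [continuous_iff_continuousAt]
      intro θ
      refine ContinuousAt.comp (f := circleMap 0 r) ?_ (continuous_circleMap 0 r).continuousAt
      refine (hd _ ?_ ?_).continuousAt
      · rw [norm_circleMap_zero, abs_of_pos hr]; exact hr1
      · exact circleMap_ne_center hr.ne'
    refine ⟨hcont.continuousOn, ?_⟩
    have h1 := circleIntegral_eq_residue hd hT hr hr1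
    rw [circleIntegral] at h1
    simp only [deriv_circleMap, smul_eq_mul] at h1
    set h : ℝ → ℂ := fun θ => circleMap 0 r θ * Complex.I * f (circleMap 0 r θ) with hh
    have ii : ∀ a b, IntervalIntegrable h volume a b := fun a b => hcont.intervalIntegrable a b
    rw [← intervalIntegral.integral_add_adjacent_intervals (ii 0 Real.pi) (ii Real.pi _)] at h1
    have h2 : ∫ θ in Real.pi..2 * Real.pi, h θ = ∫ θ in (0 : ℝ)..Real.pi, conj (h θ) := by
      have := intervalIntegral.integral_comp_sub_left (a := 0) (b := Real.pi) h (2 * Real.pi)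
      rw [show 2 * Real.pi - Real.pi = Real.pi by ring, sub_zero] at this
      rw [← this]
      refine intervalIntegral.integral_congr fun θ _ => ?_
      have e : circleMap 0 r (2 * Real.pi - θ) = conj (circleMap 0 r θ) := by
        apply Complex.ext
        · rw [Complex.conj_re, circleMap_zero_re, circleMap_zero_re, Real.cos_two_pi_sub]
        · rw [Complex.conj_im, circleMap_zero_im, circleMap_zero_im, Real.sin_two_pi_sub]; ring
      simp only [hh, e]
      rw [hs _ (by rw [norm_circleMap_zero, abs_of_pos hr]; exact hr1)]
      simp only [map_mul, Complex.conj_I]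
      ring
    have ic : IntervalIntegrable (fun θ => conj (h θ)) volume 0 Real.pi :=
      (Complex.continuous_conj.comp hcont).intervalIntegrable _ _
    rw [h2, ← intervalIntegral.integral_add (ii _ _) ic] at h1
    have h3 : ∀ θ, h θ + conj (h θ) = ((2 * (h θ).re : ℝ) : ℂ) := fun θ => Complex.add_conj _
    simp only [h3] at h1
    rw [intervalIntegral.integral_ofReal, intervalIntegral.integral_const_mul] at h1
    rw [← integral_Ioc_eq_integral_Ioo, ← intervalIntegral.integral_of_le hpi.le]
    have h4 := congrArg Complex.re h1
    rw [Complex.ofReal_re, show 2 * (Real.pi : ℂ) * Complex.I * c₄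
      = ((2 : ℝ) : ℂ) * (Real.pi * Complex.I * c₄) by push_cast; ring, Complex.re_ofReal_mul] at h4
    linarith
  have lim : Tendsto (fun r : ℝ =>
      ∫ θ in Ioo 0 Real.pi, (circleMap 0 r θ * Complex.I * f (circleMap 0 r θ)).re) (𝓝[<] 1)
      (𝓝 (∫ θ in Ioo 0 Real.pi, (circleMap 0 1 θ * Complex.I * f (circleMap 0 1 θ)).re)) := by
    have ev : ∀ᶠ r : ℝ in 𝓝[<] 1, 1 / 2 ≤ r ∧ r < 1 := by
      filter_upwards [Ioo_mem_nhdsLT (show (1 / 2 : ℝ) < 1 by norm_num)] with r hr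
      exact ⟨hr.1.le, hr.2⟩
    apply tendsto_integral_filter_of_dominated_convergence D
    · filter_upwards [ev] with r hr
      have := (key r (by linarith) hr.2).1
      rw [continuousOn_univ] at this
      exact (Complex.continuous_re.comp this).aestronglyMeasurable
    · filter_upwards [ev] with r hr
      filter_upwards [hb] with θ hθ
      refine (Complex.abs_re_le_norm _).trans ?_
      rw [norm_mul, norm_mul, Complex.norm_I, norm_circleMap_zero,
        abs_of_nonneg (by linarith : (0 : ℝ) ≤ r), mul_one]
      have := hθ r hr.1 hr.2
      nlinarith [norm_nonneg (f (circleMap 0 r θ))]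
    · exact hD
    · filter_upwards [hc] with θ hθ
      have c1 : Tendsto (fun r : ℝ => circleMap 0 r θ) (𝓝[<] 1) (𝓝 (circleMap 0 1 θ)) := by
        refine (Continuous.tendsto ?_ 1).mono_left nhdsWithin_le_nhds
        unfold circleMap; fun_prop
      exact (Complex.continuous_re.tendsto _).comp
        ((c1.mul_const _).mul (hθ.tendsto.comp c1))
  refine tendsto_nhds_unique lim ?_
  refine Tendsto.congr' ?_ tendsto_const_nhds
  filter_upwards [Ioo_mem_nhdsLT (show (0 : ℝ) < 1 by norm_num)] with r hr
  exact (key r hr.1 hr.2).2.symm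

end DefNLS

/-! ### The contour identity in the variable `x = cos θ`. -/

namespace DefNLS

open Filter Topology Asymptotics ComplexConjugate Polynomial

theorem image_cos_Ioo : Real.cos '' Ioo 0 Real.pi = Ioo (-1) 1 := by
  ext x
  constructor
  · rintro ⟨θ, hθ, rfl⟩
    have := Real.sin_pos_of_mem_Ioo hθ
    constructor <;> nlinarith [Real.sin_sq_add_cos_sq θ]
  · intro hx
    exact ⟨Real.arccos x, ⟨Real.arccos_pos.mpr hx.2, Real.arccos_lt_pi.mpr hx.1⟩,
      Real.cos_arccos hx.1.le hx.2.le⟩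

theorem integral_Icc_eq_integral_cos (g : ℝ → ℝ) :
    ∫ x in Icc (-1) 1, g x = ∫ θ in Ioo 0 Real.pi, Real.sin θ * g (Real.cos θ) := by
  rw [integral_Icc_eq_integral_Ioo, ← image_cos_Ioo,
    integral_image_eq_integral_abs_deriv_smul measurableSet_Ioo
      (fun θ _ => (Real.hasDerivAt_cos θ).hasDerivWithinAt)
      (Real.injOn_cos.mono Ioo_subset_Icc_self)]
  refine setIntegral_congr_fun measurableSet_Ioo fun θ hθ => ?_
  simp only [smul_eq_mul, abs_neg, abs_of_pos (Real.sin_pos_of_mem_Ioo hθ)]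

theorem integrableOn_cos {g : ℝ → ℝ} (hg : IntegrableOn g (Icc (-1) 1)) :
    IntegrableOn (fun θ => Real.sin θ * g (Real.cos θ)) (Ioo 0 Real.pi) := by
  have h := (integrableOn_image_iff_integrableOn_abs_deriv_smul measurableSet_Ioo
      (fun θ _ => (Real.hasDerivAt_cos θ).hasDerivWithinAt)
      (Real.injOn_cos.mono Ioo_subset_Icc_self) g).mp
      (by rw [image_cos_Ioo]; exact hg.mono_set Ioo_subset_Icc_self)
  refine h.congr_fun (fun θ hθ => ?_) measurableSet_Ioo
  simp only [smul_eq_mul, abs_neg, abs_of_pos (Real.sin_pos_of_mem_Ioo hθ)]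

theorem ae_cos_notMem (s : Finset ℝ) :
    ∀ᵐ θ ∂volume.restrict (Ioo 0 Real.pi), θ ∈ Ioo 0 Real.pi ∧ Real.cos θ ∉ s := by
  refine (ae_restrict_mem measurableSet_Ioo).and ?_
  rw [ae_restrict_iff' measurableSet_Ioo]
  have hf : (Ioo 0 Real.pi ∩ Real.cos ⁻¹' (s : Set ℝ)).Finite := by
    apply Set.Finite.of_finite_image (f := Real.cos)
    · exact s.finite_toSet.subset (by rintro _ ⟨θ, hθ, rfl⟩; exact hθ.2)
    · exact Real.injOn_cos.mono fun θ hθ => Ioo_subset_Icc_self hθ.1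
  filter_upwards [hf.measure_zero volume |> measure_eq_zero_iff_ae_notMem.mp] with θ h1 h2 h3
  exact h1 ⟨h2, h3⟩

/-- The pull-back of `G(ζ) N(z) / √(∏ (z - aⱼ)) dz` under `z = (ζ + 1 / ζ) / 2`. -/
noncomputable def diskForm (a₁ a₂ a₃ a₄ : ℝ) (N : ℝ[X]) (G : ℂ → ℂ) (ζ : ℂ) : ℂ :=
  G ζ * aeval ((ζ + ζ⁻¹) / 2) N * (2 * ((ζ ^ 2 - 1) * diskInvRoot a₁ a₂ a₃ a₄ ζ))

theorem exists_norm_aeval_le (N : ℝ[X]) : ∃ C, 0 ≤ C ∧ ∀ z : ℂ, ‖z‖ ≤ 2 → ‖aeval z N‖ ≤ C := by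
  obtain ⟨C, hC⟩ := (isCompact_closedBall (0 : ℂ) 2).exists_bound_of_continuousOn
    (f := fun z => aeval z N) (Polynomial.continuous_aeval N).continuousOn
  refine ⟨|C|, abs_nonneg _, fun z hz => (hC z (by simpa using hz)).trans (le_abs_self _)⟩

theorem norm_joukowski_le {r θ : ℝ} (hr : 1 / 2 ≤ r) (hr1 : r < 1) :
    ‖(circleMap 0 r θ + (circleMap 0 r θ)⁻¹) / 2‖ ≤ 2 := by
  rw [norm_div]
  have h1 := norm_add_le (circleMap 0 r θ) (circleMap 0 r θ)⁻¹
  rw [norm_inv, norm_circleMap_zero, abs_of_nonneg (by linarith)] at h1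
  have h2 : r⁻¹ ≤ 2 := by
    rw [inv_le_comm₀ (by linarith) (by norm_num)]; linarith
  simp only [Complex.norm_ofNat]
  linarith

theorem joukowski_circle (θ : ℝ) :
    (circleMap 0 1 θ + (circleMap 0 1 θ)⁻¹) / 2 = (Real.cos θ : ℂ) := by
  simp only [circleMap, zero_add, Complex.ofReal_one, one_mul, Complex.ofReal_cos, Complex.cos]
  rw [← Complex.exp_neg, neg_mul]

theorem circle_sq_sub_one (θ : ℝ) :
    circleMap 0 1 θ ^ 2 - 1 = 2 * Complex.I * Real.sin θ * circleMap 0 1 θ := by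
  have h0 : circleMap 0 1 θ ≠ 0 := circleMap_ne_center one_ne_zero
  have : (circleMap 0 1 θ - (circleMap 0 1 θ)⁻¹) = 2 * Complex.I * Real.sin θ := by
    simp only [circleMap, zero_add, Complex.ofReal_one, one_mul, Complex.ofReal_sin, Complex.sin]
    rw [← Complex.exp_neg, neg_mul]
    linear_combination (-(Complex.exp (-(θ * Complex.I)) - Complex.exp (θ * Complex.I))) * Complex.I_sq
  rw [← this, sub_mul, inv_mul_cancel₀ h0, sq]

/-- `integral_half_circle` for `diskForm`. Since `dz = (ζ² - 1)/(2ζ²) dζ` and the four roots give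
`4ζ²`, the form is `2(ζ² - 1)` times `diskInvRoot`. On the circle `ζ² - 1 = 2i sin θ ζ`, which
produces the Jacobian and the minus sign. The point `y` is where `G` may have a logarithmic
singularity. -/
theorem Branches.contour_identity {a₁ a₂ a₃ a₄ : ℝ} (ha : Branches a₁ a₂ a₃ a₄) (N : ℝ[X])
    {G : ℂ → ℂ} {g : ℝ → ℂ} {y K : ℝ} {c₀ c₁ c₂ c₃ c₄ : ℂ} (hK : 0 ≤ K)
    (hGd : ∀ ζ, ‖ζ‖ < 1 → ζ ≠ 0 → DifferentiableAt ℂ G ζ)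
    (hGs : ∀ ζ, ‖ζ‖ < 1 → G (conj ζ) = -conj (G ζ))
    (hGc : ∀ θ ∈ Ioo 0 Real.pi, Real.cos θ ≠ y → ContinuousAt G (circleMap 0 1 θ))
    (hGb : ∀ θ ∈ Ioo 0 Real.pi, Real.cos θ ≠ y → ∀ r, 1 / 2 ≤ r → r < 1 →
      ‖G (circleMap 0 r θ)‖ ≤ K * (1 + |Real.cos θ - y| ^ (-(1 / 4) : ℝ)))
    (hg : ∀ θ ∈ Ioo 0 Real.pi, Real.cos θ ≠ y → G (circleMap 0 1 θ) = g (Real.cos θ))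
    (hT : HasTaylor (fun ζ => ζ ^ 5 * diskForm a₁ a₂ a₃ a₄ N G ζ) c₀ c₁ c₂ c₃ c₄) :
    ∫ x in Icc (-1) 1, (g x * N.eval x * cutInvRoot a₁ a₂ a₃ a₄ x).re
      = -(Real.pi * Complex.I * c₄).re := by
  classical
  obtain ⟨CN, hCN, hN⟩ := exists_norm_aeval_le N
  obtain ⟨M, hM, hmaj⟩ := exists_mul_prod_le_majorant (singularSet a₁ a₂ a₃ a₄)
  have hae := ae_cos_notMem (insert y (singularSet a₁ a₂ a₃ a₄))
  have key := integral_half_circle (f := diskForm a₁ a₂ a₃ a₄ N G)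
    (D := fun θ => Real.sin θ *
      (K * CN * 8 * M * majorant (singularSet a₁ a₂ a₃ a₄) y (Real.cos θ))) ?_ hT ?_ ?_ ?_ ?_
  · rw [← key, integral_Icc_eq_integral_cos, ← integral_neg]
    refine integral_congr_ae ?_
    filter_upwards [hae] with θ hθ
    obtain ⟨h1, h2⟩ := hθ
    simp only [Finset.mem_insert, not_or] at h2
    have e : circleMap 0 1 θ * Complex.I * diskForm a₁ a₂ a₃ a₄ N G (circleMap 0 1 θ)
        = ((-Real.sin θ : ℝ) : ℂ) *
          (g (Real.cos θ) * N.eval (Real.cos θ) * cutInvRoot a₁ a₂ a₃ a₄ (Real.cos θ)) := by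
      rw [← diskInvRoot_circle h1 h2.2, ← hg θ h1 h2.1, diskForm, joukowski_circle,
        circle_sq_sub_one, ← Complex.coe_algebraMap, aeval_algebraMap_apply,
        Complex.coe_algebraMap]
      simp only [Polynomial.coe_aeval_eq_eval]
      push_cast
      linear_combination (4 * circleMap 0 1 θ ^ 2 * G (circleMap 0 1 θ) * ((N.eval (Real.cos θ) : ℝ) : ℂ)
        * Complex.sin θ * diskInvRoot a₁ a₂ a₃ a₄ (circleMap 0 1 θ)) * Complex.I_sq
    rw [e, Complex.re_ofReal_mul]
    ring
  · intro z hz hz0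
    unfold diskForm
    refine ((hGd z hz hz0).mul ?_).mul (DifferentiableAt.mul (by fun_prop)
      (DifferentiableAt.mul (by fun_prop) (ha.differentiableAt_diskInvRoot hz)))
    exact (Polynomial.differentiable_aeval N).differentiableAt.comp z
      ((differentiableAt_id.add (differentiableAt_inv hz0)).div_const 2)
  · intro z hz
    unfold diskForm
    rw [hGs z hz, ha.diskInvRoot_conj hz]
    have : (conj z + (conj z)⁻¹) / 2 = conj ((z + z⁻¹) / 2) := by
      simp [map_div₀, map_inv₀, Complex.conj_ofNat]
    rw [this, aeval_conj]
    simp only [map_mul, map_sub, map_pow, map_one, map_ofNat]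
    ring
  · filter_upwards [hae] with θ hθ
    obtain ⟨h1, h2⟩ := hθ
    simp only [Finset.mem_insert, not_or] at h2
    have h0 : circleMap 0 1 θ ≠ 0 := circleMap_ne_center one_ne_zero
    unfold diskForm
    refine ((hGc θ h1 h2.1).mul ?_).mul (ContinuousAt.mul (by fun_prop)
      (ContinuousAt.mul (by fun_prop) (continuousAt_diskInvRoot_circle h1 h2.2)))
    exact (Polynomial.continuous_aeval N).continuousAt.comp
      ((continuousAt_id.add (continuousAt_inv₀ h0)).div_const 2)
  · exact integrableOn_cos ((integrableOn_majorant _ _).const_mul _)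
  · filter_upwards [hae] with θ hθ r hr hr1
    obtain ⟨h1, h2⟩ := hθ
    simp only [Finset.mem_insert, not_or] at h2
    have b1 := hGb θ h1 h2.1 r hr hr1
    have b2 := hN _ (norm_joukowski_le (θ := θ) hr hr1)
    have b3 := ha.norm_sq_sub_one_mul_diskInvRoot_le h1 hr hr1 h2.2
    have b4 := hmaj y (Real.cos θ)
    have s0 := Real.sin_pos_of_mem_Ioo h1
    unfold diskForm
    rw [norm_mul, norm_mul, norm_mul, Complex.norm_ofNat]
    have q0 := abs_sub_rpow_nonneg (Real.cos θ) y (-(1 / 4))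
    calc _ ≤ K * (1 + |Real.cos θ - y| ^ (-(1 / 4) : ℝ)) * CN * (2 * (4 * (Real.sin θ *
          ∏ p ∈ singularSet a₁ a₂ a₃ a₄, |Real.cos θ - p| ^ (-(1 / 2) : ℝ)))) := by
          gcongr
      _ = K * CN * 8 * Real.sin θ * ((1 + |Real.cos θ - y| ^ (-(1 / 4) : ℝ)) *
          ∏ p ∈ singularSet a₁ a₂ a₃ a₄, |Real.cos θ - p| ^ (-(1 / 2) : ℝ)) := by ring
      _ ≤ K * CN * 8 * Real.sin θ * (M * majorant (singularSet a₁ a₂ a₃ a₄) y (Real.cos θ)) := by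
          gcongr
      _ = _ := by ring

end DefNLS

/-! ### Splitting boundary integrals into bands and gaps. -/

namespace DefNLS

open Filter Topology Asymptotics ComplexConjugate Polynomial

/-- `1 / √|∏ (X - aⱼ)|`. -/
noncomputable def absInvRoot (a₁ a₂ a₃ a₄ X : ℝ) : ℝ :=
  (√|X - a₁| * √|X - a₂| * √|X - a₃| * √|X - a₄|)⁻¹

/-- The integral of `N(x) / √|∏ (x - aⱼ)|` over the gap `(b, c)`. -/
noncomputable def gapIntegral (a₁ a₂ a₃ a₄ : ℝ) (N : ℝ[X]) (b c : ℝ) : ℝ :=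
  ∫ x in Ioo b c, N.eval x * absInvRoot a₁ a₂ a₃ a₄ x

theorem norm_cutInvRoot (a₁ a₂ a₃ a₄ X : ℝ) :
    ‖cutInvRoot a₁ a₂ a₃ a₄ X‖ = absInvRoot a₁ a₂ a₃ a₄ X := by
  simp only [cutInvRoot, absInvRoot, norm_inv, norm_mul, norm_cutSqrt]

theorem measurable_cutSqrt (a : ℝ) : Measurable (cutSqrt a) := by
  unfold cutSqrt
  refine Measurable.ite measurableSet_Ici ?_ ?_ <;> fun_prop

theorem measurable_cutInvRoot (a₁ a₂ a₃ a₄ : ℝ) : Measurable (cutInvRoot a₁ a₂ a₃ a₄) := by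
  unfold cutInvRoot
  exact ((((measurable_cutSqrt _).mul (measurable_cutSqrt _)).mul (measurable_cutSqrt _)).mul
    (measurable_cutSqrt _)).inv

/-- The set of branch points. -/
noncomputable def branchSet (a₁ a₂ a₃ a₄ : ℝ) : Finset ℝ := {a₁, a₂, a₃, a₄}

namespace Branches

variable {a₁ a₂ a₃ a₄ : ℝ}

theorem absInvRoot_eq_prod (ha : Branches a₁ a₂ a₃ a₄) (X : ℝ) : absInvRoot a₁ a₂ a₃ a₄ X =
    ∏ p ∈ branchSet a₁ a₂ a₃ a₄, |X - p| ^ (-(1 / 2) : ℝ) := by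
  obtain ⟨h₀₁, h₁₂, h₂₃, h₃₄, h₄₅⟩ := ha
  unfold branchSet
  rw [Finset.prod_insert, Finset.prod_insert, Finset.prod_pair h₃₄.ne]
  · simp only [rpow_neg_half_eq _ (abs_nonneg _), absInvRoot, mul_inv]
    ring
  · simp only [Finset.mem_insert, Finset.mem_singleton, not_or]
    exact ⟨h₂₃.ne, (h₂₃.trans h₃₄).ne⟩
  · simp only [Finset.mem_insert, Finset.mem_singleton, not_or]
    exact ⟨h₁₂.ne, (h₁₂.trans h₂₃).ne, (h₁₂.trans (h₂₃.trans h₃₄)).ne⟩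

theorem exists_mul_absInvRoot_le (ha : Branches a₁ a₂ a₃ a₄) (N : ℝ[X]) :
    ∃ C, 0 ≤ C ∧ ∀ y, ∀ x ∈ Icc (-1 : ℝ) 1,
      (1 + |x - y| ^ (-(1 / 4) : ℝ)) * (|N.eval x| * absInvRoot a₁ a₂ a₃ a₄ x) ≤
        C * majorant (branchSet a₁ a₂ a₃ a₄) y x := by
  obtain ⟨M, hM, h⟩ := exists_mul_prod_le_majorant (branchSet a₁ a₂ a₃ a₄)
  obtain ⟨CN, hN⟩ := (isCompact_Icc (a := (-1 : ℝ)) (b := 1)).exists_bound_of_continuousOn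
    (f := fun x => N.eval x) N.continuous.continuousOn
  refine ⟨|CN| * M, by positivity, fun y x hx => ?_⟩
  have h1 := h y x
  rw [← ha.absInvRoot_eq_prod] at h1
  have h2 : |N.eval x| ≤ |CN| := (hN x hx).trans (le_abs_self _)
  have h3 : 0 ≤ (1 + |x - y| ^ (-(1 / 4) : ℝ)) * absInvRoot a₁ a₂ a₃ a₄ x :=
    mul_nonneg (by linarith [abs_sub_rpow_nonneg x y (-(1 / 4))])
      (by unfold absInvRoot; positivity)
  calc _ = |N.eval x| * ((1 + |x - y| ^ (-(1 / 4) : ℝ)) * absInvRoot a₁ a₂ a₃ a₄ x) := by ring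
    _ ≤ |CN| * (M * majorant (branchSet a₁ a₂ a₃ a₄) y x) := by gcongr
    _ = _ := by ring

theorem integrableOn_mul_cutInvRoot (ha : Branches a₁ a₂ a₃ a₄) (N : ℝ[X]) {g : ℝ → ℂ} {y K : ℝ}
    (hK : 0 ≤ K) (hgm : Measurable g)
    (hgb : ∀ x ∈ Icc (-1 : ℝ) 1, ‖g x‖ ≤ K * (1 + |x - y| ^ (-(1 / 4) : ℝ))) :
    IntegrableOn (fun x => g x * N.eval x * cutInvRoot a₁ a₂ a₃ a₄ x) (Icc (-1) 1) := by
  obtain ⟨C, hC, h⟩ := ha.exists_mul_absInvRoot_le N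
  refine Integrable.mono' ((integrableOn_majorant (branchSet a₁ a₂ a₃ a₄) y).const_mul (K * C))
    ?_ ?_
  · exact ((hgm.mul (Complex.measurable_ofReal.comp N.continuous.measurable)).mul
      (measurable_cutInvRoot _ _ _ _)).aestronglyMeasurable
  · refine (ae_restrict_iff' measurableSet_Icc).mpr (Eventually.of_forall fun x hx => ?_)
    rw [norm_mul, norm_mul, norm_cutInvRoot, Complex.norm_real, Real.norm_eq_abs]
    have h0 : 0 ≤ |N.eval x| * absInvRoot a₁ a₂ a₃ a₄ x :=
      mul_nonneg (abs_nonneg _) (by unfold absInvRoot; positivity)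
    calc _ = ‖g x‖ * (|N.eval x| * absInvRoot a₁ a₂ a₃ a₄ x) := by ring
      _ ≤ K * (1 + |x - y| ^ (-(1 / 4) : ℝ)) * (|N.eval x| * absInvRoot a₁ a₂ a₃ a₄ x) :=
        mul_le_mul_of_nonneg_right (hgb x hx) h0
      _ = K * ((1 + |x - y| ^ (-(1 / 4) : ℝ)) * (|N.eval x| * absInvRoot a₁ a₂ a₃ a₄ x)) := by ring
      _ ≤ K * (C * majorant (branchSet a₁ a₂ a₃ a₄) y x) :=
        mul_le_mul_of_nonneg_left (h y x hx) hK
      _ = _ := by ring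

/-- Each branch point to the right of `X` contributes a factor `-i` to the root: three here, one in
the second gap, an even number on the bands. Hence the opposite signs on the two gaps and the real
values on the bands. -/
theorem cutInvRoot_gap₁ (ha : Branches a₁ a₂ a₃ a₄) {X : ℝ} (hX : X ∈ Ioo a₁ a₂) :
    cutInvRoot a₁ a₂ a₃ a₄ X = -Complex.I * (absInvRoot a₁ a₂ a₃ a₄ X : ℂ) := by
  obtain ⟨h₀₁, h₁₂, h₂₃, h₃₄, h₄₅⟩ := ha
  obtain ⟨h1, h2⟩ := hX
  simp only [cutInvRoot, absInvRoot, cutSqrt, h1.le, if_true, if_neg (not_le.mpr h2),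
    if_neg (not_le.mpr (h2.trans h₂₃)), if_neg (not_le.mpr (h2.trans (h₂₃.trans h₃₄)))]
  rw [abs_of_pos (by linarith : 0 < X - a₁), abs_of_neg (by linarith : X - a₂ < 0),
    abs_of_neg (by linarith : X - a₃ < 0), abs_of_neg (by linarith : X - a₄ < 0)]
  simp only [neg_sub, Complex.ofReal_inv, Complex.ofReal_mul, mul_inv, inv_neg, Complex.inv_I]
  ring_nf
  simp only [Complex.I_pow_three]
  ring

theorem cutInvRoot_gap₂ (ha : Branches a₁ a₂ a₃ a₄) {X : ℝ} (hX : X ∈ Ioo a₃ a₄) :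
    cutInvRoot a₁ a₂ a₃ a₄ X = Complex.I * (absInvRoot a₁ a₂ a₃ a₄ X : ℂ) := by
  obtain ⟨h₀₁, h₁₂, h₂₃, h₃₄, h₄₅⟩ := ha
  obtain ⟨h1, h2⟩ := hX
  simp only [cutInvRoot, absInvRoot, cutSqrt, h1.le, if_true, if_neg (not_le.mpr h2),
    (h₂₃.trans h1).le, (h₁₂.trans (h₂₃.trans h1)).le]
  rw [abs_of_pos (by linarith : 0 < X - a₁), abs_of_pos (by linarith : 0 < X - a₂),
    abs_of_pos (by linarith : 0 < X - a₃), abs_of_neg (by linarith : X - a₄ < 0)]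
  simp only [neg_sub, Complex.ofReal_inv, Complex.ofReal_mul, mul_inv, inv_neg, Complex.inv_I]
  ring

theorem cutInvRoot_im (ha : Branches a₁ a₂ a₃ a₄) {X : ℝ} (hX : X ∈ genusOneSupport a₁ a₂ a₃ a₄) :
    (cutInvRoot a₁ a₂ a₃ a₄ X).im = 0 := by
  obtain ⟨h₀₁, h₁₂, h₂₃, h₃₄, h₄₅⟩ := ha
  have main : ∃ r : ℝ, cutSqrt a₁ X * cutSqrt a₂ X * cutSqrt a₃ X * cutSqrt a₄ X = r := by
    rcases hX with (⟨h1, h2⟩ | ⟨h1, h2⟩) | ⟨h1, h2⟩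
    · rcases h2.eq_or_lt with rfl | h2
      · exact ⟨0, by simp [cutSqrt]⟩
      · refine ⟨√(a₁ - X) * √(a₂ - X) * √(a₃ - X) * √(a₄ - X), ?_⟩
        simp only [cutSqrt, if_neg (not_le.mpr h2), if_neg (not_le.mpr (h2.trans h₁₂)),
          if_neg (not_le.mpr (h2.trans (h₁₂.trans h₂₃))),
          if_neg (not_le.mpr (h2.trans (h₁₂.trans (h₂₃.trans h₃₄))))]
        push_cast
        ring_nf
        simp only [Complex.I_pow_four]
        ring
    · rcases h2.eq_or_lt with rfl | h2
      · exact ⟨0, by simp [cutSqrt]⟩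
      · refine ⟨-(√(X - a₁) * √(X - a₂) * √(a₃ - X) * √(a₄ - X)), ?_⟩
        simp only [cutSqrt, if_pos h1, if_pos (h₁₂.le.trans h1), if_neg (not_le.mpr h2),
          if_neg (not_le.mpr (h2.trans h₃₄))]
        push_cast
        ring_nf
        simp only [Complex.I_sq]
        ring
    · refine ⟨√(X - a₁) * √(X - a₂) * √(X - a₃) * √(X - a₄), ?_⟩
      simp only [cutSqrt, if_pos h1, if_pos (h₃₄.le.trans h1), if_pos (h₂₃.le.trans (h₃₄.le.trans h1)),
        if_pos (h₁₂.le.trans (h₂₃.le.trans (h₃₄.le.trans h1)))]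
      push_cast
      ring
  obtain ⟨r, hr⟩ := main
  rw [cutInvRoot, hr, ← Complex.ofReal_inv, Complex.ofReal_im]

theorem Icc_eq (ha : Branches a₁ a₂ a₃ a₄) :
    Icc (-1 : ℝ) 1 = genusOneSupport a₁ a₂ a₃ a₄ ∪ (Ioo a₁ a₂ ∪ Ioo a₃ a₄) := by
  obtain ⟨h₀₁, h₁₂, h₂₃, h₃₄, h₄₅⟩ := ha
  ext x
  simp only [genusOneSupport, mem_union, mem_Icc, mem_Ioo]
  constructor
  · rintro ⟨h1, h2⟩
    by_cases q1 : x ≤ a₁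
    · exact Or.inl (Or.inl (Or.inl ⟨h1, q1⟩))
    by_cases q2 : x < a₂
    · exact Or.inr (Or.inl ⟨not_le.mp q1, q2⟩)
    by_cases q3 : x ≤ a₃
    · exact Or.inl (Or.inl (Or.inr ⟨not_lt.mp q2, q3⟩))
    by_cases q4 : x < a₄
    · exact Or.inr (Or.inr ⟨not_le.mp q3, q4⟩)
    · exact Or.inl (Or.inr ⟨not_lt.mp q4, h2⟩)
  · rintro (((⟨h1, h2⟩ | ⟨h1, h2⟩) | ⟨h1, h2⟩) | (⟨h1, h2⟩ | ⟨h1, h2⟩)) <;>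
      constructor <;> linarith

theorem support_subset (ha : Branches a₁ a₂ a₃ a₄) :
    genusOneSupport a₁ a₂ a₃ a₄ ⊆ Icc (-1 : ℝ) 1 := by
  rw [ha.Icc_eq]; exact subset_union_left

theorem measurableSet_support (a₁ a₂ a₃ a₄ : ℝ) : MeasurableSet (genusOneSupport a₁ a₂ a₃ a₄) :=
  (measurableSet_Icc.union measurableSet_Icc).union measurableSet_Icc

theorem disjoint_support (ha : Branches a₁ a₂ a₃ a₄) :
    Disjoint (genusOneSupport a₁ a₂ a₃ a₄) (Ioo a₁ a₂ ∪ Ioo a₃ a₄) := by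
  obtain ⟨h₀₁, h₁₂, h₂₃, h₃₄, h₄₅⟩ := ha
  rw [Set.disjoint_left]
  rintro x ((⟨h1, h2⟩ | ⟨h1, h2⟩) | ⟨h1, h2⟩) (⟨h3, h4⟩ | ⟨h3, h4⟩) <;> linarith

/-- Splitting of a boundary integral into the bands and the gaps. -/
theorem integral_split (ha : Branches a₁ a₂ a₃ a₄) (N : ℝ[X]) {g : ℝ → ℂ} {y K k₁ k₂ : ℝ}
    (hK : 0 ≤ K) (hgm : Measurable g)
    (hgb : ∀ x ∈ Icc (-1 : ℝ) 1, ‖g x‖ ≤ K * (1 + |x - y| ^ (-(1 / 4) : ℝ)))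
    (hk₁ : ∀ x ∈ Ioo a₁ a₂, (g x).im = k₁) (hk₂ : ∀ x ∈ Ioo a₃ a₄, (g x).im = k₂) :
    ∫ x in Icc (-1) 1, (g x * N.eval x * cutInvRoot a₁ a₂ a₃ a₄ x).re =
      (∫ x in genusOneSupport a₁ a₂ a₃ a₄,
        (g x).re * (N.eval x * (cutInvRoot a₁ a₂ a₃ a₄ x).re))
      + (k₁ * gapIntegral a₁ a₂ a₃ a₄ N a₁ a₂ - k₂ * gapIntegral a₁ a₂ a₃ a₄ N a₃ a₄) := by
  have hi := (ha.integrableOn_mul_cutInvRoot N hK hgm hgb).re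
  have hi' : IntegrableOn (fun x => (g x * N.eval x * cutInvRoot a₁ a₂ a₃ a₄ x).re)
    (Icc (-1) 1) := hi
  rw [ha.Icc_eq] at hi' ⊢
  rw [setIntegral_union ha.disjoint_support (measurableSet_Ioo.union measurableSet_Ioo)
    (hi'.mono_set subset_union_left) (hi'.mono_set subset_union_right),
    setIntegral_union _ measurableSet_Ioo
      (hi'.mono_set (subset_union_left.trans subset_union_right))
      (hi'.mono_set (subset_union_right.trans subset_union_right))]
  · congr 1
    · refine setIntegral_congr_fun (measurableSet_support _ _ _ _) fun x hx => ?_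
      simp only [Complex.mul_re, Complex.mul_im, Complex.ofReal_re, Complex.ofReal_im,
        ha.cutInvRoot_im hx]
      ring
    · rw [sub_eq_add_neg]
      congr 1
      · rw [gapIntegral, ← integral_const_mul]
        refine setIntegral_congr_fun measurableSet_Ioo fun x hx => ?_
        simp only [ha.cutInvRoot_gap₁ hx, ← hk₁ x hx, Complex.mul_re, Complex.mul_im,
          Complex.ofReal_re, Complex.ofReal_im, Complex.neg_re, Complex.neg_im, Complex.I_re,
          Complex.I_im]
        ring
      · rw [gapIntegral, ← neg_mul, ← integral_const_mul]
        refine setIntegral_congr_fun measurableSet_Ioo fun x hx => ?_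
        simp only [ha.cutInvRoot_gap₂ hx, ← hk₂ x hx, Complex.mul_re, Complex.mul_im,
          Complex.ofReal_re, Complex.ofReal_im, Complex.I_re, Complex.I_im]
        ring
  · rw [Set.disjoint_left]
    rintro x ⟨h1, h2⟩ ⟨h3, h4⟩
    linarith [ha.h₂₃]

end Branches

end DefNLS

/-! ### Residues for quartic numerators; gap integrals and moments obtained from them. -/

namespace DefNLS

open Filter Topology Asymptotics ComplexConjugate Polynomial

theorem hasTaylor_poly_add (c₀ c₁ c₂ c₃ c₄ : ℂ) {r : ℂ → ℂ} (hr : Continuous r) :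
    HasTaylor (fun z => c₀ + c₁ * z + c₂ * z ^ 2 + c₃ * z ^ 3 + c₄ * z ^ 4 + z ^ 5 * r z)
      c₀ c₁ c₂ c₃ c₄ := by
  have := (isBigO_refl (fun z : ℂ => z ^ 5) (𝓝[≠] 0)).mul (isBigO_one_of_continuous hr)
  simp only [mul_one] at this
  refine this.congr_left fun z => ?_
  ring

/-- The elementary symmetric functions of the branch points. -/
structure IsEsymm (a₁ a₂ a₃ a₄ e₁ e₂ e₃ e₄ : ℝ) : Prop where
  h₁ : e₁ = a₁ + a₂ + a₃ + a₄
  h₂ : e₂ = a₁ * a₂ + a₁ * a₃ + a₁ * a₄ + a₂ * a₃ + a₂ * a₄ + a₃ * a₄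
  h₃ : e₃ = a₁ * a₂ * a₃ + a₁ * a₂ * a₄ + a₁ * a₃ * a₄ + a₂ * a₃ * a₄
  h₄ : e₄ = a₁ * a₂ * a₃ * a₄

/-- A real polynomial of degree at most four. -/
noncomputable def quartic (n₀ n₁ n₂ n₃ n₄ : ℝ) : ℝ[X] :=
  C n₀ + C n₁ * X + C n₂ * X ^ 2 + C n₃ * X ^ 3 + C n₄ * X ^ 4

theorem eval_quartic (n₀ n₁ n₂ n₃ n₄ x : ℝ) :
    (quartic n₀ n₁ n₂ n₃ n₄).eval x = n₀ + n₁ * x + n₂ * x ^ 2 + n₃ * x ^ 3 + n₄ * x ^ 4 := by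
  simp [quartic]

theorem aeval_quartic (n₀ n₁ n₂ n₃ n₄ : ℝ) (z : ℂ) :
    aeval z (quartic n₀ n₁ n₂ n₃ n₄) =
      n₀ + n₁ * z + n₂ * z ^ 2 + n₃ * z ^ 3 + n₄ * z ^ 4 := by
  simp [quartic]

theorem hasTaylor_quartic (n₀ n₁ n₂ n₃ n₄ : ℝ) :
    HasTaylor (fun ζ => ζ ^ 4 * aeval ((ζ + ζ⁻¹) / 2) (quartic n₀ n₁ n₂ n₃ n₄))
      (n₄ / 16) (n₃ / 8) (n₄ / 4 + n₂ / 4) (3 * n₃ / 8 + n₁ / 2) (3 * n₄ / 8 + n₂ / 2 + n₀) := by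
  refine (hasTaylor_poly_add _ _ _ _ _ (r := fun ζ : ℂ => (3 * n₃ / 8 + n₁ / 2)
    + (n₄ / 4 + n₂ / 4) * ζ + n₃ / 8 * ζ ^ 2 + n₄ / 16 * ζ ^ 3) (by fun_prop)).of_eq
    (fun ζ hζ => ?_) rfl rfl rfl rfl rfl
  rw [aeval_quartic]
  field_simp
  ring

theorem Branches.hasTaylor_diskInvRoot {a₁ a₂ a₃ a₄ e₁ e₂ e₃ e₄ : ℝ} (ha : Branches a₁ a₂ a₃ a₄)
    (he : IsEsymm a₁ a₂ a₃ a₄ e₁ e₂ e₃ e₄) :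
    HasTaylor (diskInvRoot a₁ a₂ a₃ a₄) 1 e₁ (-2 - 2 * e₂ + 3 / 2 * e₁ ^ 2)
      (-3 * e₁ + 4 * e₃ - 6 * e₁ * e₂ + 5 / 2 * e₁ ^ 3)
      (-3 - 4 * e₂ - 8 * e₄ + 6 * (1 + e₂) ^ 2 + 9 * e₁ ^ 2 + 12 * e₁ * e₃
        - 15 * e₁ ^ 2 * (1 + e₂) + 35 / 8 * e₁ ^ 4) := by
  have hq : ∀ a : ℝ, HasTaylor (fun ζ => 1 - 2 * a * ζ + ζ ^ 2) 1 (-2 * a) 1 0 0 := fun a =>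
    (hasTaylor_poly 1 (-2 * a) 1 0 0).of_eq (fun z _ => by ring) rfl rfl rfl rfl rfl
  have hh := (((hq a₁).mul (hq a₂)).mul (hq a₃)).mul (hq a₄)
  have hball : ∀ᶠ ζ : ℂ in 𝓝[≠] 0, ‖ζ‖ < 1 := by
    refine nhdsWithin_le_nhds ?_
    filter_upwards [Metric.ball_mem_nhds (0 : ℂ) one_pos] with ζ hζ
    simpa using hζ
  have hlim : Tendsto (diskInvRoot a₁ a₂ a₃ a₄) (𝓝[≠] 0) (𝓝 1) := by
    have := (ha.differentiableAt_diskInvRoot (ζ := 0) (by simp)).continuousAt.tendsto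
    rw [show diskInvRoot a₁ a₂ a₃ a₄ 0 = 1 by simp [diskInvRoot, diskSqrt_zero]] at this
    exact this.mono_left nhdsWithin_le_nhds
  have hh' : HasTaylor (fun ζ => (1 - 2 * a₁ * ζ + ζ ^ 2) * (1 - 2 * a₂ * ζ + ζ ^ 2) *
      (1 - 2 * a₃ * ζ + ζ ^ 2) * (1 - 2 * a₄ * ζ + ζ ^ 2))
      1 (-2 * e₁) (4 + 4 * e₂) (-6 * e₁ - 8 * e₃) (6 + 8 * e₂ + 16 * e₄) := by
    refine hh.of_eq (fun _ _ => rfl) (by ring) ?_ ?_ ?_ ?_ <;>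
      simp only [he.h₁, he.h₂, he.h₃, he.h₄] <;> push_cast <;> ring
  refine (hasTaylor_of_sq_mul_eq_one hh' hlim ?_).of_eq (fun _ _ => rfl) rfl ?_ ?_ ?_ ?_
  · filter_upwards [hball] with ζ hζ
    rw [← diskSqrt_sq, ← diskSqrt_sq, ← diskSqrt_sq, ← diskSqrt_sq, diskInvRoot]
    have n1 := diskSqrt_ne_zero ha.mem₁ hζ
    have n2 := diskSqrt_ne_zero ha.mem₂ hζ
    have n3 := diskSqrt_ne_zero ha.mem₃ hζ
    have n4 := diskSqrt_ne_zero ha.mem₄ hζ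
    field_simp
  all_goals ring

/-- Residue of a disc form with a quartic numerator. -/
theorem Branches.hasTaylor_diskForm {a₁ a₂ a₃ a₄ e₁ e₂ e₃ e₄ : ℝ} (ha : Branches a₁ a₂ a₃ a₄)
    (he : IsEsymm a₁ a₂ a₃ a₄ e₁ e₂ e₃ e₄) (n₀ n₁ n₂ n₃ n₄ : ℝ) {G : ℂ → ℂ} {g₀ g₁ g₂ g₃ g₄ c : ℂ}
    (hG : HasTaylor (fun ζ => ζ * G ζ) g₀ g₁ g₂ g₃ g₄)
    -- The `τ` abbreviate Taylor coefficients of the inverse root and the `ν` those of `ζ⁴ N`. The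
    -- two groups of terms come from the `-1` and the `ζ²` in `ζ² - 1`.
    (hc : ∀ τ₂ τ₃ τ₄ ν₂ ν₃ ν₄ : ℝ, τ₂ = -2 - 2 * e₂ + 3 / 2 * e₁ ^ 2 →
      τ₃ = -3 * e₁ + 4 * e₃ - 6 * e₁ * e₂ + 5 / 2 * e₁ ^ 3 →
      τ₄ = -3 - 4 * e₂ - 8 * e₄ + 6 * (1 + e₂) ^ 2 + 9 * e₁ ^ 2 + 12 * e₁ * e₃
        - 15 * e₁ ^ 2 * (1 + e₂) + 35 / 8 * e₁ ^ 4 →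
      ν₂ = n₄ / 4 + n₂ / 4 → ν₃ = 3 * n₃ / 8 + n₁ / 2 → ν₄ = 3 * n₄ / 8 + n₂ / 2 + n₀ →
      c = -2 * (g₀ * (ν₄ + ν₃ * e₁ + ν₂ * τ₂ + n₃ / 8 * τ₃ + n₄ / 16 * τ₄)
          + g₁ * (ν₃ + ν₂ * e₁ + n₃ / 8 * τ₂ + n₄ / 16 * τ₃)
          + g₂ * (ν₂ + n₃ / 8 * e₁ + n₄ / 16 * τ₂)
          + g₃ * (n₃ / 8 + n₄ / 16 * e₁) + g₄ * (n₄ / 16))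
        + 2 * (g₀ * (ν₂ + n₃ / 8 * e₁ + n₄ / 16 * τ₂) + g₁ * (n₃ / 8 + n₄ / 16 * e₁)
          + g₂ * (n₄ / 16))) :
    ∃ c₀ c₁ c₂ c₃, HasTaylor
      (fun ζ => ζ ^ 5 * diskForm a₁ a₂ a₃ a₄ (quartic n₀ n₁ n₂ n₃ n₄) G ζ) c₀ c₁ c₂ c₃ c := by
  have hq : HasTaylor (fun ζ : ℂ => 2 * (ζ ^ 2 - 1)) (-2) 0 2 0 0 :=
    (hasTaylor_poly (-2) 0 2 0 0).of_eq (fun z _ => by ring) rfl rfl rfl rfl rfl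
  have h := (hG.mul (hasTaylor_quartic n₀ n₁ n₂ n₃ n₄)).mul (hq.mul (ha.hasTaylor_diskInvRoot he))
  refine ⟨_, _, _, _, h.of_eq (fun ζ _ => ?_) rfl rfl rfl rfl ?_⟩
  · unfold diskForm; ring
  · rw [hc _ _ _ _ _ _ rfl rfl rfl rfl rfl rfl]
    push_cast
    ring

/-- The working form of the contour identity: `Re G` is seen by the bands, `Im G` by the gaps, with
opposite signs. It is used with `G = i`, with `G = i(ζ⁻¹ - ζ)/2`, and with the logarithmic
potential. -/
theorem Branches.band_identity {a₁ a₂ a₃ a₄ : ℝ} (ha : Branches a₁ a₂ a₃ a₄) (N : ℝ[X])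
    {G : ℂ → ℂ} {g : ℝ → ℂ} {y K k₁ k₂ r : ℝ} {c₀ c₁ c₂ c₃ : ℂ} (hK : 0 ≤ K)
    (hGd : ∀ ζ, ‖ζ‖ < 1 → ζ ≠ 0 → DifferentiableAt ℂ G ζ)
    (hGs : ∀ ζ, ‖ζ‖ < 1 → G (conj ζ) = -conj (G ζ))
    (hGc : ∀ θ ∈ Ioo 0 Real.pi, Real.cos θ ≠ y → ContinuousAt G (circleMap 0 1 θ))
    (hGb : ∀ θ ∈ Ioo 0 Real.pi, Real.cos θ ≠ y → ∀ r, 1 / 2 ≤ r → r < 1 →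
      ‖G (circleMap 0 r θ)‖ ≤ K * (1 + |Real.cos θ - y| ^ (-(1 / 4) : ℝ)))
    (hg : ∀ θ ∈ Ioo 0 Real.pi, Real.cos θ ≠ y → G (circleMap 0 1 θ) = g (Real.cos θ))
    (hT : HasTaylor (fun ζ => ζ ^ 5 * diskForm a₁ a₂ a₃ a₄ N G ζ) c₀ c₁ c₂ c₃ (Complex.I * r))
    (hgm : Measurable g)
    (hgb : ∀ x ∈ Icc (-1 : ℝ) 1, ‖g x‖ ≤ K * (1 + |x - y| ^ (-(1 / 4) : ℝ)))
    (hk₁ : ∀ x ∈ Ioo a₁ a₂, (g x).im = k₁) (hk₂ : ∀ x ∈ Ioo a₃ a₄, (g x).im = k₂) :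
    (∫ x in genusOneSupport a₁ a₂ a₃ a₄, (g x).re * (N.eval x * (cutInvRoot a₁ a₂ a₃ a₄ x).re))
      + (k₁ * gapIntegral a₁ a₂ a₃ a₄ N a₁ a₂ - k₂ * gapIntegral a₁ a₂ a₃ a₄ N a₃ a₄) =
      Real.pi * r := by
  rw [← ha.integral_split N hK hgm hgb hk₁ hk₂,
    ha.contour_identity N hK hGd hGs hGc hGb hg hT]
  have : (Real.pi : ℂ) * Complex.I * (Complex.I * r) = ((-(Real.pi * r) : ℝ) : ℂ) := by
    push_cast
    linear_combination (Real.pi * r : ℂ) * Complex.I_sq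
  rw [this, Complex.ofReal_re, neg_neg]

/-- The gap integrals of a differential without residue at infinity agree. -/
theorem Branches.gapIntegral_eq {a₁ a₂ a₃ a₄ e₁ e₂ e₃ e₄ : ℝ} (ha : Branches a₁ a₂ a₃ a₄)
    (he : IsEsymm a₁ a₂ a₃ a₄ e₁ e₂ e₃ e₄) (c : ℝ) :
    gapIntegral a₁ a₂ a₃ a₄ (quartic c (-e₁ / 2) 1 0 0) a₁ a₂ =
      gapIntegral a₁ a₂ a₃ a₄ (quartic c (-e₁ / 2) 1 0 0) a₃ a₄ := by
  -- For `G = i` the bands contribute nothing and both gaps carry weight one. The coefficient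
  -- `-e₁/2` makes the residue vanish.
  have hG : HasTaylor (fun ζ => ζ * (fun _ : ℂ => Complex.I) ζ) 0 Complex.I 0 0 0 :=
    (hasTaylor_poly 0 Complex.I 0 0 0).of_eq (fun z _ => by ring) rfl rfl rfl rfl rfl
  obtain ⟨c₀, c₁, c₂, c₃, hT⟩ := ha.hasTaylor_diskForm he c (-e₁ / 2) 1 0 0 hG
    (c := Complex.I * (0 : ℝ)) (by
      rintro _ _ _ _ _ _ rfl rfl rfl rfl rfl rfl
      push_cast
      ring)
  have q0 := fun x y : ℝ => abs_sub_rpow_nonneg x y (-(1 / 4))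
  have := ha.band_identity (quartic c (-e₁ / 2) 1 0 0) (G := fun _ => Complex.I)
    (g := fun _ => Complex.I) (y := 0) (K := 1) (k₁ := 1) (k₂ := 1) zero_le_one
    (fun _ _ _ => differentiableAt_const _) (fun _ _ => by simp) (fun _ _ _ => continuousAt_const)
    (fun θ _ _ _ _ _ => by rw [Complex.norm_I]; linarith [q0 (Real.cos θ) 0]) (fun _ _ _ => rfl)
    hT measurable_const (fun x _ => by rw [Complex.norm_I]; linarith [q0 x 0])
    (fun _ _ => Complex.I_im) (fun _ _ => Complex.I_im)
  simp only [Complex.I_re, zero_mul, integral_zero, zero_add, one_mul, mul_zero] at this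
  linarith

theorem absR₀_nonneg (x : ℝ) : 0 ≤ absR₀ x := Real.sqrt_nonneg _

theorem absR₀_cos {θ : ℝ} (hθ : θ ∈ Ioo 0 Real.pi) : absR₀ (Real.cos θ) = Real.sin θ := by
  rw [absR₀, ← Real.sin_sq, Real.sqrt_sq (Real.sin_pos_of_mem_Ioo hθ).le]

/-- Moments against `√(1 - x²)`. -/
theorem Branches.integral_absR₀_mul {a₁ a₂ a₃ a₄ e₁ e₂ e₃ e₄ : ℝ} (ha : Branches a₁ a₂ a₃ a₄)
    (he : IsEsymm a₁ a₂ a₃ a₄ e₁ e₂ e₃ e₄) (n₀ n₁ n₂ n₃ n₄ r : ℝ)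
    (hr : ∀ τ₂ τ₃ τ₄ ν₂ ν₃ ν₄ : ℝ, τ₂ = -2 - 2 * e₂ + 3 / 2 * e₁ ^ 2 →
      τ₃ = -3 * e₁ + 4 * e₃ - 6 * e₁ * e₂ + 5 / 2 * e₁ ^ 3 →
      τ₄ = -3 - 4 * e₂ - 8 * e₄ + 6 * (1 + e₂) ^ 2 + 9 * e₁ ^ 2 + 12 * e₁ * e₃
        - 15 * e₁ ^ 2 * (1 + e₂) + 35 / 8 * e₁ ^ 4 →
      ν₂ = n₄ / 4 + n₂ / 4 → ν₃ = 3 * n₃ / 8 + n₁ / 2 → ν₄ = 3 * n₄ / 8 + n₂ / 2 + n₀ →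
      r = -(ν₄ + ν₃ * e₁ + ν₂ * τ₂ + n₃ / 8 * τ₃ + n₄ / 16 * τ₄)
        + 2 * (ν₂ + n₃ / 8 * e₁ + n₄ / 16 * τ₂) - n₄ / 16) :
    ∫ x in genusOneSupport a₁ a₂ a₃ a₄,
      absR₀ x * ((quartic n₀ n₁ n₂ n₃ n₄).eval x * (cutInvRoot a₁ a₂ a₃ a₄ x).re) =
      Real.pi * r := by
  -- On the upper semicircle this is `sin θ = |R₀(cos θ)|`. It is real there, so the gaps drop out
  -- for every numerator.
  set G : ℂ → ℂ := fun ζ => Complex.I * ((ζ⁻¹ - ζ) / 2) with hGdef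
  have hG : HasTaylor (fun ζ => ζ * G ζ) (Complex.I / 2) 0 (-Complex.I / 2) 0 0 :=
    (hasTaylor_poly (Complex.I / 2) 0 (-Complex.I / 2) 0 0).of_eq
      (fun z hz => by simp only [hGdef]; field_simp; ring) rfl rfl rfl rfl rfl
  obtain ⟨c₀, c₁, c₂, c₃, hT⟩ := ha.hasTaylor_diskForm he n₀ n₁ n₂ n₃ n₄ hG
    (c := Complex.I * (r : ℝ)) (by
      intro τ₂ τ₃ τ₄ ν₂ ν₃ ν₄ h1 h2 h3 h4 h5 h6
      rw [hr _ _ _ _ _ _ h1 h2 h3 h4 h5 h6]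
      push_cast
      ring)
  have q0 := fun x y : ℝ => abs_sub_rpow_nonneg x y (-(1 / 4))
  have := ha.band_identity (quartic n₀ n₁ n₂ n₃ n₄) (G := G)
    (g := fun x => (absR₀ x : ℂ)) (y := 0) (K := 2) (k₁ := 0) (k₂ := 0) zero_le_two
    ?_ ?_ ?_ ?_ ?_ hT ?_ ?_ (fun _ _ => Complex.ofReal_im _) (fun _ _ => Complex.ofReal_im _)
  · simpa using this
  · intro ζ _ h0
    exact (((differentiableAt_inv h0).sub differentiableAt_id).div_const 2).const_mul _
  · intro ζ _
    simp only [hGdef, map_mul, map_div₀, map_sub, map_inv₀, Complex.conj_I, map_ofNat]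
    ring
  · intro θ _ _
    have h0 : circleMap 0 1 θ ≠ 0 := circleMap_ne_center one_ne_zero
    exact continuousAt_const.mul (((continuousAt_inv₀ h0).sub continuousAt_id).div_const 2)
  · intro θ _ _ r h1 h2
    have h3 := norm_sub_le (circleMap 0 r θ)⁻¹ (circleMap 0 r θ)
    rw [norm_inv, norm_circleMap_zero, abs_of_nonneg (by linarith)] at h3
    have h4 : r⁻¹ ≤ 2 := by
      rw [inv_le_comm₀ (by linarith) (by norm_num)]; linarith
    simp only [hGdef, norm_mul, Complex.norm_I, norm_div, Complex.norm_ofNat]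
    linarith [q0 (Real.cos θ) 0]
  · intro θ hθ _
    have h0 : circleMap 0 1 θ ≠ 0 := circleMap_ne_center one_ne_zero
    have h1 := circle_sq_sub_one θ
    simp only [absR₀_cos hθ, hGdef]
    field_simp
    linear_combination (-Complex.I) * h1 - (2 * Real.sin θ * circleMap 0 1 θ) * Complex.I_sq
  · unfold absR₀
    fun_prop
  · intro x hx
    have : absR₀ x ≤ 1 := Real.sqrt_le_one.mpr (by nlinarith)
    rw [Complex.norm_real, Real.norm_eq_abs, abs_of_nonneg (absR₀_nonneg x)]
    linarith [q0 x 0]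

end DefNLS

/-! ### The kernel as the real part of an analytic potential. -/

namespace DefNLS

open Filter Topology Asymptotics ComplexConjugate Polynomial

/-- The complex potential `log (1 - ζ η) - log (1 - ζ η̄)` of the kernel. -/
noncomputable def logPotential (η ζ : ℂ) : ℂ :=
  Complex.log (1 - ζ * η) - Complex.log (1 - ζ * conj η)

/-- `1 - exp(iφ) = 2 sin(φ/2) exp(i(φ - π)/2)`, where the modulus is positive and the angle lies in
`(-π/2, π/2)`. -/
theorem log_one_sub_exp {φ : ℝ} (h0 : 0 < φ) (h1 : φ < 2 * Real.pi) :
    Complex.log (1 - Complex.exp (φ * Complex.I)) =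
      Real.log (2 * Real.sin (φ / 2)) + ((φ - Real.pi) / 2 : ℝ) * Complex.I := by
  have hs : 0 < Real.sin (φ / 2) := Real.sin_pos_of_mem_Ioo ⟨by linarith, by linarith⟩
  have e : 1 - Complex.exp (φ * Complex.I) = ((2 * Real.sin (φ / 2) : ℝ) : ℂ) *
      Complex.exp (((φ - Real.pi) / 2 : ℝ) * Complex.I) := by
    have c2 : Real.cos φ = 1 - 2 * Real.sin (φ / 2) ^ 2 := by
      have := Real.cos_two_mul (φ / 2)
      rw [mul_div_cancel₀ _ (two_ne_zero' ℝ)] at this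
      nlinarith [Real.sin_sq_add_cos_sq (φ / 2)]
    have s2 : Real.sin φ = 2 * Real.sin (φ / 2) * Real.cos (φ / 2) := by
      have := Real.sin_two_mul (φ / 2)
      rwa [mul_div_cancel₀ _ (two_ne_zero' ℝ)] at this
    have hh : (φ - Real.pi) / 2 = φ / 2 - Real.pi / 2 := by ring
    apply Complex.ext
    · rw [Complex.re_ofReal_mul, Complex.exp_ofReal_mul_I_re, Complex.sub_re,
        Complex.exp_ofReal_mul_I_re, hh, Real.cos_sub_pi_div_two, c2, Complex.one_re]
      ring
    · rw [Complex.im_ofReal_mul, Complex.exp_ofReal_mul_I_im, Complex.sub_im,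
        Complex.exp_ofReal_mul_I_im, hh, Real.sin_sub_pi_div_two, s2, Complex.one_im]
      ring
  rw [e, Complex.log_ofReal_mul (by positivity) (Complex.exp_ne_zero _), Complex.log_exp]
  · rw [Complex.im_ofReal_mul, Complex.I_im]
    linarith [Real.pi_pos]
  · rw [Complex.im_ofReal_mul, Complex.I_im]
    linarith [Real.pi_pos]

theorem log_one_sub_exp_of_neg {φ : ℝ} (h0 : -(2 * Real.pi) < φ) (h1 : φ < 0) :
    Complex.log (1 - Complex.exp (φ * Complex.I)) =
      Real.log (2 * Real.sin (-φ / 2)) + ((φ + Real.pi) / 2 : ℝ) * Complex.I := by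
  have := log_one_sub_exp (φ := φ + 2 * Real.pi) (by linarith) (by linarith)
  have e : Complex.exp (((φ + 2 * Real.pi : ℝ) : ℂ) * Complex.I)
      = Complex.exp (φ * Complex.I) := by
    push_cast
    rw [add_mul]
    exact Complex.exp_periodic _
  rw [e] at this
  rw [this, show (φ + 2 * Real.pi) / 2 = Real.pi - (-φ / 2) by ring, Real.sin_pi_sub]
  congr 3
  ring

theorem circleMap_mul_circleMap (θ α : ℝ) :
    circleMap 0 1 θ * circleMap 0 1 α = Complex.exp ((θ + α : ℝ) * Complex.I) := by
  simp only [circleMap, zero_add, Complex.ofReal_one, one_mul]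
  rw [← Complex.exp_add]
  congr 1; push_cast; ring

theorem conj_circleMap (α : ℝ) : conj (circleMap 0 1 α) = circleMap 0 1 (-α) := by
  apply Complex.ext
  · rw [Complex.conj_re, circleMap_zero_re, circleMap_zero_re, Real.cos_neg]
  · rw [Complex.conj_im, circleMap_zero_im, circleMap_zero_im, Real.sin_neg]; ring

/-- Boundary values of the complex potential. -/
noncomputable def cutPotential (α X : ℝ) : ℂ :=
  (kernel (Real.cos α) X : ℂ) + Complex.I * ((if X < Real.cos α then α else α - Real.pi : ℝ) : ℂ)

theorem kernel_cos {α θ : ℝ} (hα : α ∈ Ioo 0 Real.pi) (hθ : θ ∈ Ioo 0 Real.pi) (h : θ ≠ α) :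
    kernel (Real.cos α) (Real.cos θ) =
      Real.log (2 * Real.sin ((θ + α) / 2)) - Real.log (2 * |Real.sin ((θ - α) / 2)|) := by
  obtain ⟨a1, a2⟩ := hα
  obtain ⟨t1, t2⟩ := hθ
  have hs : 0 < Real.sin ((θ + α) / 2) := Real.sin_pos_of_mem_Ioo ⟨by linarith, by linarith⟩
  have hd : Real.sin ((θ - α) / 2) ≠ 0 := by
    rcases lt_or_gt_of_ne h with h | h
    · exact (Real.sin_neg_of_neg_of_neg_pi_lt (by linarith) (by linarith)).ne
    · exact (Real.sin_pos_of_mem_Ioo ⟨by linarith, by linarith⟩).ne'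
  rw [kernel, absR₀_cos ⟨a1, a2⟩, absR₀_cos ⟨t1, t2⟩,
    ← Real.log_div (by positivity) (by positivity)]
  congr 1
  have e1 : -(Real.sin α * Real.sin θ) + Real.cos θ * Real.cos α - 1
      = -2 * Real.sin ((θ + α) / 2) ^ 2 := by
    have h1 : Real.cos (θ + α) = 1 - 2 * Real.sin ((θ + α) / 2) ^ 2 := by
      have := Real.cos_two_mul ((θ + α) / 2)
      rw [mul_div_cancel₀ _ (two_ne_zero' ℝ)] at this
      nlinarith [Real.sin_sq_add_cos_sq ((θ + α) / 2)]
    have h2 := Real.cos_add θ α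
    linarith
  have e2 : Real.cos α - Real.cos θ = 2 * Real.sin ((θ + α) / 2) * Real.sin ((θ - α) / 2) := by
    rw [Real.cos_sub_cos, show (α - θ) / 2 = -((θ - α) / 2) by ring, Real.sin_neg, add_comm α θ]
    ring
  rw [e1, e2, abs_div, abs_mul, abs_mul, abs_mul, abs_of_pos hs, abs_neg, abs_two, abs_pow,
    abs_of_pos hs]
  field_simp

/-- The arguments of the two logarithms are both affine in `θ` with slope `1/2`, so their difference
is constant on each side of `θ = α`. Half-angle formulas (`kernel_cos`) identify the real part. -/
theorem logPotential_circle {α θ : ℝ} (hα : α ∈ Ioo 0 Real.pi) (hθ : θ ∈ Ioo 0 Real.pi)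
    (h : Real.cos θ ≠ Real.cos α) :
    logPotential (circleMap 0 1 α) (circleMap 0 1 θ) = cutPotential α (Real.cos θ) := by
  have hne : θ ≠ α := fun h' => h (by rw [h'])
  rw [logPotential, cutPotential, kernel_cos hα hθ hne, conj_circleMap, circleMap_mul_circleMap,
    circleMap_mul_circleMap, ← sub_eq_add_neg]
  obtain ⟨a1, a2⟩ := hα
  obtain ⟨t1, t2⟩ := hθ
  rw [log_one_sub_exp (φ := θ + α) (by linarith) (by linarith)]
  rcases lt_or_gt_of_ne hne with h' | h'
  · have hc : ¬ Real.cos θ < Real.cos α :=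
      not_lt.mpr (Real.cos_le_cos_of_nonneg_of_le_pi t1.le a2.le h'.le)
    have hsn := Real.sin_neg_of_neg_of_neg_pi_lt (x := (θ - α) / 2) (by linarith) (by linarith)
    rw [log_one_sub_exp_of_neg (φ := θ - α) (by linarith) (by linarith), if_neg hc,
      abs_of_neg hsn, ← Real.sin_neg, neg_div]
    push_cast
    ring
  · have hc : Real.cos θ < Real.cos α := Real.cos_lt_cos_of_nonneg_of_le_pi a1.le t2.le h'
    have hsn := Real.sin_pos_of_mem_Ioo (x := (θ - α) / 2) ⟨by linarith, by linarith⟩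
    rw [log_one_sub_exp (φ := θ - α) (by linarith) (by linarith), if_pos hc, abs_of_pos hsn]
    push_cast
    ring

theorem one_sub_mem_slitPlane {w : ℂ} (hw : ‖w‖ ≤ 1) (h1 : w ≠ 1) :
    1 - w ∈ Complex.slitPlane := by
  rw [Complex.mem_slitPlane_iff]
  by_contra! h
  simp only [Complex.sub_re, Complex.one_re, Complex.sub_im, Complex.one_im, zero_sub,
    neg_eq_zero] at h
  apply h1
  have := Complex.re_le_norm w
  exact Complex.ext (by rw [Complex.one_re]; linarith [h.1]) (by rw [h.2, Complex.one_im])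

theorem norm_log_le {w : ℂ} {d : ℝ} (hd : 0 < d) (h1 : d / 2 ≤ ‖w‖) (h2 : ‖w‖ ≤ 2) :
    ‖Complex.log w‖ ≤ 8 * (1 + d ^ (-(1 / 4) : ℝ)) := by
  have hw : 0 < ‖w‖ := by linarith
  have q := Complex.norm_le_abs_re_add_abs_im (Complex.log w)
  rw [Complex.log_re, Complex.log_im] at q
  have harg := Complex.abs_arg_le_pi w
  have hpi := Real.pi_le_four
  have hd0 := Real.rpow_nonneg hd.le (-(1 / 4))
  have hlog : |Real.log ‖w‖| ≤ 4 + 8 * d ^ (-(1 / 4) : ℝ) := by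
    rw [abs_le]
    constructor
    · have e1 : -Real.log ‖w‖ ≤ Real.log (2 * d⁻¹) := by
        rw [← Real.log_inv]
        apply Real.log_le_log (by positivity)
        rw [inv_le_comm₀ hw (by positivity), mul_inv, inv_inv]
        linarith
      have e2 := Real.log_le_rpow_div (x := 2 * d⁻¹) (by positivity) (ε := 1 / 4) (by norm_num)
      rw [Real.mul_rpow (by norm_num) (by positivity), Real.inv_rpow hd.le,
        ← Real.rpow_neg hd.le] at e2
      have e3 : (2 : ℝ) ^ (1 / 4 : ℝ) ≤ 2 := by
        calc (2 : ℝ) ^ (1 / 4 : ℝ) ≤ 2 ^ (1 : ℝ) :=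
              Real.rpow_le_rpow_of_exponent_le (by norm_num) (by norm_num)
          _ = 2 := by simp
      have e4 := mul_le_mul_of_nonneg_right e3 hd0
      linarith
    · have := Real.log_le_sub_one_of_pos hw
      linarith
  linarith

section Potential

variable {α : ℝ}

theorem norm_circleMap_one (α : ℝ) : ‖circleMap 0 1 α‖ = 1 := by
  rw [norm_circleMap_zero, abs_one]

theorem one_sub_mul_one_sub (α : ℝ) (ζ : ℂ) :
    (1 - ζ * circleMap 0 1 α) * (1 - ζ * conj (circleMap 0 1 α)) =
      1 - 2 * (Real.cos α : ℝ) * ζ + ζ ^ 2 := by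
  have h1 : circleMap 0 1 α * conj (circleMap 0 1 α) = 1 := by
    rw [Complex.mul_conj, Complex.normSq_eq_norm_sq, norm_circleMap_one]; simp
  have h2 : circleMap 0 1 α + conj (circleMap 0 1 α) = 2 * (Real.cos α : ℝ) := by
    rw [Complex.add_conj, circleMap_zero_re]; push_cast; ring
  linear_combination (-ζ) * h2 + ζ ^ 2 * h1

/-- The product of the two factors is `1 - 2ζ cos α + ζ²`, of modulus at least `|cos θ - cos α|`
when `r ≥ 1/2`. Each factor is at most `2`, so the other is at least half of this. -/
theorem norm_one_sub_mul_bounds {α θ r : ℝ} (hr : 1 / 2 ≤ r) (hr1 : r ≤ 1) :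
    (|Real.cos θ - Real.cos α| / 2 ≤ ‖1 - circleMap 0 r θ * circleMap 0 1 α‖ ∧
      ‖1 - circleMap 0 r θ * circleMap 0 1 α‖ ≤ 2) ∧
    (|Real.cos θ - Real.cos α| / 2 ≤ ‖1 - circleMap 0 r θ * conj (circleMap 0 1 α)‖ ∧
      ‖1 - circleMap 0 r θ * conj (circleMap 0 1 α)‖ ≤ 2) := by
  have h := two_mul_abs_cos_sub_le_norm (a := Real.cos α) (r := r) (θ := θ)
    ⟨Real.neg_one_le_cos α, Real.cos_le_one α⟩ (by linarith)
  rw [← one_sub_mul_one_sub, norm_mul] at h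
  have u : ∀ w : ℂ, ‖w‖ = 1 → ‖1 - circleMap 0 r θ * w‖ ≤ 2 := by
    intro w hw
    refine (norm_sub_le _ _).trans ?_
    rw [norm_mul, norm_circleMap_zero, hw, abs_of_nonneg (by linarith), norm_one]
    linarith
  have u1 := u _ (norm_circleMap_one α)
  have u2 := u (conj (circleMap 0 1 α)) (by rw [Complex.norm_conj, norm_circleMap_one])
  have n1 := norm_nonneg (1 - circleMap 0 r θ * circleMap 0 1 α)
  have n2 := norm_nonneg (1 - circleMap 0 r θ * conj (circleMap 0 1 α))
  have h0 := abs_nonneg (Real.cos θ - Real.cos α)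
  refine ⟨⟨?_, u1⟩, ⟨?_, u2⟩⟩ <;> nlinarith

theorem norm_mul_lt_one {ζ η : ℂ} (hζ : ‖ζ‖ < 1) (hη : ‖η‖ = 1) : ‖ζ * η‖ < 1 := by
  rw [norm_mul, hη, mul_one]; exact hζ

theorem one_sub_mul_mem_slitPlane {ζ η : ℂ} (hζ : ‖ζ‖ < 1) (hη : ‖η‖ = 1) :
    1 - ζ * η ∈ Complex.slitPlane := by
  have := norm_mul_lt_one hζ hη
  exact one_sub_mem_slitPlane this.le fun h => by simp [h] at this

theorem differentiableAt_logPotential (α : ℝ) {ζ : ℂ} (hζ : ‖ζ‖ < 1) :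
    DifferentiableAt ℂ (logPotential (circleMap 0 1 α)) ζ := by
  have h1 := one_sub_mul_mem_slitPlane hζ (norm_circleMap_one α)
  have h2 := one_sub_mul_mem_slitPlane hζ
    (η := conj (circleMap 0 1 α)) (by rw [Complex.norm_conj, norm_circleMap_one])
  have d : ∀ w : ℂ, DifferentiableAt ℂ (fun ζ => 1 - ζ * w) ζ := fun w => by fun_prop
  exact ((d _).clog h1).sub ((d _).clog h2)

theorem logPotential_conj (α : ℝ) {ζ : ℂ} (hζ : ‖ζ‖ < 1) :
    logPotential (circleMap 0 1 α) (conj ζ) = -conj (logPotential (circleMap 0 1 α) ζ) := by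
  have h1 := one_sub_mul_mem_slitPlane hζ (norm_circleMap_one α)
  have h2 := one_sub_mul_mem_slitPlane hζ
    (η := conj (circleMap 0 1 α)) (by rw [Complex.norm_conj, norm_circleMap_one])
  unfold logPotential
  rw [map_sub, ← Complex.log_conj _ (Complex.slitPlane_arg_ne_pi h1),
    ← Complex.log_conj _ (Complex.slitPlane_arg_ne_pi h2)]
  simp only [map_sub, map_one, map_mul, Complex.conj_conj]
  ring

theorem continuousAt_logPotential_circle {α θ : ℝ} (h : Real.cos θ ≠ Real.cos α) :
    ContinuousAt (logPotential (circleMap 0 1 α)) (circleMap 0 1 θ) := by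
  obtain ⟨⟨b1, _⟩, b2, _⟩ := norm_one_sub_mul_bounds (α := α) (θ := θ) (r := 1)
    (by norm_num) le_rfl
  have hpos : 0 < |Real.cos θ - Real.cos α| := abs_pos.mpr (sub_ne_zero.mpr h)
  have s : ∀ w : ℂ, ‖w‖ = 1 → 0 < ‖1 - circleMap 0 1 θ * w‖ →
      1 - circleMap 0 1 θ * w ∈ Complex.slitPlane := by
    intro w hw h0
    refine one_sub_mem_slitPlane (by rw [norm_mul, hw, norm_circleMap_one, mul_one]) fun h1 => ?_
    rw [h1, sub_self, norm_zero] at h0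
    exact lt_irrefl _ h0
  have s1 := s _ (norm_circleMap_one α) (by linarith)
  have s2 := s (conj (circleMap 0 1 α)) (by rw [Complex.norm_conj, norm_circleMap_one])
    (by linarith)
  have d : ∀ w : ℂ, ContinuousAt (fun ζ => 1 - ζ * w) (circleMap 0 1 θ) := fun w => by fun_prop
  exact ((d _).clog s1).sub ((d _).clog s2)

theorem norm_logPotential_le {α θ r : ℝ} (h : Real.cos θ ≠ Real.cos α) (hr : 1 / 2 ≤ r)
    (hr1 : r < 1) : ‖logPotential (circleMap 0 1 α) (circleMap 0 r θ)‖ ≤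
      16 * (1 + |Real.cos θ - Real.cos α| ^ (-(1 / 4) : ℝ)) := by
  obtain ⟨⟨b1, b2⟩, b3, b4⟩ := norm_one_sub_mul_bounds (α := α) (θ := θ) hr hr1.le
  have hpos : 0 < |Real.cos θ - Real.cos α| := abs_pos.mpr (sub_ne_zero.mpr h)
  have l1 := norm_log_le hpos b1 b2
  have l2 := norm_log_le hpos b3 b4
  exact (norm_sub_le _ _).trans (by linarith)

theorem norm_cutPotential_le {α X : ℝ} (hα : α ∈ Ioo 0 Real.pi) (hX : X ∈ Icc (-1 : ℝ) 1) :
    ‖cutPotential α X‖ ≤ 16 * (1 + |X - Real.cos α| ^ (-(1 / 4) : ℝ)) := by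
  have h1 := abs_kernel_le (z := Real.cos α) ⟨Real.neg_one_le_cos α, Real.cos_le_one α⟩ hX
  have h2 := abs_sub_rpow_nonneg X (Real.cos α) (-(1 / 4))
  have hpi := Real.pi_le_four
  unfold cutPotential
  refine (norm_add_le _ _).trans ?_
  rw [norm_mul, Complex.norm_I, Complex.norm_real, Complex.norm_real, Real.norm_eq_abs,
    Real.norm_eq_abs]
  have h3 : |if X < Real.cos α then α else α - Real.pi| ≤ 4 := by
    rw [abs_le]
    split_ifs <;> constructor <;> linarith [hα.1, hα.2]
  linarith

theorem measurable_kernel_left (z : ℝ) : Measurable (kernel z) := by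
  unfold kernel absR₀
  fun_prop

theorem measurable_cutPotential (α : ℝ) : Measurable (cutPotential α) := by
  unfold cutPotential
  have h1 : Measurable (kernel (Real.cos α)) := measurable_kernel_left _
  have h2 : Measurable (fun X : ℝ => if X < Real.cos α then α else α - Real.pi) :=
    Measurable.ite measurableSet_Iio measurable_const measurable_const
  exact (Complex.measurable_ofReal.comp h1).add
    (measurable_const.mul (Complex.measurable_ofReal.comp h2))

/-- The coefficient of `ζᵏ` in the potential is `-2i sin(kα)/k`, that is, `sin α` times a polynomial
in `cos α`. This is why the resulting potentials are polynomials in `z` times `|R₀(z)|`. -/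
theorem hasTaylor_logPotential (α : ℝ) :
    HasTaylor (fun ζ => ζ * logPotential (circleMap 0 1 α) ζ) 0 0
      (Complex.I * ((-2 * Real.sin α : ℝ) : ℂ))
      (Complex.I * ((-2 * Real.sin α * Real.cos α : ℝ) : ℂ))
      (Complex.I * ((-2 * Real.sin α * (4 * Real.cos α ^ 2 - 1) / 3 : ℝ) : ℂ)) := by
  have hη : circleMap 0 1 α = (Real.cos α : ℂ) + (Real.sin α : ℂ) * Complex.I := by
    apply Complex.ext
    · rw [circleMap_zero_re, Complex.add_re, Complex.re_ofReal_mul, Complex.I_re,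
        Complex.ofReal_re]; ring
    · rw [circleMap_zero_im, Complex.add_im, Complex.im_ofReal_mul, Complex.I_im,
        Complex.ofReal_im]; ring
  have hη' : conj (circleMap 0 1 α) = (Real.cos α : ℂ) - (Real.sin α : ℂ) * Complex.I := by
    rw [hη, map_add, map_mul, Complex.conj_ofReal, Complex.conj_ofReal, Complex.conj_I]; ring
  have hz : HasTaylor (fun ζ : ℂ => ζ) 0 1 0 0 0 :=
    (hasTaylor_poly 0 1 0 0 0).of_eq (fun z _ => by ring) rfl rfl rfl rfl rfl
  have hm : HasTaylor (fun _ : ℂ => (-1 : ℂ)) (-1) 0 0 0 0 :=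
    (hasTaylor_poly (-1) 0 0 0 0).of_eq (fun z _ => by ring) rfl rfl rfl rfl rfl
  have h := hz.mul ((hasTaylor_log (circleMap 0 1 α)).add
    (hm.mul (hasTaylor_log (conj (circleMap 0 1 α)))))
  have hcs : (Real.sin α : ℂ) ^ 2 = 1 - (Real.cos α : ℂ) ^ 2 := by
    rw [← Complex.ofReal_pow, Real.sin_sq]; push_cast; ring
  refine h.of_eq (fun ζ _ => by simp only [logPotential]; ring) (by ring) (by ring) ?_ ?_ ?_
  · rw [hη', hη]; push_cast; ring
  · rw [hη', hη]; push_cast; ring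
  · rw [hη', hη, Complex.ofReal_div, Complex.ofReal_mul, Complex.ofReal_mul, Complex.ofReal_sub,
      Complex.ofReal_mul, Complex.ofReal_pow]
    simp only [Complex.ofReal_neg, Complex.ofReal_ofNat, Complex.ofReal_one]
    linear_combination (-2 / 3 : ℂ) * Complex.I * (Real.sin α : ℂ) * hcs
      + (2 / 3 : ℂ) * Complex.I * (Real.sin α : ℂ) ^ 3 * Complex.I_sq

end Potential

/-- The potential of a density on the bands whose numerator has vanishing gap integrals. -/
theorem Branches.integral_kernel_mul {a₁ a₂ a₃ a₄ e₁ e₂ e₃ e₄ : ℝ} (ha : Branches a₁ a₂ a₃ a₄)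
    (he : IsEsymm a₁ a₂ a₃ a₄ e₁ e₂ e₃ e₄) (n₀ n₁ n₂ n₃ n₄ : ℝ)
    (g₁ : gapIntegral a₁ a₂ a₃ a₄ (quartic n₀ n₁ n₂ n₃ n₄) a₁ a₂ = 0)
    (g₂ : gapIntegral a₁ a₂ a₃ a₄ (quartic n₀ n₁ n₂ n₃ n₄) a₃ a₄ = 0)
    {z : ℝ} (hz : z ∈ genusOneSupport a₁ a₂ a₃ a₄) :
    ∫ x in genusOneSupport a₁ a₂ a₃ a₄,
      kernel z x * ((quartic n₀ n₁ n₂ n₃ n₄).eval x * (cutInvRoot a₁ a₂ a₃ a₄ x).re) =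
      Real.pi * (absR₀ z * (n₂ + 3 / 4 * n₄ + n₃ / 2 * e₁ + n₄ / 4 * (-2 - 2 * e₂ + 3 / 2 * e₁ ^ 2)
        + 4 * (z * (n₃ / 8 + n₄ / 16 * e₁) + (4 * z ^ 2 - 1) / 3 * (n₄ / 16)))) := by
  have hz1 := ha.support_subset hz
  -- At `z = ±1`, where no `α` in the open interval exists, both sides vanish.
  rcases eq_or_ne (z ^ 2) 1 with hz2 | hz2
  · have : absR₀ z = 0 := by simp [absR₀, hz2]
    simp only [kernel_eq_zero_of_sq_eq_one hz2, zero_mul, integral_zero, this, mul_zero]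
  have hz3 : -1 < z := lt_of_le_of_ne hz1.1 fun h => hz2 (by rw [← h]; norm_num)
  have hz4 : z < 1 := lt_of_le_of_ne hz1.2 fun h => hz2 (by rw [h]; norm_num)
  obtain ⟨α, hα, rfl⟩ : ∃ α ∈ Ioo 0 Real.pi, Real.cos α = z := by
    have : z ∈ Real.cos '' Ioo 0 Real.pi := by rw [image_cos_Ioo]; exact ⟨hz3, hz4⟩
    exact this
  have hgap : ∀ x ∈ Ioo a₁ a₂ ∪ Ioo a₃ a₄, x ∉ genusOneSupport a₁ a₂ a₃ a₄ :=
    fun x hx hx' => Set.disjoint_left.mp ha.disjoint_support hx' hx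
  -- The imaginary part jumps only at `cos α`, which lies in a band, so it is constant on each gap.
  have im : ∀ b c : ℝ, Ioo b c ⊆ (genusOneSupport a₁ a₂ a₃ a₄)ᶜ →
      ∃ k, ∀ x ∈ Ioo b c, (cutPotential α x).im = k := by
    intro b c hbc
    by_cases hb : Real.cos α ≤ b
    · refine ⟨α - Real.pi, fun x hx => ?_⟩
      simp [cutPotential, not_lt.mpr (hb.trans hx.1.le)]
    · by_cases hc : c ≤ Real.cos α
      · refine ⟨α, fun x hx => ?_⟩
        simp [cutPotential, hx.2.trans_le hc]
      · exact absurd hz (hbc ⟨not_le.mp hb, not_le.mp hc⟩)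
  obtain ⟨k₁, hk₁⟩ := im a₁ a₂ fun x hx => hgap x (Or.inl hx)
  obtain ⟨k₂, hk₂⟩ := im a₃ a₄ fun x hx => hgap x (Or.inr hx)
  obtain ⟨c₀, c₁, c₂, c₃, hT⟩ := ha.hasTaylor_diskForm he n₀ n₁ n₂ n₃ n₄ (hasTaylor_logPotential α)
    (c := Complex.I * ((Real.sin α *
      (n₂ + 3 / 4 * n₄ + n₃ / 2 * e₁ + n₄ / 4 * (-2 - 2 * e₂ + 3 / 2 * e₁ ^ 2)
        + 4 * (Real.cos α * (n₃ / 8 + n₄ / 16 * e₁)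
          + (4 * Real.cos α ^ 2 - 1) / 3 * (n₄ / 16))) : ℝ) : ℂ)) (by
      rintro _ _ _ _ _ _ rfl rfl rfl rfl rfl rfl
      push_cast
      ring)
  have := ha.band_identity (quartic n₀ n₁ n₂ n₃ n₄) (g := cutPotential α) (y := Real.cos α)
    (K := 16) (by norm_num) (fun ζ hζ _ => differentiableAt_logPotential α hζ)
    (fun ζ hζ => logPotential_conj α hζ) (fun θ _ h => continuousAt_logPotential_circle h)
    (fun θ _ h r hr hr1 => norm_logPotential_le h hr hr1)
    (fun θ hθ h => logPotential_circle hα hθ h) hT (measurable_cutPotential α)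
    (fun x hx => norm_cutPotential_le hα hx) hk₁ hk₂
  rw [g₁, g₂, mul_zero, mul_zero, sub_zero, add_zero] at this
  rw [absR₀_cos hα, ← this]
  refine setIntegral_congr_fun (measurableSet_support _ _ _ _) fun x _ => ?_
  simp [cutPotential]

end DefNLS

/-! ### Gap integrals: exact differentials and complete elliptic integrals. -/

namespace DefNLS

open Filter Topology Asymptotics ComplexConjugate Polynomial

theorem absInvRoot_eq (a₁ a₂ a₃ a₄ x : ℝ) :
    absInvRoot a₁ a₂ a₃ a₄ x = (√|(x - a₁) * (x - a₂) * (x - a₃) * (x - a₄)|)⁻¹ := by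
  rw [absInvRoot, abs_mul, abs_mul, abs_mul, Real.sqrt_mul (by positivity),
    Real.sqrt_mul (by positivity), Real.sqrt_mul (by positivity)]

theorem absInvRoot_nonneg (a₁ a₂ a₃ a₄ x : ℝ) : 0 ≤ absInvRoot a₁ a₂ a₃ a₄ x := by
  unfold absInvRoot; positivity

theorem measurable_absInvRoot (a₁ a₂ a₃ a₄ : ℝ) : Measurable (absInvRoot a₁ a₂ a₃ a₄) := by
  unfold absInvRoot; fun_prop

theorem Branches.integrableOn_mul_absInvRoot {a₁ a₂ a₃ a₄ : ℝ} (ha : Branches a₁ a₂ a₃ a₄)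
    (N : ℝ[X]) : IntegrableOn (fun x => N.eval x * absInvRoot a₁ a₂ a₃ a₄ x) (Icc (-1) 1) := by
  have h := ha.integrableOn_mul_cutInvRoot N (g := fun _ => 1) (y := 0) (K := 1) zero_le_one
    measurable_const (fun x _ => by
      rw [norm_one]; linarith [abs_sub_rpow_nonneg x 0 (-(1 / 4))])
  refine Integrable.mono h ?_ (Eventually.of_forall fun x => ?_)
  · exact (N.continuous.measurable.mul (measurable_absInvRoot _ _ _ _)).aestronglyMeasurable
  · rw [norm_mul, norm_mul, norm_mul, norm_one, one_mul, norm_cutInvRoot, Complex.norm_real,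
      Real.norm_of_nonneg (absInvRoot_nonneg _ _ _ _ _)]

theorem Branches.gapIntegral_linear {a₁ a₂ a₃ a₄ : ℝ} (ha : Branches a₁ a₂ a₃ a₄)
    {N M L : ℝ[X]} {s t b c : ℝ} (hb : -1 ≤ b) (hc : c ≤ 1)
    (h : ∀ x, N.eval x = s * M.eval x + t * L.eval x) :
    gapIntegral a₁ a₂ a₃ a₄ N b c =
      s * gapIntegral a₁ a₂ a₃ a₄ M b c + t * gapIntegral a₁ a₂ a₃ a₄ L b c := by
  have hsub : Ioo b c ⊆ Icc (-1) 1 := fun x hx => ⟨hb.trans hx.1.le, hx.2.le.trans hc⟩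
  unfold gapIntegral
  rw [← integral_const_mul, ← integral_const_mul, ← integral_add
    (((ha.integrableOn_mul_absInvRoot M).mono_set hsub).const_mul s)
    (((ha.integrableOn_mul_absInvRoot L).mono_set hsub).const_mul t)]
  congr 1
  ext x
  rw [h]; ring

/-- The gap integral of the exact differential `d(p(x) √(-∏ (x - aⱼ)))` vanishes. -/
theorem Branches.gapIntegral_exact {a₁ a₂ a₃ a₄ : ℝ} (ha : Branches a₁ a₂ a₃ a₄)
    {N p P : ℝ[X]} {b c : ℝ} (hbc : b ≤ c) (hb : -1 ≤ b) (hc : c ≤ 1)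
    (hP : ∀ x, P.eval x = (x - a₁) * (x - a₂) * (x - a₃) * (x - a₄))
    (hneg : ∀ x ∈ Ioo b c, P.eval x < 0) (hPb : P.eval b = 0) (hPc : P.eval c = 0)
    (hN : ∀ x, N.eval x =
      (derivative p).eval x * P.eval x + p.eval x * (derivative P).eval x / 2) :
    gapIntegral a₁ a₂ a₃ a₄ N b c = 0 := by
  have hsub : Ioc b c ⊆ Icc (-1) 1 := fun x hx => ⟨hb.trans hx.1.le, hx.2.trans hc⟩
  have hi : IntervalIntegrable (fun x => N.eval x * absInvRoot a₁ a₂ a₃ a₄ x) volume b c := by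
    rw [intervalIntegrable_iff_integrableOn_Ioc_of_le hbc]
    exact (ha.integrableOn_mul_absInvRoot N).mono_set hsub
  -- The minus sign appears because `P < 0` on the gap: the derivative of `p √(-P)` is `-(p'P +
  -- pP'/2)/√(-P)`.
  have h := intervalIntegral.integral_eq_sub_of_hasDerivAt_of_le hbc
    (f := fun x => -(p.eval x * √(-P.eval x)))
    (f' := fun x => N.eval x * absInvRoot a₁ a₂ a₃ a₄ x) ?_ ?_ hi
  · rw [gapIntegral, ← integral_Ioc_eq_integral_Ioo, ← intervalIntegral.integral_of_le hbc, h,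
      hPb, hPc]
    simp
  · exact ((p.continuous.mul (P.continuous.neg.sqrt)).neg).continuousOn
  · intro x hx
    have hn := hneg x hx
    have hs : 0 < √(-P.eval x) := Real.sqrt_pos.mpr (by linarith)
    have hsq : √(-P.eval x) ^ 2 = -P.eval x := Real.sq_sqrt (by linarith)
    have h1 := ((p.hasDerivAt x).mul ((P.hasDerivAt x).neg.sqrt (by simpa using hn.ne))).neg
    refine h1.congr_deriv ?_
    rw [absInvRoot_eq, ← hP, abs_of_neg hn, hN]
    simp only [Pi.neg_apply]
    field_simp
    rw [hsq]
    ring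

/-! ### Reduction to complete elliptic integrals -/

theorem one_sub_mul_sin_sq_pos {m : ℝ} (hm : m < 1) (y : ℝ) : 0 < 1 - m * Real.sin y ^ 2 := by
  have h1 := Real.sin_sq_le_one y
  rcases (sq_nonneg (Real.sin y)).eq_or_lt with h2 | h2
  · rw [← h2]; norm_num
  · nlinarith

theorem continuous_sqrt_one_sub (m : ℝ) : Continuous fun y => √(1 - m * Real.sin y ^ 2) := by
  fun_prop

theorem continuous_inv_sqrt_one_sub {m : ℝ} (hm : m < 1) :
    Continuous fun y => 1 / √(1 - m * Real.sin y ^ 2) :=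
  continuous_const.div (continuous_sqrt_one_sub m)
    fun y => (Real.sqrt_pos.mpr (one_sub_mul_sin_sq_pos hm y)).ne'

theorem ellipticK_pos {m : ℝ} (hm : m < 1) : 0 < ellipticK m := by
  refine intervalIntegral.intervalIntegral_pos_of_pos_on
    ((continuous_inv_sqrt_one_sub hm).intervalIntegrable _ _) (fun y _ => ?_) Real.pi_div_two_pos
  exact one_div_pos.mpr (Real.sqrt_pos.mpr (one_sub_mul_sin_sq_pos hm y))

theorem ellipticE_lt_ellipticK {m : ℝ} (h0 : 0 < m) (hm : m < 1) : ellipticE m < ellipticK m := by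
  rw [← sub_pos, ellipticE, ellipticK, ← intervalIntegral.integral_sub
    ((continuous_inv_sqrt_one_sub hm).intervalIntegrable _ _)
    ((continuous_sqrt_one_sub m).intervalIntegrable _ _)]
  refine intervalIntegral.intervalIntegral_pos_of_pos_on
    (((continuous_inv_sqrt_one_sub hm).sub (continuous_sqrt_one_sub m)).intervalIntegrable _ _)
    (fun y hy => ?_) Real.pi_div_two_pos
  have hp := one_sub_mul_sin_sq_pos hm y
  have hs := Real.sqrt_pos.mpr hp
  have h1 : 0 < Real.sin y := Real.sin_pos_of_mem_Ioo ⟨hy.1, by linarith [hy.2, Real.pi_pos]⟩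
  have h2 : √(1 - m * Real.sin y ^ 2) ^ 2 < 1 := by
    rw [Real.sq_sqrt hp.le]
    have : 0 < m * Real.sin y ^ 2 := by positivity
    linarith
  rw [sub_pos, lt_div_iff₀ hs]
  nlinarith

/-- The Möbius substitution `sin² y = (a₄ - a₂)(x - a₁) / ((a₂ - a₁)(a₄ - x))`. -/
noncomputable def gapParam (a₁ a₂ a₄ y : ℝ) : ℝ :=
  a₄ - (a₄ - a₂) * (a₄ - a₁) / ((a₄ - a₂) + (a₂ - a₁) * Real.sin y ^ 2)

/-- The elliptic modulus. -/
noncomputable def modulus (a₁ a₂ a₃ a₄ : ℝ) : ℝ :=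
  ((a₄ - a₃) * (a₂ - a₁)) / ((a₄ - a₂) * (a₃ - a₁))

namespace Branches

variable {a₁ a₂ a₃ a₄ : ℝ}

theorem modulus_pos (ha : Branches a₁ a₂ a₃ a₄) : 0 < modulus a₁ a₂ a₃ a₄ := by
  obtain ⟨h₀₁, h₁₂, h₂₃, h₃₄, h₄₅⟩ := ha
  unfold modulus
  exact div_pos (mul_pos (by linarith) (by linarith)) (mul_pos (by linarith) (by linarith))

/-- Denominator minus numerator is `(a₄ - a₁)(a₃ - a₂)`. -/
theorem modulus_lt_one (ha : Branches a₁ a₂ a₃ a₄) : modulus a₁ a₂ a₃ a₄ < 1 := by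
  obtain ⟨h₀₁, h₁₂, h₂₃, h₃₄, h₄₅⟩ := ha
  unfold modulus
  rw [div_lt_one (mul_pos (by linarith) (by linarith))]
  have : 0 < (a₄ - a₁) * (a₃ - a₂) := mul_pos (by linarith) (by linarith)
  nlinarith

theorem den_pos (ha : Branches a₁ a₂ a₃ a₄) (y : ℝ) :
    0 < (a₄ - a₂) + (a₂ - a₁) * Real.sin y ^ 2 := by
  obtain ⟨h₀₁, h₁₂, h₂₃, h₃₄, h₄₅⟩ := ha
  have : 0 ≤ (a₂ - a₁) * Real.sin y ^ 2 := mul_nonneg (by linarith) (sq_nonneg _)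
  linarith

theorem gapParam_sub (ha : Branches a₁ a₂ a₃ a₄) (y : ℝ) :
    gapParam a₁ a₂ a₄ y - a₁ =
      (a₂ - a₁) * (a₄ - a₁) * Real.sin y ^ 2 / ((a₄ - a₂) + (a₂ - a₁) * Real.sin y ^ 2) ∧
    gapParam a₁ a₂ a₄ y - a₂ =
      -((a₄ - a₂) * (a₂ - a₁) * Real.cos y ^ 2 / ((a₄ - a₂) + (a₂ - a₁) * Real.sin y ^ 2)) ∧
    gapParam a₁ a₂ a₄ y - a₃ =
      -((a₄ - a₂) * (a₃ - a₁) * (1 - modulus a₁ a₂ a₃ a₄ * Real.sin y ^ 2) /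
        ((a₄ - a₂) + (a₂ - a₁) * Real.sin y ^ 2)) ∧
    gapParam a₁ a₂ a₄ y - a₄ =
      -((a₄ - a₂) * (a₄ - a₁) / ((a₄ - a₂) + (a₂ - a₁) * Real.sin y ^ 2)) := by
  have hd := (ha.den_pos y).ne'
  obtain ⟨h₀₁, h₁₂, h₂₃, h₃₄, h₄₅⟩ := ha
  have hp : a₄ - a₂ ≠ 0 := by linarith
  have hs : a₃ - a₁ ≠ 0 := by linarith
  unfold gapParam modulus
  refine ⟨?_, ?_, ?_, ?_⟩
  · field_simp; ring
  · rw [Real.cos_sq']; field_simp; ring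
  · field_simp; ring
  · ring

theorem hasDerivAt_gapParam (ha : Branches a₁ a₂ a₃ a₄) (y : ℝ) :
    HasDerivAt (gapParam a₁ a₂ a₄) (2 * (a₄ - a₂) * (a₄ - a₁) * (a₂ - a₁) * Real.sin y * Real.cos y /
      ((a₄ - a₂) + (a₂ - a₁) * Real.sin y ^ 2) ^ 2) y := by
  have hd := (ha.den_pos y).ne'
  have h1 := (((Real.hasDerivAt_sin y).pow 2).const_mul (a₂ - a₁)).const_add (a₄ - a₂)
  have h2 := ((hasDerivAt_const y ((a₄ - a₂) * (a₄ - a₁))).div h1 hd).const_sub a₄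
  refine h2.congr_deriv ?_
  simp only [Pi.pow_apply]
  push_cast
  ring

theorem image_gapParam (ha : Branches a₁ a₂ a₃ a₄) :
    gapParam a₁ a₂ a₄ '' Ioo 0 (Real.pi / 2) = Ioo a₁ a₂ := by
  ext x
  have hpi := Real.pi_pos
  constructor
  · rintro ⟨y, hy, rfl⟩
    obtain ⟨e1, e2, _, _⟩ := ha.gapParam_sub y
    have hd := ha.den_pos y
    obtain ⟨h₀₁, h₁₂, h₂₃, h₃₄, h₄₅⟩ := ha
    have hsn := Real.sin_pos_of_mem_Ioo (x := y) ⟨hy.1, by linarith [hy.2]⟩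
    have hcs := Real.cos_pos_of_mem_Ioo (x := y) ⟨by linarith [hy.1], hy.2⟩
    constructor
    · rw [← sub_pos, e1]
      exact div_pos (mul_pos (mul_pos (by linarith) (by linarith)) (by positivity)) hd
    · rw [← sub_neg, e2, neg_lt_zero]
      exact div_pos (mul_pos (mul_pos (by linarith) (by linarith)) (by positivity)) hd
  · rintro ⟨hx1, hx2⟩
    obtain ⟨h₀₁, h₁₂, h₂₃, h₃₄, h₄₅⟩ := ha
    have hq : 0 < a₂ - a₁ := by linarith
    have hx4 : 0 < a₄ - x := by linarith
    have hp : 0 < a₄ - a₂ := by linarith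
    set t := (a₄ - a₂) * (x - a₁) / ((a₂ - a₁) * (a₄ - x)) with ht
    have ht0 : 0 < t := div_pos (mul_pos hp (by linarith)) (mul_pos hq hx4)
    have ht1 : t < 1 := by
      rw [ht, div_lt_one (mul_pos hq hx4)]
      nlinarith [mul_pos (sub_pos.mpr hx2) (show 0 < a₄ - a₁ by linarith)]
    have hs1 : √t < 1 := by
      rw [Real.sqrt_lt' one_pos]; simpa using ht1
    refine ⟨Real.arcsin √t, ⟨Real.arcsin_pos.mpr (Real.sqrt_pos.mpr ht0),
      Real.arcsin_lt_pi_div_two.mpr hs1⟩, ?_⟩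
    rw [gapParam, Real.sin_arcsin (by linarith [Real.sqrt_nonneg t]) hs1.le, Real.sq_sqrt ht0.le]
    have hden : (a₄ - a₂) + (a₂ - a₁) * t = (a₄ - a₂) * (a₄ - a₁) / (a₄ - x) := by
      rw [ht]; field_simp; ring
    have h41 : a₄ - a₁ ≠ 0 := by linarith
    rw [hden]
    field_simp
    ring

theorem injOn_gapParam (ha : Branches a₁ a₂ a₃ a₄) :
    InjOn (gapParam a₁ a₂ a₄) (Ioo 0 (Real.pi / 2)) := by
  intro y hy z hz h
  have hpi := Real.pi_pos
  have hdy := (ha.den_pos y).ne'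
  have hdz := (ha.den_pos z).ne'
  obtain ⟨h₀₁, h₁₂, h₂₃, h₃₄, h₄₅⟩ := ha
  have hp : a₄ - a₂ ≠ 0 := by linarith
  have hq : a₂ - a₁ ≠ 0 := by linarith
  have hL : a₄ - a₁ ≠ 0 := by linarith
  unfold gapParam at h
  rw [sub_right_inj, div_eq_div_iff hdy hdz] at h
  have h2 := mul_left_cancel₀ (mul_ne_zero hp hL) h
  have h3 : Real.sin y ^ 2 = Real.sin z ^ 2 := mul_left_cancel₀ hq (by linarith)
  have sy := Real.sin_pos_of_mem_Ioo (x := y) ⟨hy.1, by linarith [hy.2]⟩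
  have sz := Real.sin_pos_of_mem_Ioo (x := z) ⟨hz.1, by linarith [hz.2]⟩
  have h4 := (pow_left_inj₀ sy.le sz.le two_ne_zero).mp h3
  exact Real.injOn_sin ⟨by linarith [hy.1], hy.2.le⟩ ⟨by linarith [hz.1], hz.2.le⟩ h4

/-- By `gapParam_sub` the product of the four differences is a square times `-(a₄ - a₂)(a₃ - a₁)(1 -
m sin² y)`. That square is the square of half the Jacobian, which therefore cancels and leaves the
factor `2`. -/
theorem gapIntegral_eq_elliptic (ha : Branches a₁ a₂ a₃ a₄) (N : ℝ[X]) :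
    gapIntegral a₁ a₂ a₃ a₄ N a₁ a₂ = 2 / √((a₄ - a₂) * (a₃ - a₁)) *
      ∫ y in (0 : ℝ)..(Real.pi / 2), N.eval (gapParam a₁ a₂ a₄ y) /
        √(1 - modulus a₁ a₂ a₃ a₄ * Real.sin y ^ 2) := by
  have hpi := Real.pi_pos
  rw [gapIntegral, ← ha.image_gapParam, integral_image_eq_integral_abs_deriv_smul measurableSet_Ioo
    (fun y _ => (ha.hasDerivAt_gapParam y).hasDerivWithinAt) ha.injOn_gapParam,
    intervalIntegral.integral_of_le (by linarith), integral_Ioc_eq_integral_Ioo,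
    ← integral_const_mul]
  refine setIntegral_congr_fun measurableSet_Ioo fun y hy => ?_
  have hδ := one_sub_mul_sin_sq_pos ha.modulus_lt_one y
  obtain ⟨e1, e2, e3, e4⟩ := ha.gapParam_sub y
  have hd := ha.den_pos y
  have hsn := Real.sin_pos_of_mem_Ioo (x := y) ⟨hy.1, by linarith [hy.2]⟩
  have hcs := Real.cos_pos_of_mem_Ioo (x := y) ⟨by linarith [hy.1], hy.2⟩
  obtain ⟨h₀₁, h₁₂, h₂₃, h₃₄, h₄₅⟩ := ha
  set d := (a₄ - a₂) + (a₂ - a₁) * Real.sin y ^ 2 with hdd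
  set D := 1 - modulus a₁ a₂ a₃ a₄ * Real.sin y ^ 2 with hD
  have hp : 0 < a₄ - a₂ := by linarith
  have hq : 0 < a₂ - a₁ := by linarith
  have hs : 0 < a₃ - a₁ := by linarith
  have hL : 0 < a₄ - a₁ := by linarith
  have hprod : (gapParam a₁ a₂ a₄ y - a₁) * (gapParam a₁ a₂ a₄ y - a₂) *
      (gapParam a₁ a₂ a₄ y - a₃) * (gapParam a₁ a₂ a₄ y - a₄) =
      -(((a₂ - a₁) * (a₄ - a₂) * (a₄ - a₁) * Real.sin y * Real.cos y / d ^ 2) ^ 2 *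
        (((a₄ - a₂) * (a₃ - a₁)) * D)) := by
    rw [e1, e2, e3, e4]
    field_simp
  have hsqrt : absInvRoot a₁ a₂ a₃ a₄ (gapParam a₁ a₂ a₄ y) =
      ((a₂ - a₁) * (a₄ - a₂) * (a₄ - a₁) * Real.sin y * Real.cos y / d ^ 2 *
        (√((a₄ - a₂) * (a₃ - a₁)) * √D))⁻¹ := by
    rw [absInvRoot_eq, hprod, abs_neg, abs_of_nonneg (by positivity),
      Real.sqrt_mul (by positivity), Real.sqrt_sq (by positivity), Real.sqrt_mul (by positivity)]
  simp only [smul_eq_mul]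
  rw [hsqrt, abs_of_nonneg (by positivity)]
  have h1 : 0 < √((a₄ - a₂) * (a₃ - a₁)) := Real.sqrt_pos.mpr (by positivity)
  have h2 : 0 < √D := Real.sqrt_pos.mpr hδ
  field_simp

/-- After the substitution the integrand equals `(a₄ - a₂)(a₃ - a₁)/2` times `√Δ - μ/√Δ`, with `Δ =
1 - m sin² y`, plus an exact derivative. The first part integrates to a multiple of `E - μK = 0`;
the second vanishes at both ends. -/
theorem gapIntegral_quasimomentum (ha : Branches a₁ a₂ a₃ a₄) {e₁ c : ℝ}
    (he : e₁ = a₁ + a₂ + a₃ + a₄)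
    (hc : c = (a₁ * a₂ + a₃ * a₄ - (a₄ - a₂) * (a₃ - a₁) *
      (ellipticE (modulus a₁ a₂ a₃ a₄) / ellipticK (modulus a₁ a₂ a₃ a₄))) / 2) :
    gapIntegral a₁ a₂ a₃ a₄ (quartic c (-e₁ / 2) 1 0 0) a₁ a₂ = 0 := by
  have hK := (ellipticK_pos ha.modulus_lt_one).ne'
  have hm := ha.modulus_lt_one
  rw [ha.gapIntegral_eq_elliptic]
  set m := modulus a₁ a₂ a₃ a₄ with hmdef
  set μ := ellipticE m / ellipticK m with hμ
  set k := (a₃ - a₁) * (a₂ - a₁) * (a₄ - a₂) / 2 with hk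
  -- The substitution turns the quadratic numerator into a rational function with a double pole in
  -- the denominator of `gapParam`. The derivative of `k Ψ` absorbs this pole, and `sin y cos y`
  -- kills the boundary terms.
  set Ψ : ℝ → ℝ := fun y => Real.sin y * Real.cos y * √(1 - m * Real.sin y ^ 2) /
    ((a₄ - a₂) + (a₂ - a₁) * Real.sin y ^ 2) with hΨ
  set f : ℝ → ℝ := fun y => (quartic c (-e₁ / 2) 1 0 0).eval (gapParam a₁ a₂ a₄ y) /
    √(1 - m * Real.sin y ^ 2) - (a₄ - a₂) * (a₃ - a₁) / 2 *
    (√(1 - m * Real.sin y ^ 2) - μ * (1 / √(1 - m * Real.sin y ^ 2))) with hf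
  have hpc : Continuous (gapParam a₁ a₂ a₄) :=
    continuous_iff_continuousAt.mpr fun y => (ha.hasDerivAt_gapParam y).continuousAt
  have hc1 : Continuous fun y => (quartic c (-e₁ / 2) 1 0 0).eval (gapParam a₁ a₂ a₄ y) /
      √(1 - m * Real.sin y ^ 2) :=
    ((quartic c (-e₁ / 2) 1 0 0).continuous.comp hpc).div (continuous_sqrt_one_sub m)
      fun y => (Real.sqrt_pos.mpr (one_sub_mul_sin_sq_pos hm y)).ne'
  have hc2 := continuous_sqrt_one_sub m
  have hc3 := (continuous_inv_sqrt_one_sub hm).const_mul μ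
  have hc4 : Continuous fun y => (a₄ - a₂) * (a₃ - a₁) / 2 *
      (√(1 - m * Real.sin y ^ 2) - μ * (1 / √(1 - m * Real.sin y ^ 2))) :=
    (hc2.sub hc3).const_mul _
  have hderiv : ∀ y, HasDerivAt (fun y => k * Ψ y) (f y) y := by
    intro y
    have hd := (ha.den_pos y).ne'
    have hδ := one_sub_mul_sin_sq_pos hm y
    have hs2 : √(1 - m * Real.sin y ^ 2) ^ 2 = 1 - m * Real.sin y ^ 2 := Real.sq_sqrt hδ.le
    have hs0 := (Real.sqrt_pos.mpr hδ).ne'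
    have h1 := (((Real.hasDerivAt_sin y).pow 2).const_mul (a₂ - a₁)).const_add (a₄ - a₂)
    have h2 := ((((Real.hasDerivAt_sin y).pow 2).const_mul m).const_sub 1).sqrt hδ.ne'
    have h3 := ((((Real.hasDerivAt_sin y).mul (Real.hasDerivAt_cos y)).mul h2).div h1 hd).const_mul k
    refine h3.congr_deriv ?_
    have hps : (a₄ - a₂) * (a₃ - a₁) * m = (a₄ - a₃) * (a₂ - a₁) := by
      obtain ⟨h₀₁, h₁₂, h₂₃, h₃₄, h₄₅⟩ := ha
      rw [hmdef, modulus]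
      have hp : a₄ - a₂ ≠ 0 := by linarith
      have hs : a₃ - a₁ ≠ 0 := by linarith
      field_simp
    simp only [hf, eval_quartic, gapParam, Pi.pow_apply, Pi.mul_apply]
    set S := Real.sin y
    set Co := Real.cos y
    set r := √(1 - m * S ^ 2)
    set d := (a₄ - a₂) + (a₂ - a₁) * S ^ 2 with hdd
    have hCo : Co ^ 2 = 1 - S ^ 2 := Real.cos_sq' y
    have key : k * (((1 - 2 * S ^ 2) * (1 - m * S ^ 2) - m * S ^ 2 * (1 - S ^ 2)) * d
        - 2 * (a₂ - a₁) * S ^ 2 * (1 - S ^ 2) * (1 - m * S ^ 2)) =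
        (c + (a₄ - a₂) * (a₃ - a₁) / 2 * μ) * d ^ 2 - e₁ / 2 * (a₄ * d - (a₄ - a₂) * (a₄ - a₁)) * d
        + (a₄ * d - (a₄ - a₂) * (a₄ - a₁)) ^ 2
        - (a₄ - a₂) * (a₃ - a₁) / 2 * (1 - m * S ^ 2) * d ^ 2 := by
      rw [hk, hc, he, hdd]
      linear_combination ((a₂ - a₁) / 2 * (-(S ^ 2 * (1 - 2 * S ^ 2) + S ^ 2 * (1 - S ^ 2)) *
        ((a₄ - a₂) + (a₂ - a₁) * S ^ 2) + 2 * (a₂ - a₁) * S ^ 4 * (1 - S ^ 2))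
        - S ^ 2 * ((a₄ - a₂) + (a₂ - a₁) * S ^ 2) ^ 2 / 2) * hps
    have hL : k * ((((Co * Co + S * -S) * r + S * Co * (-(m * ((2 : ℕ) * S ^ (2 - 1) * Co)) / (2 * r))) *
        d - S * Co * r * ((a₂ - a₁) * ((2 : ℕ) * S ^ (2 - 1) * Co))) / d ^ 2) =
        k * (((1 - 2 * S ^ 2) * (1 - m * S ^ 2) - m * S ^ 2 * (1 - S ^ 2)) * d
        - 2 * (a₂ - a₁) * S ^ 2 * (1 - S ^ 2) * (1 - m * S ^ 2)) / (r * d ^ 2) := by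
      rw [← hs2, ← hCo, show (1 : ℝ) - 2 * S ^ 2 = Co ^ 2 - S ^ 2 by rw [hCo]; ring]
      push_cast
      field_simp
      ring
    rw [hL, key]
    have hr2 : 1 - m * S ^ 2 = r ^ 2 := hs2.symm
    rw [hr2]
    field_simp
    ring
  have hint : ∫ y in (0 : ℝ)..(Real.pi / 2), f y = 0 := by
    rw [intervalIntegral.integral_eq_sub_of_hasDerivAt (fun y _ => hderiv y)
      ((hc1.sub hc4).intervalIntegrable _ _)]
    simp [hΨ]
  simp only [hf] at hint
  rw [intervalIntegral.integral_sub (hc1.intervalIntegrable _ _) (hc4.intervalIntegrable _ _),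
    intervalIntegral.integral_const_mul, intervalIntegral.integral_sub (hc2.intervalIntegrable _ _)
    (hc3.intervalIntegrable _ _), intervalIntegral.integral_const_mul] at hint
  have : (∫ y in (0 : ℝ)..(Real.pi / 2), √(1 - m * Real.sin y ^ 2)) -
      μ * ∫ y in (0 : ℝ)..(Real.pi / 2), 1 / √(1 - m * Real.sin y ^ 2) = 0 := by
    change ellipticE m - ellipticE m / ellipticK m * ellipticK m = 0
    rw [div_mul_cancel₀ _ hK, sub_self]
  rw [this, mul_zero, sub_zero] at hint
  rw [hint, mul_zero]

end Branches

end DefNLS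

/-! ### Explicit densities, existence of the condensate, and moments of arbitrary solutions by
duality. -/

namespace DefNLS

open Filter Topology Asymptotics ComplexConjugate Polynomial

/-- Symmetry of the integral operator with kernel `kernel`, for a density dominated by a
majorant. -/
theorem setIntegral_kernel_swap {Γ : Set ℝ} (hΓ : Γ ⊆ Icc (-1) 1)
    (hm : MeasurableSet Γ) {u w : ℝ → ℝ} (hu : IntegrableOn u Γ) (hw : Measurable w)
    {s : Finset ℝ} {M : ℝ} (hM : 0 ≤ M)
    (hb : ∀ z ∈ Γ, ∀ x ∈ Γ, |kernel z x * w x| ≤ M * majorant s z x) :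
    ∫ z in Γ, u z * ∫ x in Γ, kernel z x * w x =
      ∫ x in Γ, w x * ∫ z in Γ, kernel x z * u z := by
  obtain ⟨K, hK⟩ := exists_setIntegral_majorant_le s
  have hi : ∀ z ∈ Γ, IntegrableOn (fun x => kernel z x * w x) Γ := fun z hz => by
    refine Integrable.mono' (((integrableOn_majorant s z).mono_set hΓ).const_mul M)
      ((measurable_kernel_left z).mul hw).aestronglyMeasurable ?_
    filter_upwards [ae_restrict_mem hm] with x hx
    exact hb z hz x hx
  -- The bound does not depend on `z`, so integrability of `u` alone gives integrability of the
  -- double integrand.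
  have hn : ∀ z ∈ Γ, ∫ x in Γ, ‖kernel z x * w x‖ ≤ M * K := fun z hz => by
    calc ∫ x in Γ, ‖kernel z x * w x‖ ≤ ∫ x in Γ, M * majorant s z x :=
          setIntegral_mono_on (hi z hz).norm
            (((integrableOn_majorant s z).mono_set hΓ).const_mul M) hm fun x hx => hb z hz x hx
      _ = M * ∫ x in Γ, majorant s z x := integral_const_mul _ _
      _ ≤ M * ∫ x in Icc (-1) 1, majorant s z x := by
          refine mul_le_mul_of_nonneg_left (setIntegral_mono_set (integrableOn_majorant s z)
            (ae_of_all _ fun x => majorant_nonneg s z x) (ae_of_all _ hΓ)) hM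
      _ ≤ M * K := mul_le_mul_of_nonneg_left (hK z (hΓ hz)) hM
  have hsm : AEStronglyMeasurable (Function.uncurry fun z x => u z * (kernel z x * w x))
      ((volume.restrict Γ).prod (volume.restrict Γ)) :=
    hu.aestronglyMeasurable.comp_fst.mul
      (measurable_kernel.mul (hw.comp measurable_snd)).aestronglyMeasurable
  have hint : Integrable (Function.uncurry fun z x => u z * (kernel z x * w x))
      ((volume.restrict Γ).prod (volume.restrict Γ)) := by
    rw [integrable_prod_iff hsm]
    constructor
    · filter_upwards [ae_restrict_mem hm] with z hz
      exact (hi z hz).const_mul (u z)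
    · refine Integrable.mono' (hu.norm.mul_const (M * K)) hsm.norm.integral_prod_right' ?_
      filter_upwards [ae_restrict_mem hm] with z hz
      simp only [Function.uncurry_apply_pair, norm_mul (u z), integral_const_mul]
      rw [norm_mul, norm_norm,
        Real.norm_of_nonneg (integral_nonneg fun x => norm_nonneg _)]
      exact mul_le_mul_of_nonneg_left (hn z hz) (norm_nonneg _)
  have := integral_integral_swap hint
  simp only [← integral_const_mul]
  rw [this]
  refine integral_congr_ae (ae_of_all _ fun x => integral_congr_ae (ae_of_all _ fun z => ?_))
  simp only [kernel_comm x z]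
  ring

namespace Branches

variable {a₁ a₂ a₃ a₄ : ℝ}

/-- The density on the bands with numerator `N`. -/
noncomputable def density (a₁ a₂ a₃ a₄ : ℝ) (N : ℝ[X]) (x : ℝ) : ℝ :=
  1 / Real.pi * (N.eval x * (cutInvRoot a₁ a₂ a₃ a₄ x).re)

theorem measurable_density (N : ℝ[X]) : Measurable (density a₁ a₂ a₃ a₄ N) :=
  (N.continuous.measurable.mul
    (Complex.measurable_re.comp (measurable_cutInvRoot a₁ a₂ a₃ a₄))).const_mul _

theorem exists_mul_density_le (ha : Branches a₁ a₂ a₃ a₄) (N : ℝ[X]) :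
    ∃ M, 0 ≤ M ∧ ∀ y, ∀ x ∈ Icc (-1 : ℝ) 1,
      (1 + |x - y| ^ (-(1 / 4) : ℝ)) * |density a₁ a₂ a₃ a₄ N x| ≤
        M * majorant (branchSet a₁ a₂ a₃ a₄) y x := by
  obtain ⟨M, hM, h⟩ := ha.exists_mul_absInvRoot_le N
  have hpi : 0 ≤ 1 / Real.pi := by positivity
  refine ⟨1 / Real.pi * M, by positivity, fun y x hx => ?_⟩
  have h1 := abs_sub_rpow_nonneg x y (-(1 / 4))
  have h2 := Complex.abs_re_le_norm (cutInvRoot a₁ a₂ a₃ a₄ x)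
  rw [norm_cutInvRoot] at h2
  rw [density, abs_mul, abs_mul, abs_of_nonneg hpi]
  calc _ ≤ (1 + |x - y| ^ (-(1 / 4) : ℝ)) *
        (1 / Real.pi * (|N.eval x| * absInvRoot a₁ a₂ a₃ a₄ x)) := by gcongr
    _ = 1 / Real.pi * ((1 + |x - y| ^ (-(1 / 4) : ℝ)) *
        (|N.eval x| * absInvRoot a₁ a₂ a₃ a₄ x)) := by ring
    _ ≤ 1 / Real.pi * (M * majorant (branchSet a₁ a₂ a₃ a₄) y x) :=
        mul_le_mul_of_nonneg_left (h y x hx) hpi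
    _ = _ := by ring

theorem exists_kernel_mul_density_le (ha : Branches a₁ a₂ a₃ a₄) (N : ℝ[X]) :
    ∃ M, 0 ≤ M ∧ ∀ z ∈ genusOneSupport a₁ a₂ a₃ a₄, ∀ x ∈ genusOneSupport a₁ a₂ a₃ a₄,
      |kernel z x * density a₁ a₂ a₃ a₄ N x| ≤ M * majorant (branchSet a₁ a₂ a₃ a₄) z x := by
  obtain ⟨M, hM, h⟩ := ha.exists_mul_density_le N
  refine ⟨8 * M, by positivity, fun z hz x hx => ?_⟩
  have hx' := ha.support_subset hx
  have h1 := abs_kernel_le (ha.support_subset hz) hx'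
  rw [abs_mul]
  calc _ ≤ 8 * (1 + |x - z| ^ (-(1 / 4) : ℝ)) * |density a₁ a₂ a₃ a₄ N x| :=
        mul_le_mul_of_nonneg_right (by linarith) (abs_nonneg _)
    _ = 8 * ((1 + |x - z| ^ (-(1 / 4) : ℝ)) * |density a₁ a₂ a₃ a₄ N x|) := by ring
    _ ≤ 8 * (M * majorant (branchSet a₁ a₂ a₃ a₄) z x) := by linarith [h z x hx']
    _ = _ := by ring

theorem integrableOn_density (ha : Branches a₁ a₂ a₃ a₄) (N : ℝ[X]) :
    IntegrableOn (density a₁ a₂ a₃ a₄ N) (genusOneSupport a₁ a₂ a₃ a₄) := by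
  obtain ⟨M, hM, h⟩ := ha.exists_mul_density_le N
  refine Integrable.mono' (((integrableOn_majorant (branchSet a₁ a₂ a₃ a₄) 0).mono_set ha.support_subset).const_mul M)
    (measurable_density N).aestronglyMeasurable ?_
  filter_upwards [ae_restrict_mem (measurableSet_support _ _ _ _)] with x hx
  refine le_trans ?_ (h 0 x (ha.support_subset hx))
  rw [Real.norm_eq_abs]
  exact le_mul_of_one_le_left (abs_nonneg _)
    (by linarith [abs_sub_rpow_nonneg x 0 (-(1 / 4))])

theorem integrableOn_kernel_mul_density (ha : Branches a₁ a₂ a₃ a₄) (N : ℝ[X]) {z : ℝ}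
    (hz : z ∈ genusOneSupport a₁ a₂ a₃ a₄) :
    IntegrableOn (fun x => kernel z x * density a₁ a₂ a₃ a₄ N x)
      (genusOneSupport a₁ a₂ a₃ a₄) := by
  obtain ⟨M, hM, h⟩ := ha.exists_kernel_mul_density_le N
  refine Integrable.mono' (((integrableOn_majorant (branchSet a₁ a₂ a₃ a₄) z).mono_set ha.support_subset).const_mul M)
    ((measurable_kernel_left z).mul (measurable_density N)).aestronglyMeasurable ?_
  filter_upwards [ae_restrict_mem (measurableSet_support _ _ _ _)] with x hx
  exact h z hz x hx

/-- The potential of a solution of a dispersion relation against an explicit density. -/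
theorem integral_mul_eq_of_solvesNDR (ha : Branches a₁ a₂ a₃ a₄) {f h u : ℝ → ℝ} (N : ℝ[X])
    (hu : SolvesNDR (genusOneSupport a₁ a₂ a₃ a₄) (fun _ => 0) f u)
    (hN : ∀ z ∈ genusOneSupport a₁ a₂ a₃ a₄,
      ∫ x in genusOneSupport a₁ a₂ a₃ a₄, kernel z x * density a₁ a₂ a₃ a₄ N x = h z) :
    ∫ z in genusOneSupport a₁ a₂ a₃ a₄, u z * h z =
      ∫ x in genusOneSupport a₁ a₂ a₃ a₄, density a₁ a₂ a₃ a₄ N x * f x := by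
  obtain ⟨M, hM, hb⟩ := ha.exists_kernel_mul_density_le N
  have hs := measurableSet_support a₁ a₂ a₃ a₄
  have := setIntegral_kernel_swap ha.support_subset hs hu.integrableOn (measurable_density N) hM hb
  rw [setIntegral_congr_fun hs fun z hz => show u z * h z = _ by rw [← hN z hz], this]
  refine setIntegral_congr_fun hs fun x hx => ?_
  have := hu.equation x hx
  simp only [zero_mul, add_zero] at this
  simp only [this]

theorem integral_density_mul {g : ℝ → ℝ} {N : ℝ[X]} {r : ℝ}
    (h : ∫ x in genusOneSupport a₁ a₂ a₃ a₄, g x * (N.eval x * (cutInvRoot a₁ a₂ a₃ a₄ x).re) =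
      Real.pi * r) :
    ∫ x in genusOneSupport a₁ a₂ a₃ a₄, g x * density a₁ a₂ a₃ a₄ N x = r := by
  have e : ∀ x, g x * density a₁ a₂ a₃ a₄ N x =
      1 / Real.pi * (g x * (N.eval x * (cutInvRoot a₁ a₂ a₃ a₄ x).re)) := fun x => by
    unfold density; ring
  simp only [e, integral_const_mul, h]
  field_simp

section Numerators

variable {e₁ e₂ e₃ e₄ c : ℝ}

theorem gapIntegral_derivative (ha : Branches a₁ a₂ a₃ a₄) (he : IsEsymm a₁ a₂ a₃ a₄ e₁ e₂ e₃ e₄)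
    {N p : ℝ[X]} (hN : ∀ x, N.eval x =
      (derivative p).eval x * (quartic e₄ (-e₃) e₂ (-e₁) 1).eval x
        + p.eval x * (derivative (quartic e₄ (-e₃) e₂ (-e₁) 1)).eval x / 2) :
    gapIntegral a₁ a₂ a₃ a₄ N a₁ a₂ = 0 ∧ gapIntegral a₁ a₂ a₃ a₄ N a₃ a₄ = 0 := by
  have hP : ∀ x, (quartic e₄ (-e₃) e₂ (-e₁) 1).eval x =
      (x - a₁) * (x - a₂) * (x - a₃) * (x - a₄) := fun x => by
    rw [eval_quartic, he.h₁, he.h₂, he.h₃, he.h₄]; ring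
  obtain ⟨h₀₁, h₁₂, h₂₃, h₃₄, h₄₅⟩ := id ha
  constructor
  · refine ha.gapIntegral_exact h₁₂.le h₀₁ (by linarith) hP (fun x hx => ?_)
      (by rw [hP]; ring) (by rw [hP]; ring) hN
    rw [hP]
    have h1 : 0 < x - a₁ := by linarith [hx.1]
    have h2 : 0 < a₂ - x := by linarith [hx.2]
    have h3 : 0 < a₃ - x := by linarith [hx.2]
    have h4 : 0 < a₄ - x := by linarith [hx.2]
    have := mul_pos (mul_pos (mul_pos h1 h2) h3) h4
    linarith
  · refine ha.gapIntegral_exact h₃₄.le (by linarith) h₄₅ hP (fun x hx => ?_)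
      (by rw [hP]; ring) (by rw [hP]; ring) hN
    rw [hP]
    have h1 : 0 < x - a₁ := by linarith [hx.1]
    have h2 : 0 < x - a₂ := by linarith [hx.1]
    have h3 : 0 < x - a₃ := by linarith [hx.1]
    have h4 : 0 < a₄ - x := by linarith [hx.2]
    have := mul_pos (mul_pos (mul_pos h1 h2) h3) h4
    linarith

/-- The numerator of the quasimomentum differential. -/
noncomputable def momentumNum (e₁ c : ℝ) : ℝ[X] := quartic c (-e₁ / 2) 1 0 0

/-- The numerator of the quasienergy differential. -/
noncomputable def energyNum (e₁ e₂ e₃ c : ℝ) : ℝ[X] :=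
  quartic (-e₃ + e₁ * c) (2 * e₂ - e₁ ^ 2 / 2) (-2 * e₁) 4 0

/-- The numerator of the differential whose density has potential `z² |R₀(z)|`. -/
noncomputable def secondNum (e₁ e₂ e₃ e₄ c : ℝ) : ℝ[X] :=
  quartic (e₄ - e₁ * e₃ / 4 + 3 / 8 * e₁ ^ 2 * c - e₂ * c / 2 - c / 2)
    (-3 / 2 * e₃ + 3 / 4 * e₁ * e₂ - 3 / 16 * e₁ ^ 3 + e₁ / 4)
    (3 / 2 * e₂ - 3 / 8 * e₁ ^ 2 - 1 / 2) (-3 / 2 * e₁) 3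

theorem derivative_quartic (n₀ n₁ n₂ n₃ n₄ x : ℝ) :
    (derivative (quartic n₀ n₁ n₂ n₃ n₄)).eval x =
      n₁ + 2 * n₂ * x + 3 * n₃ * x ^ 2 + 4 * n₄ * x ^ 3 := by
  simp [quartic]
  ring

/-- With `P = ∏(x - aⱼ)`, the numerator is `P'`, which is exact, plus `e₁` times the momentum
numerator. -/
theorem gapIntegral_energyNum (ha : Branches a₁ a₂ a₃ a₄)
    (he : IsEsymm a₁ a₂ a₃ a₄ e₁ e₂ e₃ e₄)
    (g₁ : gapIntegral a₁ a₂ a₃ a₄ (momentumNum e₁ c) a₁ a₂ = 0)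
    (g₂ : gapIntegral a₁ a₂ a₃ a₄ (momentumNum e₁ c) a₃ a₄ = 0) :
    gapIntegral a₁ a₂ a₃ a₄ (energyNum e₁ e₂ e₃ c) a₁ a₂ = 0 ∧
      gapIntegral a₁ a₂ a₃ a₄ (energyNum e₁ e₂ e₃ c) a₃ a₄ = 0 := by
  obtain ⟨d₁, d₂⟩ := ha.gapIntegral_derivative he (N := quartic (-e₃) (2 * e₂) (-3 * e₁) 4 0)
    (p := 2) fun x => by simp [eval_quartic, derivative_quartic]
  have e : ∀ x, (energyNum e₁ e₂ e₃ c).eval x =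
      1 * (quartic (-e₃) (2 * e₂) (-3 * e₁) 4 0).eval x + e₁ * (momentumNum e₁ c).eval x :=
    fun x => by simp only [energyNum, momentumNum, eval_quartic]; ring
  obtain ⟨h₀₁, h₁₂, h₂₃, h₃₄, h₄₅⟩ := id ha
  rw [ha.gapIntegral_linear h₀₁ (by linarith) e, ha.gapIntegral_linear (by linarith) h₄₅ e,
    d₁, d₂, g₁, g₂]
  simp

/-- Here the exact part is `P + xP'/2`, from `p = x`. The multiples of the energy and momentum
numerators are those that cancel the terms of degree one and zero in the potential, leaving `z²
|R₀(z)|`. -/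
theorem gapIntegral_secondNum (ha : Branches a₁ a₂ a₃ a₄)
    (he : IsEsymm a₁ a₂ a₃ a₄ e₁ e₂ e₃ e₄)
    (g₁ : gapIntegral a₁ a₂ a₃ a₄ (momentumNum e₁ c) a₁ a₂ = 0)
    (g₂ : gapIntegral a₁ a₂ a₃ a₄ (momentumNum e₁ c) a₃ a₄ = 0) :
    gapIntegral a₁ a₂ a₃ a₄ (secondNum e₁ e₂ e₃ e₄ c) a₁ a₂ = 0 ∧
      gapIntegral a₁ a₂ a₃ a₄ (secondNum e₁ e₂ e₃ e₄ c) a₃ a₄ = 0 := by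
  obtain ⟨q₁, q₂⟩ := ha.gapIntegral_energyNum he g₁ g₂
  obtain ⟨d₁, d₂⟩ := ha.gapIntegral_derivative he
    (N := quartic e₄ (-3 / 2 * e₃) (2 * e₂) (-5 / 2 * e₁) 3)
    (p := X) fun x => by simp [eval_quartic, derivative_quartic]; ring
  set L : ℝ[X] := quartic (e₁ / 4 * (-e₃ + e₁ * c) - (e₂ / 2 - e₁ ^ 2 / 8 + 1 / 2) * c)
    (e₁ / 4 * (2 * e₂ - e₁ ^ 2 / 2) - (e₂ / 2 - e₁ ^ 2 / 8 + 1 / 2) * (-e₁ / 2))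
    (e₁ / 4 * (-2 * e₁) - (e₂ / 2 - e₁ ^ 2 / 8 + 1 / 2)) e₁ 0 with hL
  have e : ∀ x, L.eval x = e₁ / 4 * (energyNum e₁ e₂ e₃ c).eval x +
      (-(e₂ / 2 - e₁ ^ 2 / 8 + 1 / 2)) * (momentumNum e₁ c).eval x :=
    fun x => by simp only [hL, energyNum, momentumNum, eval_quartic]; ring
  have e' : ∀ x, (secondNum e₁ e₂ e₃ e₄ c).eval x =
      1 * (quartic e₄ (-3 / 2 * e₃) (2 * e₂) (-5 / 2 * e₁) 3).eval x + 1 * L.eval x :=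
    fun x => by simp only [hL, secondNum, eval_quartic]; ring
  obtain ⟨h₀₁, h₁₂, h₂₃, h₃₄, h₄₅⟩ := id ha
  rw [ha.gapIntegral_linear h₀₁ (by linarith) e', ha.gapIntegral_linear (by linarith) h₄₅ e',
    ha.gapIntegral_linear h₀₁ (by linarith) e, ha.gapIntegral_linear (by linarith) h₄₅ e,
    d₁, d₂, g₁, g₂, q₁, q₂]
  simp

theorem integral_kernel_momentum (ha : Branches a₁ a₂ a₃ a₄)
    (he : IsEsymm a₁ a₂ a₃ a₄ e₁ e₂ e₃ e₄)
    (g₁ : gapIntegral a₁ a₂ a₃ a₄ (momentumNum e₁ c) a₁ a₂ = 0)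
    (g₂ : gapIntegral a₁ a₂ a₃ a₄ (momentumNum e₁ c) a₃ a₄ = 0) {z : ℝ}
    (hz : z ∈ genusOneSupport a₁ a₂ a₃ a₄) :
    ∫ x in genusOneSupport a₁ a₂ a₃ a₄,
      kernel z x * density a₁ a₂ a₃ a₄ (momentumNum e₁ c) x = absR₀ z := by
  refine integral_density_mul ((ha.integral_kernel_mul he _ _ _ _ _ g₁ g₂ hz).trans ?_)
  ring

theorem integral_kernel_energy (ha : Branches a₁ a₂ a₃ a₄)
    (he : IsEsymm a₁ a₂ a₃ a₄ e₁ e₂ e₃ e₄)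
    (g₁ : gapIntegral a₁ a₂ a₃ a₄ (momentumNum e₁ c) a₁ a₂ = 0)
    (g₂ : gapIntegral a₁ a₂ a₃ a₄ (momentumNum e₁ c) a₃ a₄ = 0) {z : ℝ}
    (hz : z ∈ genusOneSupport a₁ a₂ a₃ a₄) :
    ∫ x in genusOneSupport a₁ a₂ a₃ a₄,
      kernel z x * density a₁ a₂ a₃ a₄ (energyNum e₁ e₂ e₃ c) x = 2 * z * absR₀ z := by
  obtain ⟨q₁, q₂⟩ := ha.gapIntegral_energyNum he g₁ g₂
  refine integral_density_mul ((ha.integral_kernel_mul he _ _ _ _ _ q₁ q₂ hz).trans ?_)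
  ring

theorem integral_kernel_second (ha : Branches a₁ a₂ a₃ a₄)
    (he : IsEsymm a₁ a₂ a₃ a₄ e₁ e₂ e₃ e₄)
    (g₁ : gapIntegral a₁ a₂ a₃ a₄ (momentumNum e₁ c) a₁ a₂ = 0)
    (g₂ : gapIntegral a₁ a₂ a₃ a₄ (momentumNum e₁ c) a₃ a₄ = 0) {z : ℝ}
    (hz : z ∈ genusOneSupport a₁ a₂ a₃ a₄) :
    ∫ x in genusOneSupport a₁ a₂ a₃ a₄,
      kernel z x * density a₁ a₂ a₃ a₄ (secondNum e₁ e₂ e₃ e₄ c) x = z ^ 2 * absR₀ z := by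
  obtain ⟨q₁, q₂⟩ := ha.gapIntegral_secondNum he g₁ g₂
  refine integral_density_mul ((ha.integral_kernel_mul he _ _ _ _ _ q₁ q₂ hz).trans ?_)
  ring

/-- Existence of the condensate. -/
theorem isCondensate_density (ha : Branches a₁ a₂ a₃ a₄)
    (he : IsEsymm a₁ a₂ a₃ a₄ e₁ e₂ e₃ e₄)
    (g₁ : gapIntegral a₁ a₂ a₃ a₄ (momentumNum e₁ c) a₁ a₂ = 0)
    (g₂ : gapIntegral a₁ a₂ a₃ a₄ (momentumNum e₁ c) a₃ a₄ = 0) :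
    IsCondensate (genusOneSupport a₁ a₂ a₃ a₄) (density a₁ a₂ a₃ a₄ (momentumNum e₁ c))
      (density a₁ a₂ a₃ a₄ (energyNum e₁ e₂ e₃ c)) where
  dos := ⟨ha.integrableOn_density _, fun _ hz => ha.integrableOn_kernel_mul_density _ hz,
    fun _ hz => by rw [zero_mul, add_zero, ha.integral_kernel_momentum he g₁ g₂ hz]⟩
  dof := ⟨ha.integrableOn_density _, fun _ hz => ha.integrableOn_kernel_mul_density _ hz,
    fun _ hz => by rw [zero_mul, add_zero, ha.integral_kernel_energy he g₁ g₂ hz]⟩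

theorem integral_dos_mul_absR₀ (ha : Branches a₁ a₂ a₃ a₄)
    (he : IsEsymm a₁ a₂ a₃ a₄ e₁ e₂ e₃ e₄)
    (g₁ : gapIntegral a₁ a₂ a₃ a₄ (momentumNum e₁ c) a₁ a₂ = 0)
    (g₂ : gapIntegral a₁ a₂ a₃ a₄ (momentumNum e₁ c) a₃ a₄ = 0) {u : ℝ → ℝ}
    (hu : IsDOS (genusOneSupport a₁ a₂ a₃ a₄) (fun _ => 0) u) :
    ∫ x in genusOneSupport a₁ a₂ a₃ a₄, u x * absR₀ x = 1 / 2 - c + e₂ / 2 - e₁ ^ 2 / 8 := by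
  rw [ha.integral_mul_eq_of_solvesNDR (momentumNum e₁ c) hu fun z hz =>
    ha.integral_kernel_momentum he g₁ g₂ hz]
  simp only [mul_comm (density _ _ _ _ _ _)]
  refine integral_density_mul (ha.integral_absR₀_mul he _ _ _ _ _ _ ?_)
  rintro _ _ _ _ _ _ rfl rfl rfl rfl rfl rfl
  ring

/-- As `u` is not known explicitly, the weight `x²|R₀|` is realised as the potential of the density
of `secondNum`. Duality then leaves the moment of that density against `|R₀|`. -/
theorem integral_dos_mul_sq_mul_absR₀ (ha : Branches a₁ a₂ a₃ a₄)
    (he : IsEsymm a₁ a₂ a₃ a₄ e₁ e₂ e₃ e₄)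
    (g₁ : gapIntegral a₁ a₂ a₃ a₄ (momentumNum e₁ c) a₁ a₂ = 0)
    (g₂ : gapIntegral a₁ a₂ a₃ a₄ (momentumNum e₁ c) a₃ a₄ = 0) {u : ℝ → ℝ}
    (hu : IsDOS (genusOneSupport a₁ a₂ a₃ a₄) (fun _ => 0) u) :
    ∫ x in genusOneSupport a₁ a₂ a₃ a₄, u x * (x ^ 2 * absR₀ x) =
      1 / 8 - e₂ / 4 + e₁ ^ 2 / 16 + e₄ / 2 - e₁ * e₃ / 2 - 3 / 8 * e₁ ^ 2 * c + e₂ * c / 2 + c / 2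
        + 9 / 16 * e₁ ^ 2 * e₂ - 15 / 128 * e₁ ^ 4 - 3 / 8 * e₂ ^ 2 := by
  rw [ha.integral_mul_eq_of_solvesNDR (secondNum e₁ e₂ e₃ e₄ c) hu fun z hz =>
    ha.integral_kernel_second he g₁ g₂ hz]
  simp only [mul_comm (density _ _ _ _ _ _)]
  refine integral_density_mul (ha.integral_absR₀_mul he _ _ _ _ _ _ ?_)
  rintro _ _ _ _ _ _ rfl rfl rfl rfl rfl rfl
  ring

theorem integral_dof_mul_id_mul_absR₀ (ha : Branches a₁ a₂ a₃ a₄)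
    (he : IsEsymm a₁ a₂ a₃ a₄ e₁ e₂ e₃ e₄)
    (g₁ : gapIntegral a₁ a₂ a₃ a₄ (momentumNum e₁ c) a₁ a₂ = 0)
    (g₂ : gapIntegral a₁ a₂ a₃ a₄ (momentumNum e₁ c) a₃ a₄ = 0) {v : ℝ → ℝ}
    (hv : IsDOF (genusOneSupport a₁ a₂ a₃ a₄) (fun _ => 0) v) :
    ∫ x in genusOneSupport a₁ a₂ a₃ a₄, v x * (x * absR₀ x) =
      1 / 2 - 3 / 2 * e₁ * e₃ - e₁ ^ 2 * c / 2 - e₂ ^ 2 / 2 + 5 / 4 * e₁ ^ 2 * e₂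
        - 9 / 32 * e₁ ^ 4 + 2 * e₄ := by
  have h := ha.integral_mul_eq_of_solvesNDR (energyNum e₁ e₂ e₃ c) hv fun z hz =>
    ha.integral_kernel_energy he g₁ g₂ hz
  have h1 : ∀ x, v x * (2 * x * absR₀ x) = 2 * (v x * (x * absR₀ x)) := fun x => by ring
  -- The factor `x` is absorbed into the cubic numerator, whose shifted coefficients still fit in
  -- degree four.
  have h2 : ∀ x, density a₁ a₂ a₃ a₄ (energyNum e₁ e₂ e₃ c) x * (2 * x * absR₀ x) =
      2 * (absR₀ x * density a₁ a₂ a₃ a₄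
        (quartic 0 (-e₃ + e₁ * c) (2 * e₂ - e₁ ^ 2 / 2) (-2 * e₁) 4) x) := fun x => by
    simp only [density, energyNum, eval_quartic]; ring
  simp only [h1, h2, integral_const_mul] at h
  rw [mul_left_cancel₀ two_ne_zero h]
  refine integral_density_mul (ha.integral_absR₀_mul he _ _ _ _ _ _ ?_)
  rintro _ _ _ _ _ _ rfl rfl rfl rfl rfl rfl
  ring

end Numerators

end Branches

end DefNLS

/-! ### Laurent coefficients at infinity as moments of `u` and `v`. -/

namespace DefNLS

open Filter Topology Asymptotics ComplexConjugate Polynomial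

section Cauchy

variable {Γ : Set ℝ} {φ : ℝ → ℂ}

theorem norm_sub_pos_of_mem (hΓ : Γ ⊆ Icc (-1) 1) {ζ : ℝ} (hζ : ζ ∈ Γ) (z : ℂ) :
    ‖z‖ - 1 ≤ ‖(ζ : ℂ) - z‖ := by
  have h1 : ‖(ζ : ℂ)‖ ≤ 1 := by
    rw [Complex.norm_real, Real.norm_eq_abs]; exact abs_le.mpr (hΓ hζ)
  have h2 := norm_sub_norm_le z (ζ : ℂ)
  rw [norm_sub_rev] at h2
  linarith

theorem differentiableAt_cauchyIntegral (hΓ : Γ ⊆ Icc (-1) 1) (hm : MeasurableSet Γ)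
    (hφ : IntegrableOn φ Γ) {z : ℂ} (hz : 1 < ‖z‖) :
    DifferentiableAt ℂ (fun z => ∫ ζ in Γ, φ ζ / ((ζ : ℂ) - z)) z := by
  set δ := (‖z‖ - 1) / 2 with hδ
  have hδ0 : 0 < δ := by linarith
  have far : ∀ y ∈ Metric.ball z δ, ∀ ζ ∈ Γ, δ ≤ ‖(ζ : ℂ) - y‖ := fun y hy ζ hζ => by
    have h1 := norm_sub_pos_of_mem hΓ hζ y
    have h2 := norm_sub_norm_le z y
    rw [Metric.mem_ball, dist_comm, dist_eq_norm] at hy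
    linarith
  have hms : ∀ y : ℂ, AEStronglyMeasurable (fun ζ : ℝ => φ ζ / ((ζ : ℂ) - y))
      (volume.restrict Γ) := fun y =>
    (hφ.aestronglyMeasurable.aemeasurable.div
      (Complex.measurable_ofReal.sub measurable_const).aemeasurable).aestronglyMeasurable
  refine (hasDerivAt_integral_of_dominated_loc_of_deriv_le (μ := volume.restrict Γ)
    (F := fun z ζ => φ ζ / ((ζ : ℂ) - z)) (F' := fun z ζ => φ ζ / ((ζ : ℂ) - z) ^ 2)
    (bound := fun ζ => ‖φ ζ‖ / δ ^ 2) (Metric.ball_mem_nhds z hδ0) (Eventually.of_forall hms)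
    ?_ ?_ ?_ ?_ ?_).2.differentiableAt
  · refine Integrable.mono' (hφ.norm.div_const δ) (hms z) ?_
    filter_upwards [ae_restrict_mem hm] with ζ hζ
    rw [norm_div]
    exact div_le_div_of_nonneg_left (norm_nonneg _) hδ0 (far z (Metric.mem_ball_self hδ0) ζ hζ)
  · exact (hφ.aestronglyMeasurable.aemeasurable.div
      ((Complex.measurable_ofReal.sub measurable_const).pow_const 2).aemeasurable).aestronglyMeasurable
  · filter_upwards [ae_restrict_mem hm] with ζ hζ y hy
    rw [norm_div, norm_pow]
    exact div_le_div_of_nonneg_left (norm_nonneg _) (by positivity)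
      (pow_le_pow_left₀ hδ0.le (far y hy ζ hζ) 2)
  · exact hφ.norm.div_const _
  · filter_upwards [ae_restrict_mem hm] with ζ hζ y hy
    have h0 : (ζ : ℂ) - y ≠ 0 := norm_pos_iff.mp (hδ0.trans_le (far y hy ζ hζ))
    have := ((hasDerivAt_const y (ζ : ℂ)).sub (hasDerivAt_id y)).inv h0
    refine (this.const_mul (φ ζ)).congr_deriv ?_
    simp [div_eq_mul_inv]

/-- Five applications of `1/(1 - ζw) = 1 + ζw/(1 - ζw)` under the integral. For `|w| < 1/2` the
denominator has modulus at least `1/2`, which bounds the last remainder by `2∫|φ|`. -/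
theorem hasTaylor_cauchyIntegral (hΓ : Γ ⊆ Icc (-1) 1) (hm : MeasurableSet Γ)
    (hφ : IntegrableOn φ Γ) :
    HasTaylor (fun w => ∫ ζ in Γ, φ ζ / (1 - (ζ : ℂ) * w)) (∫ ζ in Γ, φ ζ)
      (∫ ζ in Γ, φ ζ * ζ) (∫ ζ in Γ, φ ζ * ζ ^ 2) (∫ ζ in Γ, φ ζ * ζ ^ 3)
      (∫ ζ in Γ, φ ζ * ζ ^ 4) := by
  have hle : ∀ ζ ∈ Γ, ‖(ζ : ℂ)‖ ≤ 1 := fun ζ hζ => by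
    rw [Complex.norm_real, Real.norm_eq_abs]; exact abs_le.mpr (hΓ hζ)
  have hi : ∀ k : ℕ, IntegrableOn (fun ζ => φ ζ * (ζ : ℂ) ^ k) Γ := fun k => by
    refine Integrable.mono' hφ.norm (hφ.aestronglyMeasurable.mul
      (Complex.measurable_ofReal.pow_const k).aestronglyMeasurable) ?_
    filter_upwards [ae_restrict_mem hm] with ζ hζ
    rw [norm_mul, norm_pow]
    exact mul_le_of_le_one_right (norm_nonneg _) (pow_le_one₀ (norm_nonneg _) (hle ζ hζ))
  refine IsBigO.of_bound (2 * ∫ ζ in Γ, ‖φ ζ‖) ?_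
  have hball : ∀ᶠ w : ℂ in 𝓝[≠] 0, ‖w‖ < 1 / 2 := by
    refine nhdsWithin_le_nhds ?_
    filter_upwards [Metric.ball_mem_nhds (0 : ℂ) one_half_pos] with w hw
    simpa using hw
  filter_upwards [hball] with w hw
  have half : ∀ ζ ∈ Γ, 1 / 2 ≤ ‖1 - (ζ : ℂ) * w‖ := fun ζ hζ => by
    have h1 := norm_sub_norm_le (1 : ℂ) ((ζ : ℂ) * w)
    have h2 : ‖(ζ : ℂ) * w‖ ≤ ‖w‖ := by
      rw [norm_mul]; exact mul_le_of_le_one_left (norm_nonneg _) (hle ζ hζ)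
    rw [norm_one] at h1
    linarith
  have hd : ∀ k : ℕ, IntegrableOn (fun ζ => φ ζ * (ζ : ℂ) ^ k / (1 - (ζ : ℂ) * w)) Γ := fun k => by
    refine Integrable.mono' ((hi k).norm.mul_const 2) (((hi k).aestronglyMeasurable.aemeasurable.div
      (measurable_const.sub (Complex.measurable_ofReal.mul_const w)).aemeasurable).aestronglyMeasurable) ?_
    filter_upwards [ae_restrict_mem hm] with ζ hζ
    rw [norm_div, div_le_iff₀ (one_half_pos.trans_le (half ζ hζ))]
    nlinarith [half ζ hζ, norm_nonneg (φ ζ * (ζ : ℂ) ^ k)]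
  have step : ∀ k : ℕ, ∫ ζ in Γ, φ ζ * (ζ : ℂ) ^ k / (1 - (ζ : ℂ) * w) =
      (∫ ζ in Γ, φ ζ * (ζ : ℂ) ^ k) +
        (∫ ζ in Γ, φ ζ * (ζ : ℂ) ^ (k + 1) / (1 - (ζ : ℂ) * w)) * w := fun k => by
    rw [← integral_mul_const, ← integral_add (hi k) ((hd (k + 1)).mul_const w)]
    refine setIntegral_congr_fun hm fun ζ hζ => ?_
    have h0 : 1 - (ζ : ℂ) * w ≠ 0 := norm_pos_iff.mp (one_half_pos.trans_le (half ζ hζ))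
    simp only [pow_succ]
    field_simp
    ring
  have s0 := step 0
  have s1 := step 1
  simp only [pow_zero, mul_one, zero_add, pow_one] at s0 s1
  have e : ∫ ζ in Γ, φ ζ / (1 - (ζ : ℂ) * w) =
      (∫ ζ in Γ, φ ζ) + (∫ ζ in Γ, φ ζ * ζ) * w + (∫ ζ in Γ, φ ζ * ζ ^ 2) * w ^ 2
        + (∫ ζ in Γ, φ ζ * ζ ^ 3) * w ^ 3 + (∫ ζ in Γ, φ ζ * ζ ^ 4) * w ^ 4
        + (∫ ζ in Γ, φ ζ * ζ ^ 5 / (1 - (ζ : ℂ) * w)) * w ^ 5 := by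
    rw [s0, s1, step 2, step 3, step 4]
    ring
  rw [e, add_sub_cancel_left, norm_mul]
  refine mul_le_mul_of_nonneg_right ?_ (norm_nonneg _)
  rw [← integral_const_mul]
  refine norm_integral_le_of_norm_le (hφ.norm.const_mul 2) ?_
  filter_upwards [ae_restrict_mem hm] with ζ hζ
  rw [norm_div, div_le_iff₀ (one_half_pos.trans_le (half ζ hζ)), norm_mul, norm_pow]
  have h1 : ‖φ ζ‖ * ‖(ζ : ℂ)‖ ^ 5 ≤ ‖φ ζ‖ :=
    mul_le_of_le_one_right (norm_nonneg _) (pow_le_one₀ (norm_nonneg _) (hle ζ hζ))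
  nlinarith [half ζ hζ, norm_nonneg (φ ζ)]

end Cauchy

section Root

/-- The branch of `√(1 - w²)` on the unit disk. -/
noncomputable def diskRoot (w : ℂ) : ℂ := (1 - w ^ 2) ^ (1 / 2 : ℂ)

theorem one_sub_sq_mem_slitPlane {w : ℂ} (hw : ‖w‖ < 1) : 1 - w ^ 2 ∈ Complex.slitPlane := by
  have : ‖w ^ 2‖ < 1 := by rw [norm_pow]; exact pow_lt_one₀ (norm_nonneg _) hw two_ne_zero
  exact one_sub_mem_slitPlane this.le fun h => by simp [h] at this

theorem diskRoot_sq (w : ℂ) : diskRoot w ^ 2 = 1 - w ^ 2 := by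
  rw [diskRoot, ← Complex.cpow_nat_mul]
  norm_num

theorem diskRoot_ne_zero {w : ℂ} (hw : ‖w‖ < 1) : diskRoot w ≠ 0 := fun h => by
  have := diskRoot_sq w
  rw [h] at this
  exact Complex.slitPlane_ne_zero (one_sub_sq_mem_slitPlane hw) (by rw [← this]; ring)

theorem differentiableAt_diskRoot {w : ℂ} (hw : ‖w‖ < 1) : DifferentiableAt ℂ diskRoot w :=
  DifferentiableAt.cpow_const (by fun_prop) (one_sub_sq_mem_slitPlane hw)

theorem R₀_eq (z : ℂ) : R₀ z = z * diskRoot z⁻¹ := by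
  simp [R₀, diskRoot]

theorem norm_inv_lt_one {z : ℂ} (hz : 1 < ‖z‖) : ‖z⁻¹‖ < 1 := by
  rw [norm_inv]; exact inv_lt_one_of_one_lt₀ hz

theorem ne_zero_of_one_lt {z : ℂ} (hz : 1 < ‖z‖) : z ≠ 0 :=
  norm_pos_iff.mp (zero_lt_one.trans hz)

theorem R₀_ne_zero {z : ℂ} (hz : 1 < ‖z‖) : R₀ z ≠ 0 := by
  rw [R₀_eq]
  exact mul_ne_zero (ne_zero_of_one_lt hz) (diskRoot_ne_zero (norm_inv_lt_one hz))

theorem differentiableAt_R₀ {z : ℂ} (hz : 1 < ‖z‖) : DifferentiableAt ℂ R₀ z := by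
  rw [show R₀ = fun z => z * diskRoot z⁻¹ from funext R₀_eq]
  have h1 : DifferentiableAt ℂ (fun z : ℂ => z⁻¹) z := differentiableAt_inv (ne_zero_of_one_lt hz)
  exact differentiableAt_id.mul
    (DifferentiableAt.comp z (differentiableAt_diskRoot (norm_inv_lt_one hz)) h1)

theorem hasTaylor_inv_diskRoot :
    HasTaylor (fun w => (diskRoot w)⁻¹) 1 0 (1 / 2) 0 (3 / 8) := by
  have h1 : HasTaylor (fun w => 1 - w ^ 2) 1 0 (-1) 0 0 :=
    (hasTaylor_poly 1 0 (-1) 0 0).of_eq (fun w _ => by ring) rfl rfl rfl rfl rfl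
  have hball : ∀ᶠ w : ℂ in 𝓝[≠] 0, ‖w‖ < 1 := by
    refine nhdsWithin_le_nhds ?_
    filter_upwards [Metric.ball_mem_nhds (0 : ℂ) one_pos] with w hw
    simpa using hw
  have h0 : ‖(0 : ℂ)‖ < 1 := by simp
  have hlim : Tendsto (fun w => (diskRoot w)⁻¹) (𝓝[≠] 0) (𝓝 1) := by
    have := ((differentiableAt_diskRoot h0).continuousAt.inv₀ (diskRoot_ne_zero h0)).tendsto
    rw [show diskRoot⁻¹ 0 = 1 by simp [diskRoot]] at this
    exact this.mono_left nhdsWithin_le_nhds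
  refine (hasTaylor_of_sq_mul_eq_one h1 hlim ?_).of_eq (fun _ _ => rfl) rfl ?_ ?_ ?_ ?_
  · filter_upwards [hball] with w hw
    rw [← diskRoot_sq, inv_pow, inv_mul_cancel₀ (pow_ne_zero 2 (diskRoot_ne_zero hw))]
  all_goals norm_num

end Root

section Coefficients

variable {Γ : Set ℝ} {u : ℝ → ℝ}

theorem integrableOn_mul_R₀cut (hu : IntegrableOn u Γ) : IntegrableOn (fun ζ => (u ζ : ℂ) * R₀cut ζ) Γ := by
  have hr : Measurable R₀cut := by unfold R₀cut absR₀; fun_prop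
  have hu' : IntegrableOn (fun ζ => (u ζ : ℂ)) Γ := hu.ofReal
  refine Integrable.mono' hu'.norm (hu'.aestronglyMeasurable.mul hr.aestronglyMeasurable) ?_
  filter_upwards with ζ
  have : absR₀ ζ ≤ 1 := Real.sqrt_le_one.mpr (by nlinarith [sq_nonneg ζ])
  rw [norm_mul, R₀cut, norm_mul, Complex.norm_I, one_mul, Complex.norm_real (absR₀ ζ),
    Real.norm_of_nonneg (absR₀_nonneg ζ)]
  exact mul_le_of_le_one_right (norm_nonneg _) this

theorem integral_mul_R₀cut (Γ : Set ℝ) (u : ℝ → ℝ) (k : ℕ) :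
    ∫ ζ in Γ, (u ζ : ℂ) * R₀cut ζ * (ζ : ℂ) ^ k =
      Complex.I * ((∫ ζ in Γ, u ζ * (ζ ^ k * absR₀ ζ) : ℝ) : ℂ) := by
  rw [← integral_complex_ofReal, ← integral_const_mul]
  refine integral_congr_ae (ae_of_all _ fun ζ => ?_)
  simp only [R₀cut]
  push_cast
  ring

theorem cauchyIntegral_inv (φ : ℝ → ℂ) (Γ : Set ℝ) {w : ℂ} (hw : w ≠ 0) :
    ∫ ζ in Γ, φ ζ / ((ζ : ℂ) - w⁻¹) = -w * ∫ ζ in Γ, φ ζ / (1 - (ζ : ℂ) * w) := by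
  rw [← integral_const_mul]
  refine integral_congr_ae (ae_of_all _ fun ζ => ?_)
  have : (ζ : ℂ) - w⁻¹ = (1 - (ζ : ℂ) * w) * -w⁻¹ := by field_simp; ring
  simp only [this]
  rw [← div_div, div_eq_mul_inv _ (-w⁻¹), inv_neg, inv_inv]
  ring

theorem laurentCoeff_eq {f : ℂ → ℂ} {m : ℕ} {c₀ c₁ c₂ c₃ c₄ : ℂ}
    (hd : ∀ z, 1 < ‖z‖ → DifferentiableAt ℂ f z)
    (hT : HasTaylor (fun w => w ^ 3 * ((w⁻¹) ^ m * f w⁻¹)) c₀ c₁ c₂ c₃ c₄) :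
    laurentCoeff f m = c₄ := by
  rw [laurentCoeff, circleIntegral_eq_residue_infinity (f := fun z => z ^ m * f z)
    (fun z hz => (differentiableAt_id.pow m).mul (hd z hz)) hT]
  rw [← mul_assoc, inv_mul_cancel₀ Complex.two_pi_I_ne_zero, one_mul]

theorem differentiableAt_dpdz (hΓ : Γ ⊆ Icc (-1) 1) (hm : MeasurableSet Γ)
    (hu : IntegrableOn u Γ) {z : ℂ} (hz : 1 < ‖z‖) : DifferentiableAt ℂ (dpdz Γ u) z := by
  have h0 := R₀_ne_zero hz
  have h1 := differentiableAt_R₀ hz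
  have h2 := differentiableAt_cauchyIntegral hΓ hm (integrableOn_mul_R₀cut hu) hz
  exact (differentiableAt_id.div h1 h0).sub
    (((differentiableAt_const Complex.I).div h1 h0).mul h2)

theorem differentiableAt_dqdz (hΓ : Γ ⊆ Icc (-1) 1) (hm : MeasurableSet Γ)
    (hu : IntegrableOn u Γ) {z : ℂ} (hz : 1 < ‖z‖) : DifferentiableAt ℂ (dqdz Γ u) z := by
  have h0 := R₀_ne_zero hz
  have h1 := differentiableAt_R₀ hz
  have h2 := differentiableAt_cauchyIntegral hΓ hm (integrableOn_mul_R₀cut hu) hz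
  exact ((h1.const_mul 2).add (((differentiableAt_id.pow 2).const_mul 2).div h1 h0)).sub
    (((differentiableAt_const Complex.I).div h1 h0).mul h2)

/-- With `z = 1/w` the differential is `(1 - w²)^(-1/2)` times `1 + i w²` times a moment series.
Each moment carries another `i` from `R₀cut`, whence the minus signs. -/
theorem hasTaylor_dpdz (hΓ : Γ ⊆ Icc (-1) 1) (hm : MeasurableSet Γ) (hu : IntegrableOn u Γ)
    {M : ℕ → ℝ} (hM : ∀ k, M k = ∫ ζ in Γ, u ζ * (ζ ^ k * absR₀ ζ)) :
    HasTaylor (fun w => dpdz Γ u w⁻¹) 1 0 ((1 / 2 - M 0 : ℝ) : ℂ) ((-M 1 : ℝ) : ℂ)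
      ((3 / 8 - M 0 / 2 - M 2 : ℝ) : ℂ) := by
  have hT := hasTaylor_cauchyIntegral hΓ hm (integrableOn_mul_R₀cut hu)
  have m0 := integral_mul_R₀cut Γ u 0
  have m1 := integral_mul_R₀cut Γ u 1
  have m2 := integral_mul_R₀cut Γ u 2
  rw [← hM] at m0 m1 m2
  simp only [pow_zero, pow_one, mul_one] at m0 m1
  have h1 : HasTaylor (fun _ : ℂ => (1 : ℂ)) 1 0 0 0 0 :=
    (hasTaylor_poly 1 0 0 0 0).of_eq (fun w _ => by ring) rfl rfl rfl rfl rfl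
  have h2 : HasTaylor (fun w : ℂ => Complex.I * w ^ 2) 0 0 Complex.I 0 0 :=
    (hasTaylor_poly 0 0 Complex.I 0 0).of_eq (fun w _ => by ring) rfl rfl rfl rfl rfl
  refine (hasTaylor_inv_diskRoot.mul (h1.add (h2.mul hT))).of_eq (fun w hw => ?_) ?_ ?_ ?_ ?_ ?_
  · rw [dpdz, R₀_eq, inv_inv, cauchyIntegral_inv _ _ hw]
    rw [div_mul_eq_div_div, div_mul_eq_div_div, div_self (inv_ne_zero hw)]
    field_simp
    ring
  · ring
  · ring
  · rw [m0]; push_cast; linear_combination (-(M 0 : ℂ)) * Complex.I_sq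
  · rw [m0, m1]; push_cast; linear_combination (-(M 1 : ℂ)) * Complex.I_sq
  · rw [m0, m2]; push_cast
    linear_combination (-((M 2 : ℂ) + (M 0 : ℂ) / 2)) * Complex.I_sq

theorem hasTaylor_dqdz (hΓ : Γ ⊆ Icc (-1) 1) (hm : MeasurableSet Γ) (hu : IntegrableOn u Γ)
    {M : ℕ → ℝ} (hM : ∀ k, M k = ∫ ζ in Γ, u ζ * (ζ ^ k * absR₀ ζ)) :
    HasTaylor (fun w => w * dqdz Γ u w⁻¹) 4 0 0 ((-M 0 : ℝ) : ℂ)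
      ((1 / 2 - M 1 : ℝ) : ℂ) := by
  have hT := hasTaylor_cauchyIntegral hΓ hm (integrableOn_mul_R₀cut hu)
  have m0 := integral_mul_R₀cut Γ u 0
  have m1 := integral_mul_R₀cut Γ u 1
  rw [← hM] at m0 m1
  simp only [pow_zero, pow_one, mul_one] at m0 m1
  have h1 : HasTaylor (fun w : ℂ => 4 - 2 * w ^ 2) 4 0 (-2) 0 0 :=
    (hasTaylor_poly 4 0 (-2) 0 0).of_eq (fun w _ => by ring) rfl rfl rfl rfl rfl
  have h2 : HasTaylor (fun w : ℂ => Complex.I * w ^ 3) 0 0 0 Complex.I 0 :=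
    (hasTaylor_poly 0 0 0 Complex.I 0).of_eq (fun w _ => by ring) rfl rfl rfl rfl rfl
  refine (hasTaylor_inv_diskRoot.mul (h1.add (h2.mul hT))).of_eq (fun w hw => ?_) ?_ ?_ ?_ ?_ ?_
  · rw [dqdz, R₀_eq, inv_inv, cauchyIntegral_inv _ _ hw]
    -- The identity is required at every `w ≠ 0`. Where the root vanishes both sides are `0` by the
    -- conventions for division; elsewhere `2R₀ + 2z²/R₀ = (4z² - 2)/R₀`.
    rcases eq_or_ne (diskRoot w) 0 with h | h
    · simp [h]
    · field_simp
      linear_combination 2 * diskRoot_sq w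
  · ring
  · ring
  · ring
  · rw [m0]; push_cast; linear_combination (-(M 0 : ℂ)) * Complex.I_sq
  · rw [m0, m1]; push_cast
    linear_combination (-(M 1 : ℂ)) * Complex.I_sq

theorem coeffI_one (hΓ : Γ ⊆ Icc (-1) 1) (hm : MeasurableSet Γ) (hu : IntegrableOn u Γ) :
    coeffI Γ u 1 = (∫ ζ in Γ, u ζ * absR₀ ζ) - 1 / 2 := by
  have h := hasTaylor_dpdz hΓ hm hu (fun k => rfl)
  have h2 : HasTaylor (fun w : ℂ => w ^ 2) 0 0 1 0 0 :=
    (hasTaylor_poly 0 0 1 0 0).of_eq (fun w _ => by ring) rfl rfl rfl rfl rfl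
  rw [coeffI, laurentCoeff_eq (fun z hz => differentiableAt_dpdz hΓ hm hu hz)
    ((h2.mul h).of_eq (fun w hw => by field_simp) rfl rfl rfl rfl rfl)]
  simp

theorem coeffI_three (hΓ : Γ ⊆ Icc (-1) 1) (hm : MeasurableSet Γ) (hu : IntegrableOn u Γ) :
    coeffI Γ u 3 = (∫ ζ in Γ, u ζ * (ζ ^ 2 * absR₀ ζ)) + (∫ ζ in Γ, u ζ * absR₀ ζ) / 2 - 3 / 8 := by
  have h := hasTaylor_dpdz hΓ hm hu (fun k => rfl)
  rw [coeffI, laurentCoeff_eq (fun z hz => differentiableAt_dpdz hΓ hm hu hz)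
    (h.of_eq (fun w hw => by field_simp) rfl rfl rfl rfl rfl), Complex.neg_re, Complex.ofReal_re]
  simp only [pow_zero, one_mul]
  ring

theorem coeffJ_two (hΓ : Γ ⊆ Icc (-1) 1) (hm : MeasurableSet Γ) (hu : IntegrableOn u Γ) :
    coeffJ Γ u 2 = (∫ ζ in Γ, u ζ * (ζ * absR₀ ζ)) - 1 / 2 := by
  have h := hasTaylor_dqdz hΓ hm hu (fun k => rfl)
  rw [coeffJ, laurentCoeff_eq (fun z hz => differentiableAt_dqdz hΓ hm hu hz)
    (h.of_eq (fun w hw => by field_simp) rfl rfl rfl rfl rfl), Complex.neg_re, Complex.ofReal_re]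
  simp only [pow_one]
  ring

end Coefficients

end DefNLS

/-! ### The averages in terms of the branch points, and the kurtosis. -/

namespace DefNLS

/-- The condensate exists, and its averages are determined by the branch points and `μ = E / K`. -/
theorem Branches.exists_averages {a₁ a₂ a₃ a₄ μ : ℝ} (ha : Branches a₁ a₂ a₃ a₄)
    (hμ : μ = ellipticE (modulus a₁ a₂ a₃ a₄) / ellipticK (modulus a₁ a₂ a₃ a₄)) :
    (∃ u v : ℝ → ℝ, IsCondensate (genusOneSupport a₁ a₂ a₃ a₄) u v) ∧
    ∀ e₁ e₂ e₃ e₄ c : ℝ, IsEsymm a₁ a₂ a₃ a₄ e₁ e₂ e₃ e₄ →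
      c = (a₁ * a₂ + a₃ * a₄ - (a₄ - a₂) * (a₃ - a₁) * μ) / 2 →
      ∀ u v : ℝ → ℝ, IsCondensate (genusOneSupport a₁ a₂ a₃ a₄) u v →
        meanSq (genusOneSupport a₁ a₂ a₃ a₄) u = 2 * c - e₂ + e₁ ^ 2 / 4 ∧
        meanFourth (genusOneSupport a₁ a₂ a₃ a₄) u v =
          -(16 / 3) * (e₄ / 2 - e₁ * e₃ / 2 - 3 / 8 * e₁ ^ 2 * c + e₂ * c / 2
              + 9 / 16 * e₁ ^ 2 * e₂ - 15 / 128 * e₁ ^ 4 - 3 / 8 * e₂ ^ 2)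
            + 2 * (-(3 / 2) * e₁ * e₃ - e₁ ^ 2 * c / 2 - e₂ ^ 2 / 2 + 5 / 4 * e₁ ^ 2 * e₂
              - 9 / 32 * e₁ ^ 4 + 2 * e₄) := by
  have gaps : ∀ e₁ e₂ e₃ e₄ c : ℝ, IsEsymm a₁ a₂ a₃ a₄ e₁ e₂ e₃ e₄ →
      c = (a₁ * a₂ + a₃ * a₄ - (a₄ - a₂) * (a₃ - a₁) * μ) / 2 →
      gapIntegral a₁ a₂ a₃ a₄ (momentumNum e₁ c) a₁ a₂ = 0 ∧
        gapIntegral a₁ a₂ a₃ a₄ (momentumNum e₁ c) a₃ a₄ = 0 := by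
    intro e₁ e₂ e₃ e₄ c he hc
    have g := ha.gapIntegral_quasimomentum (c := c) he.h₁ (by rw [hc, hμ])
    exact ⟨g, by rw [← g]; exact (ha.gapIntegral_eq he c).symm⟩
  refine ⟨?_, ?_⟩
  · obtain ⟨g₁, g₂⟩ := gaps _ _ _ _ _ ⟨rfl, rfl, rfl, rfl⟩ rfl
    exact ⟨_, _, ha.isCondensate_density ⟨rfl, rfl, rfl, rfl⟩ g₁ g₂⟩
  · intro e₁ e₂ e₃ e₄ c he hc u v huv
    obtain ⟨g₁, g₂⟩ := gaps _ _ _ _ _ he hc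
    have hΓ := ha.support_subset
    have hm := measurableSet_support a₁ a₂ a₃ a₄
    have m0 := ha.integral_dos_mul_absR₀ he g₁ g₂ huv.dos
    have m2 := ha.integral_dos_mul_sq_mul_absR₀ he g₁ g₂ huv.dos
    have n1 := ha.integral_dof_mul_id_mul_absR₀ he g₁ g₂ huv.dof
    have i1 := coeffI_one hΓ hm huv.dos.integrableOn
    have i3 := coeffI_three hΓ hm huv.dos.integrableOn
    have j2 := coeffJ_two hΓ hm huv.dof.integrableOn
    rw [m0] at i1
    rw [m0, m2] at i3
    rw [n1] at j2
    constructor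
    · rw [meanSq, meanF₁, i1]; ring
    · rw [meanFourth, meanF₃, meanG₂, i3, j2]; ring

end DefNLS

theorem mainTheorem9 (a₁ a₂ a₃ a₄ : ℝ) (h₀₁ : -1 ≤ a₁) (h₁₂ : a₁ < a₂) (h₂₃ : a₂ < a₃)
    (h₃₄ : a₃ < a₄) (h₄₅ : a₄ ≤ 1)
    (Γ : Set ℝ) (hΓ : Γ = DefNLS.genusOneSupport a₁ a₂ a₃ a₄)
    (m μ A B C D : ℝ)
    (hm : m = ((a₃ - a₄) * (-a₂ + a₁)) / ((a₂ - a₄) * (-a₃ + a₁)))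
    (hμ : μ = DefNLS.ellipticE m / DefNLS.ellipticK m)
    (hA : A = -8 * (-a₄ + a₂) * (-a₃ + a₁)
      * (4 * (a₁ ^ 2 + a₂ ^ 2 + a₃ ^ 2 + a₄ ^ 2) - (a₁ + a₂ + a₃ + a₄) ^ 2))
    (hB : B = 3 * a₁ ^ 4 + (12 * a₂ - 12 * a₃ - 12 * a₄) * a₁ ^ 3
      + (2 * a₂ ^ 2 + (-20 * a₃ - 20 * a₄) * a₂ + 18 * a₃ ^ 2 + 20 * a₄ * a₃ + 18 * a₄ ^ 2) * a₁ ^ 2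
      + (12 * a₂ ^ 3 - 4 * (a₃ + a₄) * (5 * a₂ ^ 2 - 5 * a₃ * a₂ - 5 * a₄ * a₂
          + 3 * a₃ ^ 2 + 2 * a₄ * a₃ + 3 * a₄ ^ 2)) * a₁
      + 3 * a₂ ^ 4 + (-12 * a₃ - 12 * a₄) * a₂ ^ 3
      + (18 * a₃ ^ 2 + 20 * a₄ * a₃ + 18 * a₄ ^ 2) * a₂ ^ 2
      + (-12 * a₃ ^ 3 - 20 * a₃ ^ 2 * a₄ - 20 * a₃ * a₄ ^ 2 - 12 * a₄ ^ 3) * a₂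
      + 3 * a₃ ^ 4 + 12 * a₃ ^ 3 * a₄ + 2 * a₃ ^ 2 * a₄ ^ 2 + 12 * a₃ * a₄ ^ 3 + 3 * a₄ ^ 4)
    (hC : C = 4 * (-a₄ + a₂) * (-a₃ + a₁))
    (hD : D = -(a₁ + a₂ - a₃ - a₄) ^ 2) :
    (∃ u v : ℝ → ℝ, DefNLS.IsCondensate Γ u v) ∧
    ∀ u v : ℝ → ℝ, DefNLS.IsCondensate Γ u v →
      0 < DefNLS.meanSq Γ u ∧ C * μ + D ≠ 0 ∧
      DefNLS.kurtosis Γ u v = (A * μ + B) / (3 * (C * μ + D) ^ 2) := by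
  subst hΓ
  have ha : DefNLS.Branches a₁ a₂ a₃ a₄ := ⟨h₀₁, h₁₂, h₂₃, h₃₄, h₄₅⟩
  have hmod : m = DefNLS.modulus a₁ a₂ a₃ a₄ := by
    rw [hm, DefNLS.modulus]
    congr 1 <;> ring
  rw [hmod] at hμ
  obtain ⟨hex, hall⟩ := ha.exists_averages hμ
  refine ⟨hex, fun u v huv => ?_⟩
  obtain ⟨h2, h4⟩ := hall _ _ _ _ _ ⟨rfl, rfl, rfl, rfl⟩ rfl u v huv
  -- With `c` written through `μ`, both averages are polynomial identities in the branch points and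
  -- `μ`. The factors `1/4` and `1/48` give the `3` in the kurtosis.
  have e2 : DefNLS.meanSq (DefNLS.genusOneSupport a₁ a₂ a₃ a₄) u = -(C * μ + D) / 4 := by
    rw [h2, hC, hD]; ring
  have e4 : DefNLS.meanFourth (DefNLS.genusOneSupport a₁ a₂ a₃ a₄) u v = (A * μ + B) / 48 := by
    rw [h4, hA, hB]; ring
  have hμ1 : μ < 1 := by
    rw [hμ, div_lt_one (DefNLS.ellipticK_pos ha.modulus_lt_one)]
    exact DefNLS.ellipticE_lt_ellipticK ha.modulus_pos ha.modulus_lt_one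
  have hneg : C * μ + D < 0 := by
    have hC0 : 0 < C := by
      rw [hC]
      have := mul_pos (show 0 < a₄ - a₂ by linarith) (show 0 < a₃ - a₁ by linarith)
      linarith
    have h1 : C * μ < C * 1 := mul_lt_mul_of_pos_left hμ1 hC0
    -- With `p = a₄ - a₂` and `q = a₃ - a₁` one has `C = 4pq` and `D = -(p + q)²`, so `C + D = -(p -
    -- q)²`.
    have h3 : C + D ≤ 0 := by
      rw [hC, hD]
      linarith [sq_nonneg ((a₄ - a₂) - (a₃ - a₁))]
    linarith
  refine ⟨by rw [e2]; linarith, hneg.ne, ?_⟩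
  have hne := hneg.ne
  rw [DefNLS.kurtosis, e2, e4]
  field_simp
  ring
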